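/- There are an absolute constant $C$ and deterministic word-RAM algorithms for preprocessing and reporting such that the following holds for every undirected simple graph $G=(V,E)$ with $n=|V|\ge 2$ vertices and $m=|E|$ edges, on every word RAM whose words have $w\ge C\log_2 n$ bits (unit cost per memory access, arithmetic operation, comparison or test). Given a list of the edges of $G$, the preprocessing algorithm builds a data structure $\mathcal D$ consisting of at most $C\,m\log_2 n$ words, i.e. of size $O(m\log n)$. Given $\mathcal D$ and a list of any set $U$ of $k\le n$ edges to be inserted, the reporting algorithm reports a DFS tree of $G+U$ in at most $C\,n\log_2^3 n$ steps, i.e. in $O(n\log^3 n)$ time. Here $G+U$ is the graph obtained from $G$ by inserting the edges in $U$. Since graphs need not be connected, a DFS tree of $G+U$ means a DFS tree rooted at $r$ of the graph obtained from $G+U$ by adding a dummy vertex $r$ adjacent to all vertices in $V$; the subtrees rooted at the children of $r$ are then DFS trees of the connected components of $G+U$. A DFS tree of a graph $H$ rooted at $r$ is a spanning tree of $H$ rooted at $r$ such that the endpoints of every edge of $H$ are in ancestor-descendant relation in the tree. It is reported by giving the parent of each vertex in $V$. -/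

import Mathlib

namespace DynDFS

/-! ### The word RAM

Programs are built from assignments, conditionals and loops over finitely many registers and
finitely many random access arrays of `w`-bit words, all named by literals of the program.  Every
read, write, arithmetic operation, comparison and test costs one step; arithmetic is modulo
`2 ^ w`. -/

/-- The machine's memory: registers and arrays. -/
structure State where
  reg : ℕ → ℕ
  arr : ℕ → ℕ → ℕ

/-- The binary operations on words. -/
inductive BinOp where
  | add
  | sub
  | mul
  | div
  | lt
  | eq

/-- The result of an operation on `w`-bit words. Subtraction is truncated at `0`, `div` is integer
division, and a comparison yields `1` if it holds and `0` if not. -/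
def BinOp.apply (w : ℕ) : BinOp → ℕ → ℕ → ℕ
  | .add, a, b => (a + b) % 2 ^ w
  | .sub, a, b => a - b
  | .mul, a, b => (a * b) % 2 ^ w
  | .div, a, b => a / b
  | .lt, a, b => if a < b then 1 else 0
  | .eq, a, b => if a = b then 1 else 0

/-- Word-valued expressions. `get a e` is the entry of array `a` at index `e`. -/
inductive Expr where
  | lit (c : ℕ)
  | reg (r : ℕ)
  | get (a : ℕ) (e : Expr)
  | op (o : BinOp) (e₁ e₂ : Expr)

/-- The value of an expression on a machine with `w`-bit words. -/
def Expr.eval (w : ℕ) (s : State) : Expr → ℕ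
  | .lit c => c % 2 ^ w
  | .reg r => s.reg r
  | .get a e => s.arr a (e.eval w s)
  | .op o e₁ e₂ => o.apply w (e₁.eval w s) (e₂.eval w s)

/-- The number of steps taken to evaluate an expression: one for each of its nodes. -/
def Expr.cost : Expr → ℕ
  | .lit _ => 1
  | .reg _ => 1
  | .get _ e => e.cost + 1
  | .op _ e₁ e₂ => e₁.cost + e₂.cost + 1

/-- Programs. A test `e` succeeds when the value of `e` is nonzero. -/
inductive Prog where
  | skip
  | setReg (r : ℕ) (e : Expr)
  | setArr (a : ℕ) (i e : Expr)
  | seq (p q : Prog)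
  | cond (e : Expr) (p q : Prog)
  | loop (e : Expr) (p : Prog)

/-- Write `x` to register `r`. -/
def State.putReg (s : State) (r x : ℕ) : State :=
  { s with reg := Function.update s.reg r x }

/-- Write `x` to entry `i` of array `a`. -/
def State.putArr (s : State) (a i x : ℕ) : State :=
  { s with arr := Function.update s.arr a (Function.update (s.arr a) i x) }

/-- `Exec w p s s' t`: with `w`-bit words, program `p` started in memory state `s` halts in memory
state `s'` after exactly `t` steps. -/
inductive Exec (w : ℕ) : Prog → State → State → ℕ → Prop where
  | skip (s : State) : Exec w .skip s s 1
  | setReg (r : ℕ) (e : Expr) (s : State) :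
      Exec w (.setReg r e) s (s.putReg r (e.eval w s)) (e.cost + 1)
  | setArr (a : ℕ) (i e : Expr) (s : State) :
      Exec w (.setArr a i e) s (s.putArr a (i.eval w s) (e.eval w s)) (i.cost + e.cost + 1)
  | seq {p q : Prog} {s₁ s₂ s₃ : State} {t₁ t₂ : ℕ} :
      Exec w p s₁ s₂ t₁ → Exec w q s₂ s₃ t₂ → Exec w (.seq p q) s₁ s₃ (t₁ + t₂)
  | condTrue {e : Expr} {p q : Prog} {s s' : State} {t : ℕ} :
      e.eval w s ≠ 0 → Exec w p s s' t → Exec w (.cond e p q) s s' (e.cost + 1 + t)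
  | condFalse {e : Expr} {p q : Prog} {s s' : State} {t : ℕ} :
      e.eval w s = 0 → Exec w q s s' t → Exec w (.cond e p q) s s' (e.cost + 1 + t)
  | loopTrue {e : Expr} {p : Prog} {s₁ s₂ s₃ : State} {t₁ t₂ : ℕ} :
      e.eval w s₁ ≠ 0 → Exec w p s₁ s₂ t₁ → Exec w (.loop e p) s₂ s₃ t₂ →
        Exec w (.loop e p) s₁ s₃ (e.cost + 1 + t₁ + t₂)
  | loopFalse {e : Expr} {p : Prog} {s : State} :
      e.eval w s = 0 → Exec w (.loop e p) s s (e.cost + 1)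

/-- The memory holding the given inputs in its first registers and its first arrays, and `0`
everywhere else. -/
def inputState (regs : List ℕ) (arrs : List (List ℕ)) : State where
  reg r := regs.getD r 0
  arr a i := (arrs.getD a []).getD i 0

/-! ### Graphs and DFS trees -/

/-- `L` lists the edges in `S`, each exactly once, as pairs of endpoints; the order of the list and
of the two endpoints of an edge is arbitrary. -/
def Lists {V : Type*} (L : List (V × V)) (S : Set (Sym2 V)) : Prop :=
  (L.map fun p => s(p.1, p.2)).Nodup ∧ ∀ e, e ∈ S ↔ e ∈ L.map fun p => s(p.1, p.2)

/-- The first endpoints in a list of pairs of vertices, as an array of words. -/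
def fsts {n : ℕ} (L : List (Fin n × Fin n)) : List ℕ := L.map fun p => p.1.val

/-- The second endpoints in a list of pairs of vertices, as an array of words. -/
def snds {n : ℕ} (L : List (Fin n × Fin n)) : List ℕ := L.map fun p => p.2.val

/-- The graph `G + U` obtained from `G` by inserting the edges in `U`. -/
def insertEdges {V : Type*} (G : SimpleGraph V) (U : Finset (Sym2 V)) : SimpleGraph V :=
  G ⊔ SimpleGraph.fromEdgeSet (U : Set (Sym2 V))

/-- The augmented graph: `G` together with a dummy vertex, the last one, that is joined to every
vertex of `G`. -/
def augment {n : ℕ} (G : SimpleGraph (Fin n)) : SimpleGraph (Fin (n + 1)) :=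
  G.map Fin.castSucc ⊔ SimpleGraph.fromRel fun u _ => u = Fin.last n

/-- In the rooted tree with parent map `par`, `a` is an ancestor of `v` (or `v` itself). -/
def IsAncestor {V : Type*} (par : V → V) (a v : V) : Prop :=
  ∃ i : ℕ, par^[i] v = a

/-- `par` is the parent map of a DFS tree of `H` rooted at `r`: a spanning tree of `H` rooted at `r`
such that each edge of `H` joins a vertex to one of its ancestors. The root is its own parent. -/
structure IsDFSTree {V : Type*} (H : SimpleGraph V) (r : V) (par : V → V) : Prop where
  root : par r = r
  adj_par : ∀ v, v ≠ r → H.Adj v (par v)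
  root_ancestor : ∀ v, IsAncestor par r v
  no_cross : ∀ u v, H.Adj u v → IsAncestor par u v ∨ IsAncestor par v u

/-! ### Reading the results off the memory -/

/-- The data structure left by the preprocessing: the first words of array `0`, their number being
in register `0`. -/
def builtData (s : State) : List ℕ := (List.range (s.reg 0)).map (s.arr 0)

/-- The memory reports a DFS tree of `H`, rooted at the dummy vertex of the augmented graph: entry
`v` of array `0` is the parent of `v`, the dummy vertex being denoted by `n`. -/
def ReportsDFSTree {n : ℕ} (H : SimpleGraph (Fin n)) (s : State) : Prop :=
  ∃ par : Fin (n + 1) → Fin (n + 1), IsDFSTree (augment H) (Fin.last n) par ∧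
    ∀ v : Fin n, s.arr 0 v = par v.castSucc

end DynDFS

/-! The data structure is a DFS tree of `G` with preorder numbers, together with a sorted list of
edge keys. A DFS tree of `G + U` is then rebuilt while looking at only O(n) edges of `G`.

The new search visits whole paths of the old tree. Between paths the visited set is closed under old
parents (`MainInv.closed`), so the unvisited vertices form complete subtrees of the old tree. When
the search enters such an untouched subtree with root `x` at a vertex `a₀`, it visits the old tree
path from `a₀` up to `x`. What remains is the subtrees hanging from that path. Edges of `G` join
only ancestors and descendants, so no edge joins two hanging subtrees, and an edge leaving the
subtree of `x` ends at an old ancestor of `x`, which is visited already.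

For each hanging subtree just one edge of `G` enters the reduced adjacency lists: the one whose
endpoint on the path is nearest to `x`. The path is traversed upwards and becomes a chain of the new
tree, so this endpoint is the neighbour of the subtree that was visited last and lies deepest. The
stack finishes it before the other neighbours on the path, so the omitted edges cannot become cross
edges. `Reachable` makes this precise: every edge of `G` from a stack vertex `p` into an untouched
subtree is covered by a list entry for that subtree at a stack vertex numbered no earlier than `p`.
Hence, if the top of the stack has an empty list, all its neighbours are visited (`MainInv.finish`),
and the usual argument for depth first search (`DFSInv.push`, `DFSInv.pop`) applies. `PathInv.serve`
and `PathInv.done` restore the covering property after each path. Inserted edges and edges at the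
dummy root are in the lists in full from the start.

The edge to serve is found by a range query: the numbers of the lower endpoints must lie in an
interval, namely that of the hanging subtree, and the number of the upper endpoint must be at least
that of `x` and minimal. Two dyadic blocks per level suffice (`exists_block`), and each block takes
one binary search in the list of keys `(2 ^ k, d u / 2 ^ k, d z, u, z)` (`search_runs`). A query
takes O(log² n) steps and every vertex is served at most once, which gives O(n log² n), within the
claimed bound. The list has one entry per edge and level, hence O(m log n) words.

If `m < n`, the tree alone might already be too large, so only the edges are stored. Then `G + U`
has fewer than `2 * n` edges counted with the inserted ones, and a plain search suffices. This is
the same program run with a star as the old tree (`setup_star`), where no queries occur; the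
preprocessing itself uses it to find its tree.

Time is accounted for by budgets in the loop rule `Runs.loop` and by the potential `weight`, which
also bounds the number of list cells and so excludes overflow. -/

namespace DynDFS

/-! ### Program logic -/

/-- Sequential composition. -/
infixr:65 " ;; " => Prog.seq

theorem State.putReg_reg (s : State) (r x r' : ℕ) :
    (s.putReg r x).reg r' = if r' = r then x else s.reg r' := by
  simp [State.putReg, Function.update_apply]

@[simp] theorem State.putReg_arr (s : State) (r x : ℕ) : (s.putReg r x).arr = s.arr := rfl

@[simp] theorem State.putArr_reg (s : State) (a i x : ℕ) : (s.putArr a i x).reg = s.reg := rfl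

theorem State.putArr_arr (s : State) (a i x a' : ℕ) :
    (s.putArr a i x).arr a' = if a' = a then Function.update (s.arr a) i x else s.arr a' := by
  simp only [State.putArr, Function.update_apply]

/-- Program `p`, started in `s`, halts in a state and after a number of steps that satisfy `Q`. -/
def Runs (w : ℕ) (p : Prog) (s : State) (Q : State → ℕ → Prop) : Prop :=
  ∃ s' t, Exec w p s s' t ∧ Q s' t

theorem runs_setReg {w r e s Q} :
    Runs w (.setReg r e) s Q ↔ Q (s.putReg r (e.eval w s)) (e.cost + 1) := by
  constructor
  · rintro ⟨s', t, h, hQ⟩; cases h; exact hQ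
  · exact fun h => ⟨_, _, .setReg r e s, h⟩

theorem runs_setArr {w a i e s Q} :
    Runs w (.setArr a i e) s Q ↔
      Q (s.putArr a (i.eval w s) (e.eval w s)) (i.cost + e.cost + 1) := by
  constructor
  · rintro ⟨s', t, h, hQ⟩; cases h; exact hQ
  · exact fun h => ⟨_, _, .setArr a i e s, h⟩

theorem runs_skip {w s Q} : Runs w .skip s Q ↔ Q s 1 := by
  constructor
  · rintro ⟨s', t, h, hQ⟩; cases h; exact hQ
  · exact fun h => ⟨_, _, .skip s, h⟩

theorem runs_seq {w p q s Q} :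
    Runs w (p ;; q) s Q ↔ Runs w p s fun s₁ t₁ => Runs w q s₁ fun s₂ t₂ => Q s₂ (t₁ + t₂) := by
  constructor
  · rintro ⟨s', t, h, hQ⟩
    cases h with
    | seq h₁ h₂ => exact ⟨_, _, h₁, _, _, h₂, hQ⟩
  · rintro ⟨s₁, t₁, h₁, s₂, t₂, h₂, hQ⟩
    exact ⟨_, _, .seq h₁ h₂, hQ⟩

theorem runs_cond {w e p q s Q} :
    Runs w (.cond e p q) s Q ↔
      (e.eval w s ≠ 0 → Runs w p s fun s' t => Q s' (e.cost + 1 + t)) ∧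
      (e.eval w s = 0 → Runs w q s fun s' t => Q s' (e.cost + 1 + t)) := by
  constructor
  · rintro ⟨s', t, h, hQ⟩
    cases h with
    | condTrue h₁ h₂ => exact ⟨fun _ => ⟨_, _, h₂, hQ⟩, fun h => absurd h h₁⟩
    | condFalse h₁ h₂ => exact ⟨fun h => absurd h₁ h, fun _ => ⟨_, _, h₂, hQ⟩⟩
  · rintro ⟨h₁, h₂⟩
    by_cases h : e.eval w s = 0
    · obtain ⟨s', t, hx, hQ⟩ := h₂ h
      exact ⟨_, _, .condFalse h hx, hQ⟩
    · obtain ⟨s', t, hx, hQ⟩ := h₁ h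
      exact ⟨_, _, .condTrue h hx, hQ⟩

/-- The registers that a program may write. -/
def Prog.regs : Prog → List ℕ
  | .skip => []
  | .setReg r _ => [r]
  | .setArr _ _ _ => []
  | .seq p q => p.regs ++ q.regs
  | .cond _ p q => p.regs ++ q.regs
  | .loop _ p => p.regs

/-- The arrays that a program may write. -/
def Prog.arrs : Prog → List ℕ
  | .skip => []
  | .setReg _ _ => []
  | .setArr a _ _ => [a]
  | .seq p q => p.arrs ++ q.arrs
  | .cond _ p q => p.arrs ++ q.arrs
  | .loop _ p => p.arrs

/-- `s` and `s'` agree on all registers and arrays that `p` does not write. -/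
structure Frame (p : Prog) (s s' : State) : Prop where
  reg : ∀ r, r ∉ p.regs → s'.reg r = s.reg r
  arr : ∀ a, a ∉ p.arrs → s'.arr a = s.arr a

theorem Frame.rfl' (p : Prog) (s : State) : Frame p s s := ⟨fun _ _ => rfl, fun _ _ => rfl⟩

theorem Frame.trans {p : Prog} {s₁ s₂ s₃ : State} (h : Frame p s₁ s₂) (h' : Frame p s₂ s₃) :
    Frame p s₁ s₃ :=
  ⟨fun r hr => (h'.reg r hr).trans (h.reg r hr), fun a ha => (h'.arr a ha).trans (h.arr a ha)⟩

theorem Frame.mono {p q : Prog} {s s' : State} (h : Frame p s s')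
    (hr : ∀ r, r ∈ p.regs → r ∈ q.regs) (ha : ∀ a, a ∈ p.arrs → a ∈ q.arrs) : Frame q s s' :=
  ⟨fun r h' => h.reg r fun h'' => h' (hr r h''), fun a h' => h.arr a fun h'' => h' (ha a h'')⟩

/-- Since programs name registers and arrays by literals, the lists of what a program writes can be
computed. This lets `decide` settle every question of non-interference below. -/
theorem Exec.frame {w p s s' t} (h : Exec w p s s' t) : Frame p s s' := by
  induction h with
  | skip s => exact .rfl' _ _
  | setReg r e s =>
    refine ⟨fun r' hr => ?_, fun _ _ => rfl⟩
    simp only [Prog.regs, List.mem_singleton] at hr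
    simp [State.putReg_reg, hr]
  | setArr a i e s =>
    refine ⟨fun _ _ => rfl, fun a' ha => ?_⟩
    simp only [Prog.arrs, List.mem_singleton] at ha
    simp [State.putArr_arr, ha]
  | seq _ _ ih₁ ih₂ =>
    exact (ih₁.mono (by simp +contextual [Prog.regs]) (by simp +contextual [Prog.arrs])).trans
      (ih₂.mono (by simp +contextual [Prog.regs]) (by simp +contextual [Prog.arrs]))
  | condTrue _ _ ih =>
    exact ih.mono (by simp +contextual [Prog.regs]) (by simp +contextual [Prog.arrs])
  | condFalse _ _ ih =>
    exact ih.mono (by simp +contextual [Prog.regs]) (by simp +contextual [Prog.arrs])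
  | loopTrue _ _ _ ih₁ ih₂ =>
    exact Frame.trans (ih₁.mono (fun _ h => h) (fun _ h => h)) ih₂
  | loopFalse _ => exact .rfl' _ _

theorem Runs.mono {w p s} {Q Q' : State → ℕ → Prop} (h : Runs w p s Q)
    (hQ : ∀ s' t, Frame p s s' → Q s' t → Q' s' t) : Runs w p s Q' := by
  obtain ⟨s', t, hx, h⟩ := h
  exact ⟨s', t, hx, hQ s' t hx.frame h⟩

/-- The rule for loops: `I s B` says that the invariant holds in `s`, where `B` steps are left. -/
theorem Runs.loop {w e p s₀ B₀} (I : State → ℕ → Prop) (h₀ : I s₀ B₀)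
    (hstep : ∀ s B, Frame p s₀ s → I s B → e.eval w s ≠ 0 →
      Runs w p s fun s' t => ∃ B', I s' B' ∧ e.cost + 1 + t + B' ≤ B) :
    Runs w (.loop e p) s₀ fun s t =>
      (∃ B, I s B ∧ t + B ≤ B₀ + e.cost + 1) ∧ e.eval w s = 0 := by
  suffices H : ∀ B s, Frame p s₀ s → I s B → Runs w (.loop e p) s fun s t =>
      (∃ B', I s B' ∧ t + B' ≤ B + e.cost + 1) ∧ e.eval w s = 0 from H B₀ s₀ (.rfl' _ _) h₀
  -- The budget is itself the measure of the induction: every pass costs at least one step, so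
  -- termination and the time bound come together.
  intro B
  induction B using Nat.strong_induction_on with
  | _ B ih =>
    intro s hF hI
    by_cases he : e.eval w s = 0
    · exact ⟨s, _, .loopFalse he, ⟨B, hI, by omega⟩, he⟩
    · obtain ⟨s₁, t₁, hx₁, B₁, hI₁, hB₁⟩ := hstep s B hF hI he
      obtain ⟨s₂, t₂, hx₂, ⟨B₂, hI₂, hB₂⟩, he₂⟩ := ih B₁ (by omega) s₁ (hF.trans hx₁.frame) hI₁
      exact ⟨s₂, _, .loopTrue he hx₁ hx₂, ⟨B₂, hI₂, by omega⟩, he₂⟩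

/-! ### Expressions -/

instance : Add Expr := ⟨.op .add⟩
instance : Sub Expr := ⟨.op .sub⟩
instance : Mul Expr := ⟨.op .mul⟩
instance : Div Expr := ⟨.op .div⟩
instance (c : ℕ) : OfNat Expr c := ⟨.lit c⟩

section eval
variable {w : ℕ} {s : State} {a b : Expr}

@[simp] theorem eval_add : (a + b).eval w s = (a.eval w s + b.eval w s) % 2 ^ w := rfl
@[simp] theorem eval_sub : (a - b).eval w s = a.eval w s - b.eval w s := rfl
@[simp] theorem eval_mul : (a * b).eval w s = (a.eval w s * b.eval w s) % 2 ^ w := rfl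
@[simp] theorem eval_div : (a / b).eval w s = a.eval w s / b.eval w s := rfl
@[simp] theorem eval_lt_eq_zero : (Expr.op .lt a b).eval w s = 0 ↔ b.eval w s ≤ a.eval w s := by
  simp [Expr.eval, BinOp.apply]
@[simp] theorem eval_eq_eq_zero : (Expr.op .eq a b).eval w s = 0 ↔ a.eval w s ≠ b.eval w s := by
  simp [Expr.eval, BinOp.apply]
@[simp] theorem eval_lit {c : ℕ} :
    (no_index (OfNat.ofNat c) : Expr).eval w s = OfNat.ofNat c % 2 ^ w := rfl
@[simp] theorem eval_reg {r : ℕ} : (Expr.reg r).eval w s = s.reg r := rfl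
@[simp] theorem eval_get {r : ℕ} : (Expr.get r a).eval w s = s.arr r (a.eval w s) := rfl

@[simp] theorem cost_add : (a + b).cost = a.cost + b.cost + 1 := rfl
@[simp] theorem cost_sub : (a - b).cost = a.cost + b.cost + 1 := rfl
@[simp] theorem cost_mul : (a * b).cost = a.cost + b.cost + 1 := rfl
@[simp] theorem cost_div : (a / b).cost = a.cost + b.cost + 1 := rfl
@[simp] theorem cost_op {o : BinOp} : (Expr.op o a b).cost = a.cost + b.cost + 1 := rfl
@[simp] theorem cost_lit {c : ℕ} : (no_index (OfNat.ofNat c) : Expr).cost = 1 := rfl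
@[simp] theorem cost_reg {r : ℕ} : (Expr.reg r).cost = 1 := rfl
@[simp] theorem cost_get {r : ℕ} : (Expr.get r a).cost = a.cost + 1 := rfl

end eval

attribute [simp] runs_setReg runs_setArr runs_skip runs_seq runs_cond State.putReg_reg
  State.putArr_arr


/-! ### The range queries -/

/-- The number with the digits `pw`, `j`, `dz`, `u` and `z` in base `B`. -/
def comp (B pw j dz u z : ℕ) : ℕ := (((pw * B + j) * B + dz) * B + u) * B + z

theorem comp_div {B pw j dz u z : ℕ} (hz : z < B) :
    comp B pw j dz u z / B = ((pw * B + j) * B + dz) * B + u := by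
  rw [comp, Nat.add_comm, Nat.add_mul_div_right _ _ (by omega), Nat.div_eq_of_lt hz, Nat.zero_add]

theorem digit_div {B x y : ℕ} (hy : y < B) : (x * B + y) / B = x := by
  rw [Nat.add_comm, Nat.add_mul_div_right _ _ (by omega), Nat.div_eq_of_lt hy, Nat.zero_add]

theorem digit_lt {B x y k : ℕ} (hx : x < B ^ k) (hy : y < B) : x * B + y < B ^ (k + 1) := by
  rw [pow_succ]
  calc x * B + y < x * B + B := by omega
    _ = (x + 1) * B := by ring
    _ ≤ B ^ k * B := Nat.mul_le_mul_right _ hx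

/-- A key has five digits in base `n + 2`; this is the source of the requirement `(n + 2) ^ 5 ≤ 2 ^
w`. -/
theorem comp_lt {B pw j dz u z : ℕ} (h₁ : pw < B) (h₂ : j < B) (h₃ : dz < B) (h₄ : u < B)
    (h₅ : z < B) : comp B pw j dz u z < B ^ 5 :=
  digit_lt (digit_lt (digit_lt (digit_lt (k := 1) (by simpa using h₁) h₂) h₃) h₄) h₅

/-- Binary search for register `28` in the part of array `0` from `3 * n` on. -/
def searchLoop : Prog :=
  .loop (.op .lt (.reg 25) (.reg 26)) <|
    .setReg 27 ((.reg 25 + .reg 26) / 2) ;;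
    .cond (.op .lt (.get 0 (3 * .reg 0 + .reg 27)) (.reg 28))
      (.setReg 25 (.reg 27 + 1))
      (.setReg 26 (.reg 27))

/-- The search interval has length below `2 ^ b'` and halves in each pass, so 30 steps per bit
suffice. Register 25 ends at the first index whose entry is not below the key. -/
theorem searchLoop_runs {w : ℕ} {s : State} {b : ℕ} {A : ℕ → ℕ} {M : ℕ}
    (hlo : s.reg 25 = 0) (hhi : s.reg 26 = M) (hMb : M < 2 ^ b)
    (hA : ∀ i, s.arr 0 (3 * s.reg 0 + i) = A i) (hmono : ∀ i j, i ≤ j → j < M → A i ≤ A j)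
    (hW : 3 * s.reg 0 + 2 * M + 3 < 2 ^ w) :
    Runs w searchLoop s fun s' t => t ≤ 30 * b + 4 ∧
      (∀ i < s'.reg 25, A i < s.reg 28) ∧ (∀ i, s'.reg 25 ≤ i → i < M → s.reg 28 ≤ A i) ∧
      s'.reg 25 ≤ M := by
  refine (Runs.loop (B₀ := 30 * b) (fun s' B => ∃ b', B = 30 * b' ∧
    s'.reg 26 - s'.reg 25 < 2 ^ b' ∧
    s'.reg 25 ≤ s'.reg 26 ∧ s'.reg 26 ≤ M ∧ (∀ i < s'.reg 25, A i < s.reg 28) ∧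
    (∀ i, s'.reg 26 ≤ i → i < M → s.reg 28 ≤ A i)) ?_ ?_).mono ?_
  · exact ⟨b, rfl, by omega, by omega, by omega, by simp [hlo], fun i hi => by omega⟩
  · rintro s' B hF ⟨b', rfl, h1, h2, h3, h4, h5⟩ he
    have r0 := hF.reg 0 (by decide)
    have r28 := hF.reg 28 (by decide)
    have a0 := hF.arr 0 (by decide)
    simp at he
    obtain _ | b' := b'
    · omega
    rw [pow_succ] at h1
    have hm : (s'.reg 25 + s'.reg 26) / 2 < M := by omega
    simp (disch := omega) [Nat.mod_eq_of_lt, r0, r28, a0, hA]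
    exact ⟨fun hc => ⟨b', ⟨by omega, by omega, h3, fun i hi => (hmono _ _ hi hm).trans_lt hc, h5⟩,
        by omega⟩,
      fun hc => ⟨b', ⟨by omega, by omega, by omega, h4,
        fun i hi hi' => hc.trans (hmono _ _ hi hi')⟩, by omega⟩⟩
  · rintro s' t hF ⟨⟨B, ⟨b', rfl, h1, h2, h3, h4, h5⟩, ht⟩, he⟩
    simp at he ht
    have : s'.reg 26 = s'.reg 25 := by omega
    exact ⟨by omega, h4, this ▸ h5, by omega⟩

/-- `D` is a data structure for the graph `GA` on the vertices `0, …, n - 1`: it holds the first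
and the last number `d v` and `l v` in the subtree of each vertex `v`, and a sorted list of `M`
words that has one entry for each edge and each power of two. -/
structure DSValid (n : ℕ) (GA : ℕ → ℕ → Prop) (d l : ℕ → ℕ) (D : ℕ → ℕ) (M : ℕ) : Prop where
  d_eq : ∀ v < n, D (n + v) = d v
  l_eq : ∀ v < n, D (2 * n + v) = l v
  mono : ∀ i j, i ≤ j → j < M → D (3 * n + i) ≤ D (3 * n + j)
  mem : ∀ y, (∃ i < M, D (3 * n + i) = y) ↔ ∃ k u z, 2 ^ k < n + 2 ∧ GA u z ∧ d z < d u ∧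
    y = comp (n + 2) (2 ^ k) (d u / 2 ^ k) (d z) u z
  bound : ∀ u z, GA u z → u < n ∧ z < n
  d_pos : ∀ v < n, 0 < d v
  d_lt : ∀ v < n, d v < n + 2
  l_lt : ∀ v < n, l v < n + 2

/-- Search for an edge in one block of numbers. -/
def search : Prog :=
  .setReg 30 (.reg 20 * .reg 4 + .reg 24) ;;
  .setReg 28 ((.reg 30 * .reg 4 + .reg 16) * .reg 4 * .reg 4) ;;
  .setReg 25 0 ;;
  .setReg 26 (.reg 3) ;;
  searchLoop ;;
  .cond (.op .lt (.reg 25) (.reg 3))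
    (.setReg 29 (.get 0 (3 * .reg 0 + .reg 25)) ;;
     .cond (.op .eq (.reg 29 / .reg 4 / .reg 4 / .reg 4) (.reg 30))
      (.setReg 33 (.reg 29 / .reg 4 / .reg 4 - .reg 30 * .reg 4) ;;
       .cond (.op .lt (.reg 33) (.reg 23))
        (.setReg 23 (.reg 33) ;;
         .setReg 31 (.reg 29 / .reg 4 - .reg 29 / .reg 4 / .reg 4 * .reg 4) ;;
         .setReg 32 (.reg 29 - .reg 29 / .reg 4 * .reg 4)) .skip) .skip) .skip

/-- The search key has the digits `2 ^ k, j, dx, 0, 0`. Keys are ordered lexicographically, so the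
first entry not below it, if it still starts with `2 ^ k, j`, has the smallest `d z ≥ dx` in the
block. If it starts differently or does not exist, the block has no suitable edge. -/
theorem search_runs {w n k b M dx j : ℕ} {GA : ℕ → ℕ → Prop} {d l : ℕ → ℕ} {s : State}
    (hD : DSValid n GA d l (s.arr 0) M) (hn : s.reg 0 = n) (hM : s.reg 3 = M)
    (hB : s.reg 4 = n + 2) (hdx : s.reg 16 = dx) (hdxB : dx < n + 2) (hk : s.reg 20 = 2 ^ k)
    (hkB : 2 ^ k < n + 2) (hj : s.reg 24 = j) (hjB : j < n + 2)
    (hMb : M < 2 ^ b) (hW : 3 * n + 2 * M + 3 < 2 ^ w) (hW' : (n + 2) ^ 5 ≤ 2 ^ w) :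
    Runs w search s fun s' t => t ≤ 30 * b + 100 ∧ s'.reg 23 ≤ s.reg 23 ∧
      (∀ u z, GA u z → d z < d u → d u / 2 ^ k = j → dx ≤ d z → s'.reg 23 ≤ d z) ∧
      ((s'.reg 23 = s.reg 23 ∧ s'.reg 31 = s.reg 31 ∧ s'.reg 32 = s.reg 32) ∨
        (GA (s'.reg 31) (s'.reg 32) ∧ d (s'.reg 32) < d (s'.reg 31) ∧ d (s'.reg 31) / 2 ^ k = j ∧
          dx ≤ d (s'.reg 32) ∧ s'.reg 23 = d (s'.reg 32))) := by
  have p2 : 2 ^ k * (n + 2) + j < (n + 2) ^ 2 := digit_lt (k := 1) (by simpa using hkB) hjB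
  have p3 := digit_lt p2 hdxB
  have p4 := digit_lt (y := 0) p3 (by omega)
  have p5 := digit_lt (y := 0) p4 (by omega)
  have m23 : (n + 2) ^ 2 ≤ (n + 2) ^ 5 := Nat.pow_le_pow_right (by omega) (by norm_num)
  have m34 : (n + 2) ^ 3 ≤ (n + 2) ^ 5 := Nat.pow_le_pow_right (by omega) (by norm_num)
  have m45 : (n + 2) ^ 4 ≤ (n + 2) ^ 5 := Nat.pow_le_pow_right (by omega) (by norm_num)
  simp only [Nat.add_zero, show 2 + 1 = 3 from rfl, show 3 + 1 = 4 from rfl,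
    show 4 + 1 = 5 from rfl] at p3 p4 p5
  have e2 : (2 ^ k * (n + 2)) % 2 ^ w = 2 ^ k * (n + 2) := Nat.mod_eq_of_lt (by omega)
  have e2' : (2 ^ k * (n + 2) + j) % 2 ^ w = 2 ^ k * (n + 2) + j := Nat.mod_eq_of_lt (by omega)
  have e3 : ((2 ^ k * (n + 2) + j) * (n + 2)) % 2 ^ w = (2 ^ k * (n + 2) + j) * (n + 2) :=
    Nat.mod_eq_of_lt (by omega)
  have e3' : ((2 ^ k * (n + 2) + j) * (n + 2) + dx) % 2 ^ w
      = (2 ^ k * (n + 2) + j) * (n + 2) + dx := Nat.mod_eq_of_lt (by omega)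
  have e4 := Nat.mod_eq_of_lt (p4.trans_le (m45.trans hW'))
  have e5 := Nat.mod_eq_of_lt (p5.trans_le hW')
  simp only [search, runs_seq, runs_setReg, eval_add, eval_mul, eval_reg, State.putReg_reg,
    Nat.reduceEqDiff, if_true, if_false, hk, hB, hj, hdx, e2, e2', e3, e3',
    e4, e5, hM]
  set base := 2 ^ k * (n + 2) + j with hbase
  refine (searchLoop_runs (A := fun i => s.arr 0 (3 * n + i)) (M := M) (b := b) ?_ ?_ hMb ?_ hD.mono
    ?_).mono ?_
  · simp
  · simp
  · simp [State.putReg_reg, hn]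
  · simpa [State.putReg_reg, hn] using hW
  rintro s₁ t₁ hF ⟨ht, hlt, hge, hle⟩
  have r0 := hF.reg 0 (by decide)
  have r3 := hF.reg 3 (by decide)
  have r4 := hF.reg 4 (by decide)
  have r23 := hF.reg 23 (by decide)
  have r28 := hF.reg 28 (by decide)
  have r30 := hF.reg 30 (by decide)
  have r31 := hF.reg 31 (by decide)
  have r32 := hF.reg 32 (by decide)
  have a0 := hF.arr 0 (by decide)
  simp at r0 r3 r4 r23 r28 r30 r31 r32 a0 hlt hge
  -- The entry of a suitable edge is not below the search key, so it sits at or after the position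
  -- found.
  have key : ∀ u z, GA u z → d z < d u → d u / 2 ^ k = j → dx ≤ d z →
      ∃ i, s₁.reg 25 ≤ i ∧ i < M ∧ s.arr 0 (3 * n + i) = comp (n + 2) (2 ^ k) j (d z) u z := by
    intro u z hG hd hdj hx
    obtain ⟨i, hi, hy⟩ := (hD.mem _).2 ⟨k, u, z, hkB, hG, hd, rfl⟩
    rw [hdj] at hy
    refine ⟨i, ?_, hi, hy⟩
    by_contra hc
    have := hlt i (by omega)
    rw [hy, comp, ← hbase] at this
    have h1 := Nat.mul_le_mul_right (n + 2) (Nat.add_le_add_left hx (base * (n + 2)))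
    have h2 := Nat.mul_le_mul_right (n + 2) (h1.trans (Nat.le_add_right _ u))
    omega
  by_cases hc : s₁.reg 25 < M
  · obtain ⟨k', u', z', hk', hG', hd', hv⟩ := (hD.mem _).1 ⟨_, hc, rfl⟩
    have bu := (hD.bound _ _ hG').1
    have bz := (hD.bound _ _ hG').2
    have bdu := hD.d_lt _ bu
    have bdz := hD.d_lt _ bz
    have bj : d u' / 2 ^ k' < n + 2 := (Nat.div_le_self _ _).trans_lt bdu
    have hval := hge _ le_rfl hc
    have low : ∀ u z, GA u z → d z < d u → d u / 2 ^ k = j → dx ≤ d z →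
        s.arr 0 (3 * n + s₁.reg 25) ≤ comp (n + 2) (2 ^ k) j (d z) u z := by
      intro u z hG hd hdj hx
      obtain ⟨i, h1, h2, h3⟩ := key u z hG hd hdj hx
      rw [← h3]
      exact hD.mono _ _ h1 h2
    obtain ⟨V, hV⟩ : ∃ V, s.arr 0 (3 * n + s₁.reg 25) = V := ⟨_, rfl⟩
    rw [hV] at hv hval low
    obtain ⟨V₁, c1⟩ : ∃ V₁, V / (n + 2) = V₁ := ⟨_, rfl⟩
    obtain ⟨V₂, c2⟩ : ∃ V₂, V₁ / (n + 2) = V₂ := ⟨_, rfl⟩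
    obtain ⟨V₃, c3⟩ : ∃ V₃, V₂ / (n + 2) = V₃ := ⟨_, rfl⟩
    have d1 : V₁ = ((2 ^ k' * (n + 2) + d u' / 2 ^ k') * (n + 2) + d z') * (n + 2) + u' := by
      rw [← c1, hv, comp_div (by omega)]
    have d2 : V₂ = (2 ^ k' * (n + 2) + d u' / 2 ^ k') * (n + 2) + d z' := by
      rw [← c2, d1, digit_div (by omega)]
    have d3 : V₃ = 2 ^ k' * (n + 2) + d u' / 2 ^ k' := by
      rw [← c3, d2, digit_div (by omega)]
    have q2 : 2 ^ k' * (n + 2) + d u' / 2 ^ k' < (n + 2) ^ 2 :=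
      digit_lt (k := 1) (by simpa using hk') bj
    have q3 := digit_lt q2 bdz
    have q4 := digit_lt q3 (y := u') (by omega)
    have q5 := comp_lt hk' bj bdz (u := u') (z := z') (by omega) (by omega)
    rw [← hv] at q5
    have q6 := Nat.div_mul_le_self V (n + 2)
    have q7 := Nat.div_mul_le_self V₁ (n + 2)
    rw [c1] at q6
    rw [c2] at q7
    have e6 : (V₁ * (n + 2)) % 2 ^ w = V₁ * (n + 2) := Nat.mod_eq_of_lt (by omega)
    have e7 : (V₂ * (n + 2)) % 2 ^ w = V₂ * (n + 2) := Nat.mod_eq_of_lt (by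
      have := Nat.le_mul_of_pos_right V₁ (show 0 < n + 2 by omega)
      omega)
    have e8 : 3 % 2 ^ w = 3 := Nat.mod_eq_of_lt (by omega)
    have e9 : (3 * n) % 2 ^ w = 3 * n := Nat.mod_eq_of_lt (by omega)
    have e10 : (3 * n + s₁.reg 25) % 2 ^ w = 3 * n + s₁.reg 25 := Nat.mod_eq_of_lt (by omega)
    simp [r0, r3, r4, r30, a0, hn, hM, hB, hc, e8, e9, e10, hV, c3, c2, c1,
      r23, r31, r32, e3, e6, e7]
    have hval1 : (base * (n + 2) + dx) * (n + 2) ≤ V₁ :=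
      c1 ▸ (Nat.le_div_iff_mul_le (by omega)).2 hval
    have hval2 : (base * (n + 2) + dx) ≤ V₂ :=
      c2 ▸ (Nat.le_div_iff_mul_le (by omega)).2 hval1
    refine ⟨fun hb => ?_, fun hb => ?_⟩
    · have hkk : 2 ^ k' = 2 ^ k := by
        have := congrArg (· / (n + 2)) (d3.symm.trans hb)
        simpa only [hbase, digit_div bj, digit_div hjB] using this
      have hjj : d u' / 2 ^ k = j := by
        rw [d3, hkk] at hb; omega
      rw [← d3, hb] at d2 d1
      have hdz : dx ≤ d z' := by omega
      -- Dividing twice by the base removes the digits `u` and `z`; as the two leading digits agree,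
      -- what is compared is `d z`.
      have hmin : ∀ u z, GA u z → d z < d u → d u / 2 ^ k = j → dx ≤ d z → d z' ≤ d z := by
        intro u z hG hd hdj hx
        have := low u z hG hd hdj hx
        have b1 := hD.bound _ _ hG
        have h2 := Nat.div_le_div_right (c := n + 2) (Nat.div_le_div_right (c := n + 2) this)
        rw [c1, c2, d2, comp_div (by omega), digit_div (by omega), ← hbase] at h2
        omega
      have g1 : V₂ - base * (n + 2) = d z' := by omega
      have g2 : V₁ - V₂ * (n + 2) = u' := by rw [d1, ← d2]; omega
      have g3 : V - V₁ * (n + 2) = z' := by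
        rw [hv, comp, ← d3, hb, ← d1]; omega
      rw [g1, g2, g3]
      refine ⟨fun h => ⟨by omega, by omega, ?_, ?_⟩, fun h => ⟨by omega, ?_⟩⟩
      · exact fun u z hG hd hdj hx => by have := hmin u z hG hd hdj hx; omega
      · exact Or.inr ⟨hG', hd', hjj, hdz, by omega⟩
      · exact fun u z hG hd hdj hx => by have := hmin u z hG hd hdj hx; omega
    -- A suitable edge would squeeze the leading digits of the found entry between `base` and
    -- `base`, contrary to the failed test.
    · refine ⟨by omega, fun u z hG hd hdj hx => ?_⟩
      exfalso
      apply hb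
      have := low u z hG hd hdj hx
      have b1 := hD.bound _ _ hG
      have b2 := hD.d_lt _ b1.2
      have h2 := Nat.div_le_div_right (c := n + 2) (Nat.div_le_div_right (c := n + 2)
        (Nat.div_le_div_right (c := n + 2) this))
      rw [c1, c2, c3, comp_div (by omega), digit_div (by omega), digit_div (by omega)] at h2
      have h3 := Nat.div_le_div_right (c := n + 2) hval2
      rw [digit_div hdxB, c3] at h3
      omega
  · simp [r3, hM, hc, r23, r31, r32]
    refine fun _ => ⟨by omega, fun u z hG hd hdj hx => ?_⟩
    obtain ⟨i, h1, h2, -⟩ := key u z hG hd hdj hx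
    omega

/-- What is known about the best edge found so far: its upper endpoint has number `best`. -/
def BestOk (n : ℕ) (GA : ℕ → ℕ → Prop) (d : ℕ → ℕ) (lo hi dx best u z : ℕ) : Prop :=
  best = n + 2 ∨
    (GA u z ∧ d z < d u ∧ lo ≤ d u ∧ d u ≤ hi ∧ dx ≤ d z ∧ best = d z)

theorem search_runs' {w n k b M dx j lo hi : ℕ} {GA : ℕ → ℕ → Prop} {d l : ℕ → ℕ} {s : State}
    (hD : DSValid n GA d l (s.arr 0) M) (hn : s.reg 0 = n) (hM : s.reg 3 = M)
    (hB : s.reg 4 = n + 2) (hdx : s.reg 16 = dx) (hdxB : dx < n + 2) (hk : s.reg 20 = 2 ^ k)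
    (hkB : 2 ^ k < n + 2) (hj : s.reg 24 = j) (hjB : j < n + 2)
    (hMb : M < 2 ^ b) (hW : 3 * n + 2 * M + 3 < 2 ^ w) (hW' : (n + 2) ^ 5 ≤ 2 ^ w)
    (hlo : lo ≤ j * 2 ^ k) (hhi : (j + 1) * 2 ^ k ≤ hi + 1)
    (hbest : BestOk n GA d lo hi dx (s.reg 23) (s.reg 31) (s.reg 32)) :
    Runs w search s fun s' t => t ≤ 30 * b + 100 ∧ s'.reg 23 ≤ s.reg 23 ∧
      (∀ u z, GA u z → d z < d u → d u / 2 ^ k = j → dx ≤ d z → s'.reg 23 ≤ d z) ∧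
      BestOk n GA d lo hi dx (s'.reg 23) (s'.reg 31) (s'.reg 32) := by
  refine (search_runs hD hn hM hB hdx hdxB hk hkB hj hjB hMb hW hW').mono ?_
  rintro s' t - ⟨h1, h2, h3, h4⟩
  refine ⟨h1, h2, h3, ?_⟩
  obtain ⟨h5, h6, h7⟩ | ⟨h5, h6, h7, h8, h9⟩ := h4
  · rwa [h5, h6, h7]
  · refine Or.inr ⟨h5, h6, ?_, ?_, h8, h9⟩
    · exact hlo.trans (h7 ▸ Nat.div_mul_le_self _ _)
    · have := Nat.lt_div_mul_add (a := d (s'.reg 31)) (b := 2 ^ k) (by positivity)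
      rw [h7] at this
      rw [add_mul, one_mul] at hhi
      omega


/-- Choose a level `k` where the dyadic block around `d` fits into `[l, h)` but its parent block
does not. If the block is a left half, the parent sticks out on the right, so this is the last block
of its size that fits; if it is a right half, it is the first. Hence two candidates per level cover
the whole range. -/
theorem exists_block {l h d : ℕ} (h₁ : l ≤ d) (h₂ : d < h) :
    ∃ k, l + 2 ^ k ≤ h ∧
      (((l + 2 ^ k - 1) / 2 ^ k + 1) * 2 ^ k ≤ h ∧ d / 2 ^ k = (l + 2 ^ k - 1) / 2 ^ k ∨
        l ≤ (h / 2 ^ k - 1) * 2 ^ k ∧ d / 2 ^ k = h / 2 ^ k - 1) := by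
  classical
  let P : ℕ → Prop := fun k => l ≤ d / 2 ^ k * 2 ^ k ∧ (d / 2 ^ k + 1) * 2 ^ k ≤ h
  have hP0 : P 0 := by simp only [P, pow_zero, Nat.div_one, mul_one]; omega
  -- A block of size `2 ^ k` that fits below `h` forces `k < 2 ^ k ≤ h`, so fitting cannot persist
  -- at all levels.
  have hPh : ∀ k, P k → k ≤ h := fun k hk => by
    have := Nat.lt_two_pow_self (n := k)
    have h3 := Nat.mul_le_mul_right (2 ^ k) (Nat.le_add_left 1 (d / 2 ^ k))
    have := hk.2
    omega
  obtain ⟨k, hk, hmax⟩ : ∃ k, P k ∧ ¬ P (k + 1) := by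
    by_contra hc
    push Not at hc
    have : ∀ k, P k := fun k => by
      induction k with
      | zero => exact hP0
      | succ k ih => exact hc k ih
    have := hPh _ (this (h + 1))
    omega
  have hpos : 0 < 2 ^ k := by positivity
  refine ⟨k, ?_, ?_⟩
  · have := hk.2
    rw [add_mul, one_mul] at this
    exact (Nat.add_le_add_right hk.1 _).trans this
  simp only [P, pow_succ, ← Nat.div_div_eq_div_mul] at hmax hk
  set j := d / 2 ^ k with hj
  generalize 2 ^ k = p at *
  -- Even `j` is a left half with the same left end as its parent; odd `j` is a right half with the
  -- same right end.
  rcases Nat.even_or_odd' j with ⟨i, hi | hi⟩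
  · right
    have e : j / 2 = i := by omega
    have e1 : (j + 1) * p = i * p * 2 + p := by rw [hi]; ring
    have e2 : (i + 1) * (p * 2) = i * p * 2 + p + p := by ring
    have e3 : j * p = i * p * 2 := by rw [hi]; ring
    have e4 : (j + 1 + 1) * p = i * p * 2 + p + p := by rw [hi]; ring
    have e5 : i * (p * 2) = i * p * 2 := by ring
    rw [e, e2, e5] at hmax
    have : h / p = j + 1 := Nat.div_eq_of_lt_le (by omega) (by omega)
    rw [this, Nat.add_sub_cancel]
    exact ⟨hk.1, rfl⟩
  · left
    have e : j / 2 = i := by omega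
    have e1 : (j + 1) * p = i * p * 2 + p + p := by rw [hi]; ring
    have e2 : (i + 1) * (p * 2) = i * p * 2 + p + p := by ring
    have e3 : j * p = i * p * 2 + p := by rw [hi]; ring
    have e5 : i * (p * 2) = i * p * 2 := by ring
    rw [e, e2, e5] at hmax
    have : (l + p - 1) / p = j := Nat.div_eq_of_lt_le (by omega) (by omega)
    rw [this]
    exact ⟨hk.2, rfl⟩

/-- Search in the first block of size `2 ^ k` that begins in the range of the query. -/
def blockLeft : Prog :=
  .setReg 24 ((.reg 21 + .reg 20 - 1) / .reg 20) ;;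
  .cond (.op .lt (.reg 22) ((.reg 24 + 1) * .reg 20)) .skip search

/-- Search in the last block of size `2 ^ k` that ends in the range of the query. -/
def blockRight : Prog :=
  .setReg 24 (.reg 22 / .reg 20) ;;
  .cond (.op .lt 0 (.reg 24))
    (.setReg 24 (.reg 24 - 1) ;;
     .cond (.op .lt (.reg 24 * .reg 20) (.reg 21)) .skip search) .skip

/-- Find an edge from the subtree of vertex `15` to a vertex whose number is at least register `16`
and minimal. -/
def query : Prog :=
  .setReg 21 (.get 0 (.reg 0 + .reg 15)) ;;
  .setReg 22 (.get 0 (2 * .reg 0 + .reg 15) + 1) ;;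
  .setReg 23 (.reg 4) ;;
  .setReg 20 1 ;;
  .loop (.op .lt (.reg 20) (.reg 4)) (blockLeft ;; blockRight ;; .setReg 20 (.reg 20 * 2))

/-- The setting of a range query: the data structure is in array `0`, the parameters are in
registers. -/
structure QueryCtx (w n b M dx lo hi : ℕ) (GA : ℕ → ℕ → Prop) (d l : ℕ → ℕ) (s : State) :
    Prop where
  valid : DSValid n GA d l (s.arr 0) M
  reg0 : s.reg 0 = n
  reg3 : s.reg 3 = M
  reg4 : s.reg 4 = n + 2
  reg16 : s.reg 16 = dx
  dx_lt : dx < n + 2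
  lo_lt : lo < n + 2
  hi_lt : hi < n + 2
  M_lt : M < 2 ^ b
  word : 3 * n + 2 * M + 3 < 2 ^ w
  word' : (n + 2) ^ 5 ≤ 2 ^ w

theorem QueryCtx.of_frame {w n b M dx lo hi : ℕ} {GA : ℕ → ℕ → Prop} {d l : ℕ → ℕ} {s s' : State}
    {p : Prog} (h : QueryCtx w n b M dx lo hi GA d l s) (hF : Frame p s s') (h0 : 0 ∉ p.regs)
    (h3 : 3 ∉ p.regs) (h4 : 4 ∉ p.regs) (h16 : 16 ∉ p.regs) (ha : 0 ∉ p.arrs) :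
    QueryCtx w n b M dx lo hi GA d l s' where
  valid := hF.arr 0 ha ▸ h.valid
  reg0 := (hF.reg 0 h0).trans h.reg0
  reg3 := (hF.reg 3 h3).trans h.reg3
  reg4 := (hF.reg 4 h4).trans h.reg4
  reg16 := (hF.reg 16 h16).trans h.reg16
  dx_lt := h.dx_lt
  lo_lt := h.lo_lt
  hi_lt := h.hi_lt
  M_lt := h.M_lt
  word := h.word
  word' := h.word'

theorem four_mul_le {w n : ℕ} (h : (n + 2) ^ 5 ≤ 2 ^ w) : 16 * (n + 2) ≤ 2 ^ w := by
  refine le_trans ?_ h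
  rw [pow_succ]
  exact Nat.mul_le_mul_right _ (Nat.pow_le_pow_left (n := 2) (by omega) 4)

theorem blockLeft_runs {w n k b M dx lo hi : ℕ} {GA : ℕ → ℕ → Prop} {d l : ℕ → ℕ} {s : State}
    (hs : QueryCtx w n b M dx lo hi GA d l s) (hk : s.reg 20 = 2 ^ k)
    (hkB : 2 ^ k < n + 2) (h21 : s.reg 21 = lo) (h22 : s.reg 22 = hi + 1)
    (hbest : BestOk n GA d lo hi dx (s.reg 23) (s.reg 31) (s.reg 32)) :
    Runs w blockLeft s fun s' t => t ≤ 30 * b + 130 ∧ s'.reg 23 ≤ s.reg 23 ∧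
      (∀ u z, GA u z → d z < d u → dx ≤ d z →
        ((lo + 2 ^ k - 1) / 2 ^ k + 1) * 2 ^ k ≤ hi + 1 → d u / 2 ^ k = (lo + 2 ^ k - 1) / 2 ^ k →
        s'.reg 23 ≤ d z) ∧
      BestOk n GA d lo hi dx (s'.reg 23) (s'.reg 31) (s'.reg 32) := by
  have hW := four_mul_le hs.word'
  have hlo := hs.lo_lt
  have hhi := hs.hi_lt
  have hpos : 0 < 2 ^ k := by positivity
  have e1 := Nat.div_mul_le_self (lo + 2 ^ k - 1) (2 ^ k)
  have e2 := Nat.lt_div_mul_add (a := lo + 2 ^ k - 1) (b := 2 ^ k) hpos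
  have e3 := Nat.div_le_self (lo + 2 ^ k - 1) (2 ^ k)
  have e4 : ((lo + 2 ^ k - 1) / 2 ^ k + 1) * 2 ^ k = (lo + 2 ^ k - 1) / 2 ^ k * 2 ^ k + 2 ^ k := by
    ring
  have e5 : (lo + 2 ^ k) % 2 ^ w = lo + 2 ^ k := Nat.mod_eq_of_lt (by omega)
  obtain ⟨j, hj⟩ : ∃ j, (lo + 2 ^ k - 1) / 2 ^ k = j := ⟨_, rfl⟩
  rw [hj] at e1 e2 e3 e4
  simp only [hj]
  have e6 : (j + 1) % 2 ^ w = j + 1 := Nat.mod_eq_of_lt (by omega)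
  have e7 : ((j + 1) * 2 ^ k) % 2 ^ w = (j + 1) * 2 ^ k := Nat.mod_eq_of_lt (by omega)
  have e8 : 1 % 2 ^ w = 1 := Nat.mod_eq_of_lt (by omega)
  simp [blockLeft, hk, h21, h22, e5, e8, hj, e7]
  refine ⟨fun hc => ⟨fun u z _ _ _ h => by omega, hbest⟩, fun hc => ?_⟩
  have hjm : j < n + 2 := by
    have := Nat.le_mul_of_pos_right (j + 1) hpos
    omega
  refine (search_runs' (s := s.putReg 24 j) (j := j) (k := k) (b := b) (lo := lo) (hi := hi)
    hs.valid ?_ ?_ ?_ ?_ hs.dx_lt ?_ hkB ?_ hjm hs.M_lt hs.word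
    hs.word' (by omega) hc ?_).mono ?_ <;>
    simp only [State.putReg_reg, Nat.reduceEqDiff, if_true, if_false, hs.reg0, hs.reg3, hs.reg4,
      hs.reg16, hk]
  · exact hbest
  · rintro s' t - ⟨h1, h2, h3, h4⟩
    exact ⟨by omega, h2, fun u z h5 h6 h7 _ h9 => h3 u z h5 h6 h9 h7, h4⟩

theorem blockRight_runs {w n k b M dx lo hi : ℕ} {GA : ℕ → ℕ → Prop} {d l : ℕ → ℕ} {s : State}
    (hs : QueryCtx w n b M dx lo hi GA d l s) (hk : s.reg 20 = 2 ^ k)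
    (hkB : 2 ^ k < n + 2) (h21 : s.reg 21 = lo) (h22 : s.reg 22 = hi + 1)
    (hbest : BestOk n GA d lo hi dx (s.reg 23) (s.reg 31) (s.reg 32)) :
    Runs w blockRight s fun s' t => t ≤ 30 * b + 130 ∧ s'.reg 23 ≤ s.reg 23 ∧
      (∀ u z, GA u z → d z < d u → dx ≤ d z → 2 ^ k ≤ hi + 1 →
        lo ≤ ((hi + 1) / 2 ^ k - 1) * 2 ^ k → d u / 2 ^ k = (hi + 1) / 2 ^ k - 1 →
        s'.reg 23 ≤ d z) ∧
      BestOk n GA d lo hi dx (s'.reg 23) (s'.reg 31) (s'.reg 32) := by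
  have hW := four_mul_le hs.word'
  have hlo := hs.lo_lt
  have hhi := hs.hi_lt
  have hpos : 0 < 2 ^ k := by positivity
  have e1 := Nat.div_mul_le_self (hi + 1) (2 ^ k)
  have e3 := Nat.div_le_self (hi + 1) (2 ^ k)
  have e8 : 1 % 2 ^ w = 1 := Nat.mod_eq_of_lt (by omega)
  obtain ⟨j, hj⟩ : ∃ j, (hi + 1) / 2 ^ k = j := ⟨_, rfl⟩
  rw [hj] at e1 e3
  simp only [hj]
  have e2 : (j - 1) * 2 ^ k ≤ j * 2 ^ k := Nat.mul_le_mul_right _ (by omega)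
  have e4 : ((j - 1) * 2 ^ k) % 2 ^ w = (j - 1) * 2 ^ k := Nat.mod_eq_of_lt (by omega)
  simp [blockRight, hk, h21, h22, e8, hj, e4]
  refine ⟨fun hj0 => ⟨fun hc => ⟨fun u z _ _ _ _ h => by omega, hbest⟩, fun hc => ?_⟩,
    fun hj0 => ⟨fun u z _ _ _ h => absurd (Nat.div_pos h hpos) (by omega), hbest⟩⟩
  have e5 : (j - 1 + 1) * 2 ^ k = j * 2 ^ k := by congr 1; omega
  refine (search_runs' (s := (s.putReg 24 j).putReg 24 (j - 1)) (j := j - 1) (k := k) (b := b) (lo := lo) (hi := hi)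
    hs.valid ?_ ?_ ?_ ?_ hs.dx_lt ?_ hkB ?_ (by omega) hs.M_lt hs.word
    hs.word' hc (by omega) ?_).mono ?_ <;>
    simp only [State.putReg_reg, Nat.reduceEqDiff, if_true, if_false, hs.reg0, hs.reg3, hs.reg4,
      hs.reg16, hk]
  · exact hbest
  · rintro s' t - ⟨h1, h2, h3, h4⟩
    exact ⟨by omega, h2, fun u z h5 h6 h7 _ _ h9 => h3 u z h5 h6 h9 h7, h4⟩

/-- Each of at most `c` levels costs two searches of `30 * b + 130` steps and some overhead, within
`75 * (b + 4)`. The best value starts at `n + 2`, above all numbers; `hex` guarantees that it is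
replaced. -/
theorem query_runs {w n b c M dx v lo hi : ℕ} {GA : ℕ → ℕ → Prop} {d l : ℕ → ℕ} {s : State}
    (hs : QueryCtx w n b M dx lo hi GA d l s) (hv : s.reg 15 = v)
    (hvn : v < n) (hlo : d v = lo) (hhi : l v = hi) (hc : n + 2 ≤ 2 ^ c)
    (hex : ∃ u z, GA u z ∧ d z < d u ∧ lo ≤ d u ∧ d u ≤ hi ∧ dx ≤ d z) :
    Runs w query s fun s' t => t ≤ 100 * (c + 1) * (b + 4) ∧
      (∀ u z, GA u z → d z < d u → lo ≤ d u → d u ≤ hi → dx ≤ d z → d (s'.reg 32) ≤ d z) ∧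
      GA (s'.reg 31) (s'.reg 32) ∧ d (s'.reg 32) < d (s'.reg 31) ∧ lo ≤ d (s'.reg 31) ∧
      d (s'.reg 31) ≤ hi ∧ dx ≤ d (s'.reg 32) := by
  have e1 := hs.valid.d_eq v hvn
  have e2 := hs.valid.l_eq v hvn
  have e3 := hs.lo_lt
  have e4 := hs.hi_lt
  have hW := four_mul_le hs.word'
  have hcs := hs.reg4
  have m1 : 1 % 2 ^ w = 1 := Nat.mod_eq_of_lt (by omega)
  have m2 : 2 % 2 ^ w = 2 := Nat.mod_eq_of_lt (by omega)
  have hn := hs.reg0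
  have m3 : (n + v) % 2 ^ w = n + v := Nat.mod_eq_of_lt (by omega)
  have m4 : (2 * n) % 2 ^ w = 2 * n := Nat.mod_eq_of_lt (by omega)
  have m5 : (2 * n + v) % 2 ^ w = 2 * n + v := Nat.mod_eq_of_lt (by omega)
  have m6 : (hi + 1) % 2 ^ w = hi + 1 := Nat.mod_eq_of_lt (by omega)
  simp [query, hn, hcs, hv, e1, e2, hlo, hhi, m1, m2, m3, m5, m6]
  set s₀ := (((s.putReg 21 lo).putReg 22 (hi + 1)).putReg 23 (n + 2)).putReg 20 1 with hs₀
  have hs₀' : QueryCtx w n b M dx lo hi GA d l s₀ := by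
    refine ⟨hs.valid, ?_, ?_, ?_, ?_, hs.dx_lt, e3, e4, hs.M_lt, hs.word, hs.word'⟩ <;>
      simp [hs₀, hs.reg0, hs.reg3, hs.reg4, hs.reg16]
  refine (Runs.loop (B₀ := 75 * c * (b + 4)) (fun s' B => ∃ k, s'.reg 20 = 2 ^ k ∧
    B = 75 * (c - k) * (b + 4) ∧
    (∀ u z, GA u z → d z < d u → dx ≤ d z → ∀ k' < k,
      (((lo + 2 ^ k' - 1) / 2 ^ k' + 1) * 2 ^ k' ≤ hi + 1 ∧
          d u / 2 ^ k' = (lo + 2 ^ k' - 1) / 2 ^ k' ∨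
        2 ^ k' ≤ hi + 1 ∧ lo ≤ ((hi + 1) / 2 ^ k' - 1) * 2 ^ k' ∧
          d u / 2 ^ k' = (hi + 1) / 2 ^ k' - 1) →
      s'.reg 23 ≤ d z) ∧
    BestOk n GA d lo hi dx (s'.reg 23) (s'.reg 31) (s'.reg 32)) ?_ ?_).mono ?_
  · exact ⟨0, by simp [hs₀], rfl, fun u z _ _ _ k' hk' => absurd hk' (by omega),
      Or.inl (by simp [hs₀])⟩
  · rintro s₁ B hF ⟨k, hk, rfl, hcov, hbest⟩ he
    have hs₁ := hs₀'.of_frame hF (by decide) (by decide) (by decide) (by decide) (by decide)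
    have h21 : s₁.reg 21 = lo := (hF.reg 21 (by decide)).trans (by simp [hs₀])
    have h22 : s₁.reg 22 = hi + 1 := (hF.reg 22 (by decide)).trans (by simp [hs₀])
    have r4 := hs₁.reg4
    simp [hk, r4] at he
    rw [runs_seq]
    refine (blockLeft_runs hs₁ hk he h21 h22 hbest).mono ?_
    rintro s₂ t₂ hF₂ ⟨ht₂, hle₂, hcov₂, hbest₂⟩
    have hs₂ := hs₁.of_frame hF₂ (by decide) (by decide) (by decide) (by decide) (by decide)
    have hk₂ := (hF₂.reg 20 (by decide)).trans hk
    rw [runs_seq]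
    refine (blockRight_runs hs₂ hk₂ he ((hF₂.reg 21 (by decide)).trans h21)
      ((hF₂.reg 22 (by decide)).trans h22) hbest₂).mono ?_
    rintro s₃ t₃ hF₃ ⟨ht₃, hle₃, hcov₃, hbest₃⟩
    have hk₃ := (hF₃.reg 20 (by decide)).trans hk₂
    have m7 : (2 ^ k * 2) % 2 ^ w = 2 ^ k * 2 := Nat.mod_eq_of_lt (by omega)
    have hkc : k < c := by
      by_contra h
      have := Nat.pow_le_pow_right (n := 2) (by omega) (not_lt.1 h)
      omega
    simp [hk₃, m2, m7]
    refine ⟨k + 1, ⟨(pow_succ _ _).symm, ?_, hbest₃⟩, ?_⟩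
    · intro u z h1 h2 h3 k' hk' h
      rcases Nat.lt_succ_iff_lt_or_eq.1 hk' with h' | rfl
      · exact (hle₃.trans hle₂).trans (hcov u z h1 h2 h3 k' h' h)
      · rcases h with ⟨h4, h5⟩ | ⟨h4, h5, h6⟩
        · exact hle₃.trans (hcov₂ u z h1 h2 h3 h4 h5)
        · exact hcov₃ u z h1 h2 h3 h4 h5 h6
    · obtain ⟨e, rfl⟩ : ∃ e, c = k + 1 + e := ⟨c - (k + 1), by omega⟩
      rw [show k + 1 + e - (k + 1) = e by omega, show k + 1 + e - k = e + 1 by omega]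
      have : 75 * (e + 1) * (b + 4) = 75 * e * (b + 4) + 75 * b + 300 := by ring
      omega
  · rintro s' t hF ⟨⟨B, ⟨k, hk, rfl, hcov, hbest⟩, ht⟩, he⟩
    have r4 := (hs₀'.of_frame hF (by decide) (by decide) (by decide) (by decide) (by decide)).reg4
    simp [hk, r4] at he ht
    have hcov' : ∀ u z, GA u z → d z < d u → lo ≤ d u → d u ≤ hi → dx ≤ d z →
        s'.reg 23 ≤ d z := by
      intro u z h1 h2 h3 h4 h5
      obtain ⟨k', hk', h⟩ := exists_block h3 (Nat.lt_succ_of_le h4)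
      by_cases hkk : k' < k
      · refine hcov u z h1 h2 h5 k' hkk ?_
        rcases h with h | h
        · exact Or.inl h
        · exact Or.inr ⟨by omega, h⟩
      -- The loop stops once `2 ^ k ≥ n + 2`. Blocks of that size cannot fit, because numbers are
      -- positive and so the range has at most `n + 1` elements.
      · exfalso
        have := Nat.pow_le_pow_right (n := 2) (by omega) (not_lt.1 hkk)
        have := hs.valid.d_pos v hvn
        omega
    obtain ⟨u, z, h1, h2, h3, h4, h5⟩ := hex
    have h6 := hcov' u z h1 h2 h3 h4 h5
    have h7 := hs.valid.d_lt z (hs.valid.bound _ _ h1).2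
    rcases hbest with h8 | ⟨h8, h9, h10, h11, h12, h13⟩
    · omega
    · have : 100 * (c + 1) * (b + 4) = 75 * c * (b + 4) + 25 * (c * (b + 4)) + 100 * b + 400 := by
        ring
      exact ⟨by omega, fun u z a1 a2 a3 a4 a5 => h13 ▸ hcov' u z a1 a2 a3 a4 a5, h8, h9, h10,
        h11, h12⟩

/-! ### Depth first search -/

section ancestor
variable {V : Type*} {par : V → V}

theorem IsAncestor.refl (v : V) : IsAncestor par v v := ⟨0, rfl⟩

theorem isAncestor_iff {w v : V} : IsAncestor par w v ↔ v = w ∨ IsAncestor par w (par v) := by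
  constructor
  · rintro ⟨_ | i, h⟩
    · exact Or.inl h
    · exact Or.inr ⟨i, h⟩
  · rintro (rfl | ⟨i, h⟩)
    · exact .refl _
    · exact ⟨i + 1, h⟩

theorem isAncestor_par (v : V) : IsAncestor par (par v) v := ⟨1, rfl⟩

theorem IsAncestor.trans {a b c : V} (h : IsAncestor par a b) (h' : IsAncestor par b c) :
    IsAncestor par a c := by
  obtain ⟨i, rfl⟩ := h
  obtain ⟨j, rfl⟩ := h'
  exact ⟨i + j, Function.iterate_add_apply _ _ _ _⟩

/-- Two ancestors of a vertex are comparable. -/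
theorem IsAncestor.total {a b c : V} (h : IsAncestor par a c) (h' : IsAncestor par b c) :
    IsAncestor par a b ∨ IsAncestor par b a := by
  obtain ⟨i, rfl⟩ := h
  obtain ⟨j, rfl⟩ := h'
  rcases le_total i j with hij | hij
  · right
    exact ⟨j - i, by rw [← Function.iterate_add_apply]; congr 2; omega⟩
  · left
    exact ⟨i - j, by rw [← Function.iterate_add_apply]; congr 2; omega⟩

/-- A chain of parents that starts in a set closed under parents stays there and never meets the
vertex whose parent is changed. -/
theorem isAncestor_update {p : V → Prop} (hp : ∀ v, p v → p (par v)) {u : V} (hu : ¬ p u) (x : V)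
    [DecidableEq V] {w v : V} (hv : p v) :
    IsAncestor (Function.update par u x) w v ↔ IsAncestor par w v := by
  have : ∀ i, ∀ v, p v → (Function.update par u x)^[i] v = par^[i] v := by
    intro i
    induction i with
    | zero => exact fun _ _ => rfl
    | succ i ih =>
      intro v hv
      have hne : v ≠ u := fun h => hu (h ▸ hv)
      rw [Function.iterate_succ_apply, Function.iterate_succ_apply, Function.update_of_ne hne,
        ih _ (hp v hv)]
  exact ⟨fun ⟨i, h⟩ => ⟨i, (this i v hv).symm.trans h⟩, fun ⟨i, h⟩ => ⟨i, (this i v hv).trans h⟩⟩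

end ancestor

/-- The state of a depth first search of the graph `A` on the vertices `0, …, n` from `n`. A vertex
is visited if its number `num v` is not `0`; `par` is the tree, `fin v` is the last number in the
subtree of a finished vertex, `st` is the stack of the unfinished vertices, and `cnt` is the number
of visited vertices. -/
structure DFSInv (A : ℕ → ℕ → Prop) (n : ℕ) (num par fin : ℕ → ℕ) (st : List ℕ) (cnt : ℕ) :
    Prop where
  le_n : ∀ v, num v ≠ 0 → v ≤ n
  num_le : ∀ v, num v ≤ cnt
  inj : ∀ u v, num u ≠ 0 → num u = num v → u = v
  card : ((Finset.range (n + 1)).filter (num · ≠ 0)).card = cnt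
  par_root : par n = n
  num_root : num n = 1
  par_vis : ∀ v, num v ≠ 0 → num (par v) ≠ 0
  adj_par : ∀ v, num v ≠ 0 → v ≠ n → A v (par v)
  root_anc : ∀ v, num v ≠ 0 → IsAncestor par n v
  st_vis : ∀ v ∈ st, num v ≠ 0
  st_par : ∀ v ∈ st, par v ∈ st
  st_desc : st.Pairwise (num · > num ·)
  st_anc : ∀ w ∈ st, ∀ u, num u ≠ 0 → (IsAncestor par w u ↔ num w ≤ num u)
  fin_anc : ∀ w, num w ≠ 0 → w ∉ st → ∀ u, num u ≠ 0 →
    (IsAncestor par w u ↔ num w ≤ num u ∧ num u ≤ fin w)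
  fin_le : ∀ w, num w ≠ 0 → w ∉ st → fin w ≤ cnt
  fin_adj : ∀ w, num w ≠ 0 → w ∉ st → ∀ v, A w v → num v ≠ 0
  no_cross : ∀ u v, num u ≠ 0 → num v ≠ 0 → A u v → IsAncestor par u v ∨ IsAncestor par v u

namespace DFSInv
variable {A : ℕ → ℕ → Prop} {n : ℕ} {num par fin : ℕ → ℕ} {st : List ℕ} {cnt : ℕ}

theorem cnt_le (h : DFSInv A n num par fin st cnt) : cnt ≤ n + 1 := by
  rw [← h.card]
  exact (Finset.card_filter_le _ _).trans (by simp)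

theorem num_top {top : ℕ} (h : DFSInv A n num par fin (top :: st) cnt) {v : ℕ}
    (hv : v ∈ top :: st) : num v ≤ num top := by
  rcases List.mem_cons.1 hv with rfl | hv
  · rfl
  · exact (List.rel_of_pairwise_cons h.st_desc hv).le

theorem init (hA : ∀ v, ¬ A v v) (hpar : par n = n) (hnum : ∀ v, num v = if v = n then 1 else 0) :
    DFSInv A n num par fin [n] 1 := by
  have hv : ∀ v, num v ≠ 0 ↔ v = n := fun v => by rw [hnum]; split <;> simp_all
  refine ⟨fun v h => ((hv v).1 h).le, fun v => by rw [hnum]; split <;> omega,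
    fun u v h h' => ?_, ?_, hpar, by simp [hnum], fun v h => ?_, fun v h h' => absurd ((hv v).1 h) h',
    fun v h => ?_, fun v h => ?_, fun v h => ?_, by simp, fun w h u h' => ?_, fun w h h' => ?_,
    fun w h h' => ?_, fun w h h' => ?_, fun u v h h' h'' => ?_⟩
  · rw [(hv u).1 h, (hv v).1 (h' ▸ h)]
  · rw [Finset.card_eq_one]
    refine ⟨n, Finset.ext fun v => ?_⟩
    simp only [Finset.mem_filter, Finset.mem_range, hv, Finset.mem_singleton]
    omega
  · rw [(hv v).1 h, hpar, hv]
  · rw [(hv v).1 h]; exact .refl _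
  · rw [hv]; simpa using h
  · rw [List.mem_singleton.1 h, hpar]; simp
  · rw [List.mem_singleton.1 h, (hv u).1 h']
    simp [IsAncestor.refl]
  · simp [(hv w).1 h] at h'
  · simp [(hv w).1 h] at h'
  · simp [(hv w).1 h] at h'
  · rw [(hv u).1 h, (hv v).1 h'] at h''
    exact absurd h'' (hA _)

/-- Any visited neighbour of the new vertex `u` is still on the stack, because a finished vertex has
only visited neighbours. Stack vertices are ancestors of `top`, hence of `u`, so no cross edge
arises. -/
theorem push {top u : ℕ} (h : DFSInv A n num par fin (top :: st) cnt)
    (hA : ∀ u v, A u v → A v u) (hA' : ∀ v, ¬ A v v) (hu : u ≤ n) (h0 : num u = 0)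
    (hadj : A u top) :
    DFSInv A n (Function.update num u (cnt + 1)) (Function.update par u top) fin (u :: top :: st)
      (cnt + 1) := by
  have hne : ∀ v, num v ≠ 0 → v ≠ u := fun v hv h' => hv (h' ▸ h0)
  have hnum : ∀ v, num v ≠ 0 → Function.update num u (cnt + 1) v = num v := fun v hv =>
    Function.update_of_ne (hne v hv) _ _
  have hvis : ∀ v, Function.update num u (cnt + 1) v ≠ 0 ↔ v = u ∨ num v ≠ 0 := fun v => by
    by_cases hv : v = u
    · simp [hv]
    · simp [hv]
  have hanc : ∀ v, num v ≠ 0 → ∀ w, IsAncestor (Function.update par u top) w v ↔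
      IsAncestor par w v := fun v hv w =>
    isAncestor_update (p := fun v => num v ≠ 0) h.par_vis (by simpa using h0) top hv
  have htop : num top ≠ 0 := h.st_vis _ (by simp)
  have hancu : ∀ w, IsAncestor (Function.update par u top) w u ↔ u = w ∨ IsAncestor par w top :=
    fun w => by rw [isAncestor_iff, Function.update_self, hanc _ htop]
  have hun : u ≠ n := fun h' => by
    have := h.num_root
    rw [h'] at h0
    omega
  have hust : u ∉ top :: st := fun h' => h.st_vis _ h' h0
  refine ⟨fun v hv => ?_, fun v => ?_, fun v w hv hvw => ?_, ?_, ?_, ?_, fun v hv => ?_,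
    fun v hv hvn => ?_, fun v hv => ?_, fun v hv => ?_, fun v hv => ?_, ?_, fun w hw v hv => ?_,
    fun w hw hw' v hv => ?_, fun w hw hw' => ?_, fun w hw hw' v hv => ?_, fun v w hv hw hvw => ?_⟩
  · rcases (hvis v).1 hv with rfl | hv
    · exact hu
    · exact h.le_n v hv
  · by_cases hv : v = u
    · simp [hv]
    · rw [Function.update_of_ne hv]; exact (h.num_le v).trans (by omega)
  · by_cases hvu : v = u <;> by_cases hwu : w = u
    · rw [hvu, hwu]
    · rw [hvu, Function.update_self, Function.update_of_ne hwu] at hvw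
      have := h.num_le w
      omega
    · rw [hwu, Function.update_self, Function.update_of_ne hvu] at hvw
      have := h.num_le v
      omega
    · rw [Function.update_of_ne hvu] at hv
      rw [Function.update_of_ne hvu, Function.update_of_ne hwu] at hvw
      exact h.inj v w hv hvw
  · have e : (Finset.range (n + 1)).filter (Function.update num u (cnt + 1) · ≠ 0)
        = insert u ((Finset.range (n + 1)).filter (num · ≠ 0)) := by
      ext v
      simp only [Finset.mem_filter, Finset.mem_range, hvis, Finset.mem_insert]
      constructor
      · rintro ⟨h1, h2 | h2⟩
        · exact Or.inl h2
        · exact Or.inr ⟨h1, h2⟩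
      · rintro (rfl | ⟨h1, h2⟩)
        · exact ⟨by omega, Or.inl rfl⟩
        · exact ⟨h1, Or.inr h2⟩
    rw [e, Finset.card_insert_of_notMem (by simp [h0]), h.card]
  · rw [Function.update_of_ne (Ne.symm hun), h.par_root]
  · rw [Function.update_of_ne (Ne.symm hun), h.num_root]
  · rcases (hvis v).1 hv with rfl | hv
    · rw [Function.update_self, hvis]; exact Or.inr htop
    · rw [Function.update_of_ne (hne v hv), hvis]; exact Or.inr (h.par_vis v hv)
  · rcases (hvis v).1 hv with rfl | hv
    · rwa [Function.update_self]
    · rw [Function.update_of_ne (hne v hv)]; exact h.adj_par v hv hvn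
  · rcases (hvis v).1 hv with rfl | hv
    · rw [hancu]; exact Or.inr (h.root_anc _ htop)
    · rw [hanc v hv]; exact h.root_anc v hv
  · rw [hvis]
    rcases List.mem_cons.1 hv with rfl | hv
    · exact Or.inl rfl
    · exact Or.inr (h.st_vis v hv)
  · rcases List.mem_cons.1 hv with rfl | hv
    · simp
    · rw [Function.update_of_ne (hne v (h.st_vis v hv))]
      exact List.mem_cons_of_mem _ (h.st_par v hv)
  · refine List.pairwise_cons.2 ⟨fun v hv => ?_, h.st_desc.imp_of_mem fun {a b} ha hb hab => ?_⟩
    · rw [Function.update_self, hnum v (h.st_vis v hv)]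
      have := h.num_le v
      omega
    · rw [hnum _ (h.st_vis _ ha), hnum _ (h.st_vis _ hb)]; exact hab
  · rcases (hvis v).1 hv with rfl | hv
    · rw [hancu, Function.update_self]
      rcases List.mem_cons.1 hw with rfl | hw
      · simp
      · rw [hnum w (h.st_vis w hw), h.st_anc w hw _ htop]
        have := h.num_top hw
        have := h.num_le w
        exact ⟨fun _ => by omega, fun _ => Or.inr (by omega)⟩
    · rw [hanc v hv, hnum v hv]
      rcases List.mem_cons.1 hw with rfl | hw
      · rw [Function.update_self]
        have := h.num_le v
        -- An ancestor of a visited vertex is visited, so the unvisited `u` cannot be one.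
        refine ⟨fun h' => ?_, fun h' => by omega⟩
        exfalso
        obtain ⟨i, hi⟩ := h'
        have : ∀ i, num (par^[i] v) ≠ 0 := fun i => by
          induction i with
          | zero => exact ‹num v ≠ 0›
          | succ i ih => rw [Function.iterate_succ_apply']; exact h.par_vis _ ih
        exact this i (hi ▸ h0)
      · rw [hnum w (h.st_vis w hw)]; exact h.st_anc w hw v hv
  · simp only [List.mem_cons, not_or] at hw'
    rw [hvis] at hw
    replace hw := hw.resolve_left hw'.1
    have hwst : w ∉ top :: st := by simp [hw'.2]
    rw [hnum w hw]
    rcases (hvis v).1 hv with rfl | hv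
    · rw [hancu, Function.update_self]
      have := h.fin_le w hw hwst
      refine ⟨fun h' => ?_, fun h' => by omega⟩
      exfalso
      rcases h' with h' | h'
      · exact hne w hw h'.symm
      -- All ancestors of `top` are on the stack, while `w` is finished.
      · obtain ⟨i, hi⟩ := h'
        apply hwst
        rw [← hi]
        clear hi
        induction i with
        | zero => simp
        | succ i ih => rw [Function.iterate_succ_apply']; exact h.st_par _ ih
    · rw [hanc v hv, hnum v hv]; exact h.fin_anc w hw hwst v hv
  · simp only [List.mem_cons, not_or] at hw'
    rw [hvis] at hw
    have := h.fin_le w (hw.resolve_left hw'.1) (by simp [hw'.2])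
    omega
  · simp only [List.mem_cons, not_or] at hw'
    rw [hvis] at hw
    exact (hvis v).2 (Or.inr (h.fin_adj w (hw.resolve_left hw'.1) (by simp [hw'.2]) v hv))
  · have key : ∀ w, num w ≠ 0 → A u w → IsAncestor (Function.update par u top) w u := by
      intro w hw huw
      have hwst : w ∈ top :: st := by
        by_contra hc
        exact h.fin_adj w hw hc u (hA _ _ huw) h0
      rw [hancu]
      exact Or.inr ((h.st_anc w hwst _ htop).2 (h.num_top hwst))
    rcases (hvis v).1 hv with rfl | hv' <;> rcases (hvis w).1 hw with rfl | hw'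
    · exact absurd hvw (hA' _)
    · exact Or.inr (key w hw' hvw)
    · exact Or.inl (key v hv' (hA _ _ hvw))
    · rw [hanc w hw', hanc v hv']; exact h.no_cross v w hv' hw' hvw

/-- While a vertex is on the stack, its subtree consists of all visited vertices numbered from it
on. Recording the current count as `fin` freezes this as a closed interval, since later vertices get
larger numbers. -/
theorem pop {top : ℕ} (h : DFSInv A n num par fin (top :: st) cnt)
    (hadj : ∀ v, A top v → num v ≠ 0) :
    DFSInv A n num par (Function.update fin top cnt) st cnt := by
  have hd := List.pairwise_cons.1 h.st_desc
  have htop : top ∉ st := fun h' => lt_irrefl _ (hd.1 _ h')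
  refine ⟨h.le_n, h.num_le, h.inj, h.card, h.par_root, h.num_root, h.par_vis, h.adj_par,
    h.root_anc, fun v hv => h.st_vis v (List.mem_cons_of_mem _ hv), fun v hv => ?_, hd.2,
    fun w hw => h.st_anc w (List.mem_cons_of_mem _ hw), fun w hw hw' v hv => ?_,
    fun w hw hw' => ?_, fun w hw hw' v hv => ?_, h.no_cross⟩
  · have hv' := List.mem_cons_of_mem top hv
    have h1 := h.st_par v hv'
    refine (List.mem_cons.1 h1).resolve_left fun h2 => ?_
    have h3 := (h.st_anc _ h1 v (h.st_vis v hv')).1 (isAncestor_par v)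
    have h4 := hd.1 v hv
    rw [h2] at h3
    omega
  · by_cases hwt : w = top
    · subst hwt
      rw [Function.update_self, h.st_anc w (by simp) v hv]
      have := h.num_le v
      omega
    · rw [Function.update_of_ne hwt]
      exact h.fin_anc w hw (by simp [hwt, hw']) v hv
  · by_cases hwt : w = top
    · subst hwt; simp
    · rw [Function.update_of_ne hwt]; exact h.fin_le w hw (by simp [hwt, hw'])
  · by_cases hwt : w = top
    · subst hwt; exact hadj v hv
    · exact h.fin_adj w hw (by simp [hwt, hw']) v hv

end DFSInv

/-! ### The search with reduced adjacency lists -/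

/-- The graph `GA` on the vertices `0, …, n - 1` with a depth first search forest `par₀`, whose roots
have the parent `n`, numbered by `d₀`, and further edges `XA`, which join `n` to all vertices. -/
structure Setup (n : ℕ) (GA XA : ℕ → ℕ → Prop) (par₀ d₀ : ℕ → ℕ) : Prop where
  ga_symm : ∀ u v, GA u v → GA v u
  ga_irrefl : ∀ v, ¬ GA v v
  ga_lt : ∀ u v, GA u v → u < n
  xa_symm : ∀ u v, XA u v → XA v u
  xa_irrefl : ∀ v, ¬ XA v v
  xa_le : ∀ u v, XA u v → u ≤ n
  xa_root : ∀ v < n, XA n v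
  par_root : par₀ n = n
  par_le : ∀ v < n, par₀ v ≤ n
  par_adj : ∀ v < n, par₀ v < n → GA v (par₀ v)
  d_lt : ∀ v < n, d₀ (par₀ v) < d₀ v
  cross : ∀ u v, GA u v → IsAncestor par₀ u v ∨ IsAncestor par₀ v u

section
variable {n : ℕ} {GA XA : ℕ → ℕ → Prop} {par₀ d₀ : ℕ → ℕ}

namespace Setup

theorem symm (hT : Setup n GA XA par₀ d₀) (u v : ℕ) (h : GA u v ∨ XA u v) : GA v u ∨ XA v u :=
  h.imp (hT.ga_symm u v) (hT.xa_symm u v)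

theorem irrefl (hT : Setup n GA XA par₀ d₀) (v : ℕ) : ¬ (GA v v ∨ XA v v) :=
  fun h => h.elim (hT.ga_irrefl v) (hT.xa_irrefl v)

theorem le (hT : Setup n GA XA par₀ d₀) (u v : ℕ) (h : GA u v ∨ XA u v) : u ≤ n :=
  h.elim (fun h => (hT.ga_lt u v h).le) (hT.xa_le u v)

theorem iterate_le (hT : Setup n GA XA par₀ d₀) {v : ℕ} (hv : v ≤ n) (i : ℕ) : par₀^[i] v ≤ n := by
  induction i with
  | zero => exact hv
  | succ i ih =>
    rw [Function.iterate_succ_apply']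
    rcases Nat.lt_or_eq_of_le ih with h | h
    · exact hT.par_le _ h
    · rw [h, hT.par_root]

theorem d_le_of_anc (hT : Setup n GA XA par₀ d₀) {u v : ℕ} (hv : v ≤ n)
    (h : IsAncestor par₀ u v) : d₀ u ≤ d₀ v := by
  obtain ⟨i, rfl⟩ := h
  induction i with
  | zero => exact le_rfl
  | succ i ih =>
    rw [Function.iterate_succ_apply']
    refine le_trans ?_ ih
    rcases Nat.lt_or_eq_of_le (hT.iterate_le hv i) with h | h
    · exact (hT.d_lt _ h).le
    · rw [h, hT.par_root]

/-- Numbers strictly decrease on the way up; in particular the vertices of a path are distinct and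
their order can be read off the numbers. -/
theorem d_iterate_lt (hT : Setup n GA XA par₀ d₀) {a i j : ℕ} (hij : i < j)
    (h : ∀ k < j, par₀^[k] a < n) : d₀ (par₀^[j] a) < d₀ (par₀^[i] a) := by
  induction j, hij using Nat.le_induction with
  | base => rw [Function.iterate_succ_apply']; exact hT.d_lt _ (h i (by omega))
  | succ j hj ih =>
    rw [Function.iterate_succ_apply']
    exact (hT.d_lt _ (h j (by omega))).trans (ih fun k hk => h k (by omega))

/-- Climbing from an unvisited vertex must stop below a visited parent, as the root is visited; the
place where it stops is the root of an untouched subtree. -/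
theorem exists_top (hT : Setup n GA XA par₀ d₀) {num : ℕ → ℕ} (hroot : num n ≠ 0) {q : ℕ}
    (hq : q < n) (h0 : num q = 0) :
    ∃ w < n, num w = 0 ∧ num (par₀ w) ≠ 0 ∧ IsAncestor par₀ w q := by
  induction hd : d₀ q using Nat.strong_induction_on generalizing q with
  | _ m ih =>
    by_cases hp : num (par₀ q) = 0
    · have hpn : par₀ q < n := lt_of_le_of_ne (hT.par_le q hq) fun h => hroot (h ▸ hp)
      obtain ⟨w, h1, h2, h3, h4⟩ := ih _ (hd ▸ hT.d_lt q hq) hpn hp rfl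
      exact ⟨w, h1, h2, h3, h4.trans (isAncestor_par q)⟩
    · exact ⟨q, hq, h0, hp, .refl q⟩

end Setup

/-- What holds throughout the search. `S v` is the adjacency list of the vertex `v ≤ n`,
`S (n + 1 + v)` is the list of its children in the old tree, and `S (2 * n + 2)` is the stack. -/
structure BaseInv (n : ℕ) (GA XA : ℕ → ℕ → Prop) (par₀ : ℕ → ℕ) (num par fin : ℕ → ℕ)
    (S : ℕ → List ℕ) (cnt : ℕ) : Prop where
  dfs : DFSInv (fun u v => GA u v ∨ XA u v) n num par fin (S (2 * n + 2)) cnt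
  xa : ∀ p q, XA p q → num q = 0 → q ∈ S p
  edge : ∀ h ≤ n, ∀ a ∈ S h, GA h a ∨ XA h a
  child : ∀ v < n, num (par₀ v) = 0 → v ∈ S (n + 1 + par₀ v)
  child' : ∀ u ≤ n, ∀ v ∈ S (n + 1 + u), v < n ∧ par₀ v = u

/-- The list of some vertex on the stack, which is not below `p`, holds a vertex of the untouched
subtree of `q`. -/
def Reachable (n : ℕ) (par₀ num : ℕ → ℕ) (S : ℕ → List ℕ) (p q : ℕ) : Prop :=
  ∃ w < n, num w = 0 ∧ num (par₀ w) ≠ 0 ∧ IsAncestor par₀ w q ∧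
    ∃ z ∈ S (2 * n + 2), num p ≤ num z ∧ ∃ a ∈ S z, IsAncestor par₀ w a

/-- The invariant of the main loop. -/
structure MainInv (n : ℕ) (GA XA : ℕ → ℕ → Prop) (par₀ : ℕ → ℕ) (num par fin : ℕ → ℕ)
    (S : ℕ → List ℕ) (cnt : ℕ) : Prop extends BaseInv n GA XA par₀ num par fin S cnt where
  closed : ∀ v < n, num v ≠ 0 → num (par₀ v) ≠ 0
  ga : ∀ p ∈ S (2 * n + 2), ∀ q, GA p q → num q = 0 → Reachable n par₀ num S p q

/-- The invariant while the path of length `ℓ` from the vertex `a₀` to the root `x` of an untouched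
subtree is visited; `i` vertices of the path have been visited. -/
structure PathInv (n : ℕ) (GA XA : ℕ → ℕ → Prop) (par₀ : ℕ → ℕ) (a₀ ℓ c₀ i : ℕ)
    (num par fin : ℕ → ℕ) (S : ℕ → List ℕ) (cnt : ℕ) : Prop
    extends BaseInv n GA XA par₀ num par fin S cnt where
  cnt_eq : cnt = c₀ + i
  i_le : i ≤ ℓ
  lt_n : ∀ j < ℓ, par₀^[j] a₀ < n
  num_done : ∀ j < i, num (par₀^[j] a₀) = c₀ + j + 1
  num_todo : ∀ j, i ≤ j → j < ℓ → num (par₀^[j] a₀) = 0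
  num_old : ∀ v, num v ≠ 0 → (∃ j < i, v = par₀^[j] a₀) ∨ num v ≤ c₀
  num_above : ∀ v, IsAncestor par₀ v (par₀^[ℓ] a₀) → num v ≠ 0
  num_sub : ∀ v, num v ≠ 0 → IsAncestor par₀ (par₀^[ℓ - 1] a₀) v → ∃ j < i, v = par₀^[j] a₀
  closed : ∀ v < n, num v ≠ 0 → (∃ j < i, v = par₀^[j] a₀) ∨ num (par₀ v) ≠ 0
  mem_st : ∀ j < i, par₀^[j] a₀ ∈ S (2 * n + 2)
  top : ∃ t st, S (2 * n + 2) = t :: st ∧ (i < ℓ → GA (par₀^[i] a₀) t ∨ XA (par₀^[i] a₀) t)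
  ga : ∀ p ∈ S (2 * n + 2), ∀ q, GA p q → num q = 0 → ¬ IsAncestor par₀ (par₀^[ℓ - 1] a₀) q →
    Reachable n par₀ num S p q
  hang : ∀ j < i, ∀ w < n, par₀ w = par₀^[j] a₀ → num w = 0 →
    (j + 1 = i ∧ w ∈ S (n + 1 + par₀^[j] a₀)) ∨
    ∃ k < ℓ, (∃ a ∈ S (par₀^[k] a₀), IsAncestor par₀ w a) ∧
      ∀ k' < ℓ, ∀ q, IsAncestor par₀ w q → GA (par₀^[k'] a₀) q → k' ≤ k

variable {num par fin : ℕ → ℕ} {S : ℕ → List ℕ} {cnt : ℕ}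

/-- Entries that are visited may be lost: a witness lies below an unvisited vertex and so is
unvisited itself. -/
theorem Reachable.mono {S' : ℕ → List ℕ} {p q : ℕ} (h : Reachable n par₀ num S p q)
    (hst : S' (2 * n + 2) = S (2 * n + 2))
    (hS : ∀ z ∈ S (2 * n + 2), ∀ a ∈ S z, num a = 0 → a ∈ S' z)
    (hunv : ∀ w < n, num w = 0 → ∀ a, IsAncestor par₀ w a → num a = 0) :
    Reachable n par₀ num S' p q := by
  obtain ⟨w, h1, h2, h3, h4, z, h5, h6, a, h7, h8⟩ := h
  exact ⟨w, h1, h2, h3, h4, z, hst ▸ h5, h6, a, hS z h5 a h7 (hunv w h1 h2 a h8), h8⟩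

theorem Reachable.mono' {S' : ℕ → List ℕ} {p q : ℕ} (h : Reachable n par₀ num S p q)
    (hst : S' (2 * n + 2) = S (2 * n + 2))
    (hS : ∀ z ∈ S (2 * n + 2), ∀ a ∈ S z, a ∈ S' z) :
    Reachable n par₀ num S' p q := by
  obtain ⟨w, h1, h2, h3, h4, z, h5, h6, a, h7, h8⟩ := h
  exact ⟨w, h1, h2, h3, h4, z, hst ▸ h5, h6, a, hS z h5 a h7, h8⟩

namespace MainInv

/-- The contrapositive of closure under parents: below an unvisited vertex everything is unvisited.
-/
theorem unvisited (hT : Setup n GA XA par₀ d₀) (h : MainInv n GA XA par₀ num par fin S cnt)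
    {w a : ℕ} (hw : num w = 0) (ha : IsAncestor par₀ w a) : num a = 0 := by
  by_contra hc
  obtain ⟨i, rfl⟩ := ha
  have : ∀ i, num (par₀^[i] a) ≠ 0 := fun i => by
    induction i with
    | zero => exact hc
    | succ i ih =>
      rw [Function.iterate_succ_apply']
      rcases Nat.lt_or_eq_of_le (h.dfs.le_n _ ih) with h' | h'
      · exact h.closed _ h' ih
      · rw [h', hT.par_root, ← h']; exact ih
  exact this i hw

/-- Delete a visited vertex from a list. -/
theorem drop (hT : Setup n GA XA par₀ d₀) (h : MainInv n GA XA par₀ num par fin S cnt) {p a : ℕ}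
    {l : List ℕ} (hp : p ≤ n) (hS : S p = a :: l) (ha : num a ≠ 0) :
    MainInv n GA XA par₀ num par fin (Function.update S p l) cnt := by
  have hst : Function.update S p l (2 * n + 2) = S (2 * n + 2) :=
    Function.update_of_ne (by omega) _ _
  have hch : ∀ u, Function.update S p l (n + 1 + u) = S (n + 1 + u) := fun u =>
    Function.update_of_ne (by omega) _ _
  have hmem : ∀ z, ∀ b ∈ S z, num b = 0 → b ∈ Function.update S p l z := by
    intro z b hb hb0
    by_cases hz : z = p
    · subst hz
      rw [Function.update_self]
      rw [hS] at hb
      exact (List.mem_cons.1 hb).resolve_left fun h' => ha (h' ▸ hb0)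
    · rwa [Function.update_of_ne hz]
  have hsub : ∀ z, ∀ b ∈ Function.update S p l z, b ∈ S z := by
    intro z b hb
    by_cases hz : z = p
    · subst hz
      rw [Function.update_self] at hb
      rw [hS]; exact List.mem_cons_of_mem _ hb
    · rwa [Function.update_of_ne hz] at hb
  refine ⟨⟨hst ▸ h.dfs, fun p' q hq hq0 => ?_, fun h' hh b hb => h.edge h' hh b (hsub _ _ hb),
    fun v hv hv0 => ?_, fun u hu v hv => h.child' u hu v (hsub _ _ hv)⟩, h.closed,
    fun p' hp' q hq hq0 => ?_⟩
  · exact hmem _ _ (h.xa p' q hq hq0) hq0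
  · rw [hch]; exact h.child v hv hv0
  · exact (h.ga p' (hst ▸ hp') q hq hq0).mono hst (fun z _ => hmem z)
      fun w _ hw a ha => h.unvisited hT hw ha

/-- Remove a vertex with an empty list from the stack. -/
theorem finish (hT : Setup n GA XA par₀ d₀) (h : MainInv n GA XA par₀ num par fin S cnt) {p : ℕ}
    {st : List ℕ} (hst : S (2 * n + 2) = p :: st) (hp : S p = []) :
    MainInv n GA XA par₀ num par (Function.update fin p cnt)
      (Function.update S (2 * n + 2) st) cnt := by
  have hdfs := h.dfs
  rw [hst] at hdfs
  -- An unvisited neighbour along `GA` would have a covering entry at a stack vertex numbered at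
  -- least as high as `p`. As `p` is the top, this vertex is `p`, but its list is empty. Unvisited
  -- neighbours along `XA` would be in the list themselves.
  have hpn : ∀ v, GA p v ∨ XA p v → num v ≠ 0 := by
    rintro v (hv | hv) h0
    · obtain ⟨w, h1, h2, h3, h4, z, h5, h6, a, h7, h8⟩ := h.ga p (by simp [hst]) v hv h0
      rw [hst] at h5
      have h9 := hdfs.num_top h5
      rw [hdfs.inj z p (hdfs.st_vis _ h5) (by omega), hp] at h7
      simp at h7
    · have := h.xa p v hv h0
      simp [hp] at this
  have hpn' : p ≤ n := hdfs.le_n p (hdfs.st_vis p (by simp))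
  have hne : ∀ z ≤ n, Function.update S (2 * n + 2) st z = S z := fun z hz =>
    Function.update_of_ne (by omega) _ _
  have hstn : ∀ z ∈ st, z ∈ S (2 * n + 2) := fun z hz => by rw [hst]; exact List.mem_cons_of_mem _ hz
  have hst' : ∀ z ∈ st, z ≤ n := fun z hz =>
    h.dfs.le_n z (h.dfs.st_vis z (hstn z hz))
  refine ⟨⟨?_, fun p' q hq hq0 => ?_, fun h' hh b hb => ?_,
    fun v hv hv0 => ?_, fun u hu v hv => ?_⟩, h.closed, fun p' hp' q hq hq0 => ?_⟩
  · rw [Function.update_self]; exact hdfs.pop hpn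
  · rw [hne _ (hT.xa_le _ _ hq)]
    exact h.xa p' q hq hq0
  · rw [hne _ hh] at hb
    exact h.edge h' hh b hb
  · have := hT.par_le v hv
    rw [Function.update_of_ne (by omega)]; exact h.child v hv hv0
  · rw [Function.update_of_ne (by omega)] at hv
    exact h.child' u hu v hv
  · rw [Function.update_self] at hp'
    obtain ⟨w, h1, h2, h3, h4, z, h5, h6, a, h7, h8⟩ := h.ga p' (hstn _ hp') q hq hq0
    have hz : z ∈ st := by
      rw [hst] at h5
      refine (List.mem_cons.1 h5).resolve_left fun h' => ?_
      rw [h', hp] at h7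
      simp at h7
    refine ⟨w, h1, h2, h3, h4, z, by rwa [Function.update_self], h6, a, ?_, h8⟩
    rwa [hne z (hst' z hz)]

/-- The vertex `a₀` in the list of the top of the stack has not been visited. -/
theorem start (hT : Setup n GA XA par₀ d₀) (h : MainInv n GA XA par₀ num par fin S cnt)
    {p a₀ ℓ : ℕ} {st l : List ℕ} (hst : S (2 * n + 2) = p :: st) (hp : S p = a₀ :: l)
    (hℓ : 0 < ℓ) (htodo : ∀ j < ℓ, num (par₀^[j] a₀) = 0) (hdone : num (par₀^[ℓ] a₀) ≠ 0) :
    PathInv n GA XA par₀ a₀ ℓ cnt 0 num par fin S cnt := by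
  have hpn : p ≤ n := h.dfs.le_n p (h.dfs.st_vis p (by simp [hst]))
  have he := h.edge p hpn a₀ (by simp [hp])
  have ha : a₀ ≤ n := hT.le _ _ (hT.symm _ _ he)
  have hroot := h.dfs.num_root
  have hx : ∀ v, num v ≠ 0 → ¬ IsAncestor par₀ (par₀^[ℓ - 1] a₀) v := fun v hv hv' =>
    hv (h.unvisited hT (htodo _ (by omega)) hv')
  refine ⟨h.toBaseInv, rfl, Nat.zero_le _, fun j hj => ?_, fun j hj => absurd hj (by omega),
    fun j _ hj => htodo j hj, fun v hv => Or.inr (h.dfs.num_le v),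
    fun v hv h0 => hdone (h.unvisited hT h0 hv),
    fun v hv hv' => absurd hv' (hx v hv), fun v hv hv0 => Or.inr (h.closed v hv hv0),
    fun j hj => absurd hj (by omega),
    ⟨p, st, hst, fun _ => hT.symm _ _ he⟩, fun p hp q hq hq0 _ => h.ga p hp q hq hq0,
    fun j hj => absurd hj (by omega)⟩
  refine lt_of_le_of_ne (hT.iterate_le ha j) fun h' => ?_
  have := htodo j hj
  rw [h'] at this
  omega

/-- With an empty stack the root is finished, and it is joined to every vertex. -/
theorem all_visited (hT : Setup n GA XA par₀ d₀) (h : MainInv n GA XA par₀ num par fin S cnt)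
    (hst : S (2 * n + 2) = []) (v : ℕ) (hv : v ≤ n) : num v ≠ 0 := by
  have hroot := h.dfs.num_root
  rcases Nat.lt_or_eq_of_le hv with hv | rfl
  · exact h.dfs.fin_adj n (by omega) (by simp [hst]) v (Or.inr (hT.xa_root v hv))
  · omega

end MainInv

namespace PathInv
variable {a₀ ℓ c₀ i : ℕ}

/-- Visit the next vertex of the path. -/
theorem push (hT : Setup n GA XA par₀ d₀)
    (h : PathInv n GA XA par₀ a₀ ℓ c₀ i num par fin S cnt) (hi : i < ℓ) {t : ℕ} {st : List ℕ}
    (hst : S (2 * n + 2) = t :: st) (hch : ∀ j, j + 1 = i → S (n + 1 + par₀^[j] a₀) = []) :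
    PathInv n GA XA par₀ a₀ ℓ c₀ (i + 1) (Function.update num (par₀^[i] a₀) (cnt + 1))
      (Function.update par (par₀^[i] a₀) t) fin
      (Function.update S (2 * n + 2) (par₀^[i] a₀ :: t :: st)) (cnt + 1) := by
  obtain ⟨t', st', hst', hadj⟩ := h.top
  obtain ⟨rfl, rfl⟩ := List.cons.inj (hst.symm.trans hst')
  clear hst'
  replace hadj := hadj hi
  obtain ⟨u, hu⟩ : ∃ u, par₀^[i] a₀ = u := ⟨_, rfl⟩
  have hun : u < n := hu ▸ h.lt_n i hi
  have hu0 : num u = 0 := hu ▸ h.num_todo i le_rfl hi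
  have hroot := h.dfs.num_root
  have hdfs := h.dfs
  rw [hst] at hdfs
  rw [hu] at hadj ⊢
  have hdfs' := hdfs.push hT.symm hT.irrefl hun.le hu0 hadj
  set num' := Function.update num u (cnt + 1) with hnum'
  set S' := Function.update S (2 * n + 2) (u :: t :: st) with hS'
  have hne : ∀ z < 2 * n + 2, S' z = S z := fun z hz => Function.update_of_ne (by omega) _ _
  have hself : S' (2 * n + 2) = u :: t :: st := Function.update_self ..
  have hnum : ∀ v, num v ≠ 0 → num' v = num v := fun v hv =>
    Function.update_of_ne (fun h' => hv (by rw [h', hu0])) _ _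
  have hnumu : num' u = cnt + 1 := Function.update_self ..
  have hunv : ∀ v, num' v = 0 → num v = 0 := fun v hv => by
    by_contra hc
    exact hc (hnum v hc ▸ hv)
  have hvis : ∀ v, num v ≠ 0 → num' v ≠ 0 := fun v hv hv' => hv (hunv v hv')
  have hvis' : ∀ v, num' v ≠ 0 → v = u ∨ num v ≠ 0 := fun v hv => by
    by_cases h' : v = u
    · exact Or.inl h'
    · rw [hnum', Function.update_of_ne h'] at hv; exact Or.inr hv
  have hxu : IsAncestor par₀ (par₀^[ℓ - 1] a₀) u :=
    ⟨ℓ - 1 - i, by rw [← hu, ← Function.iterate_add_apply]; congr 2; omega⟩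
  have hstn : ∀ z ∈ S (2 * n + 2), z ≤ n := fun z hz => h.dfs.le_n z (h.dfs.st_vis z hz)
  have hpne : ∀ j < i, num (par₀^[j] a₀) ≠ 0 := fun j hj => by rw [h.num_done j hj]; omega
  have hmem' : ∀ z ∈ S (2 * n + 2), z ∈ S' (2 * n + 2) := fun z hz => by
    rw [hself, ← hst]; exact List.mem_cons_of_mem _ hz
  have hcu : ∀ v ∈ S u, GA u v ∨ XA u v := h.edge u hun.le
  refine ⟨⟨hself ▸ hdfs', fun p q hq hq0 => ?_, fun z hz b hb => ?_, fun v hv hv0 => ?_,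
    fun z hz v hv => ?_⟩, by rw [h.cnt_eq]; rfl, hi, h.lt_n, fun j hj => ?_, fun j hj hj' => ?_,
    fun v hv => ?_, fun v hv => hvis v (h.num_above v hv), fun v hv hv' => ?_, fun v hv hv' => ?_,
    fun j hj => ?_, ⟨u, t :: st, hself, fun hi' => ?_⟩, fun p hp q hq hq0 hxq => ?_,
    fun j hj w hw hwj hw0 => ?_⟩
  · have := hT.xa_le _ _ hq
    rw [hne _ (by omega)]
    exact h.xa p q hq (hunv _ hq0)
  · rw [hne z (by omega)] at hb
    exact h.edge z hz b hb
  · have := hT.par_le v hv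
    rw [hne _ (by omega)]
    exact h.child v hv (hunv _ hv0)
  · rw [hne _ (by omega)] at hv
    exact h.child' z hz v hv
  · rcases Nat.lt_succ_iff_lt_or_eq.1 hj with hj | rfl
    · rw [hnum _ (hpne j hj), h.num_done j hj]
    · rw [hu, hnumu, h.cnt_eq]
  · have : par₀^[j] a₀ ≠ u := fun h' => by
      have := hT.d_iterate_lt (a := a₀) (i := i) (j := j) (by omega)
        fun k hk => h.lt_n k (by omega)
      rw [h', hu] at this
      omega
    rw [hnum', Function.update_of_ne this]
    exact h.num_todo j (by omega) hj'
  · rcases hvis' v hv with rfl | hv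
    · exact Or.inl ⟨i, by omega, hu.symm⟩
    · rw [hnum v hv]
      rcases h.num_old v hv with ⟨j, hj, hj'⟩ | h'
      · exact Or.inl ⟨j, by omega, hj'⟩
      · exact Or.inr h'
  · rcases hvis' v hv with rfl | hv
    · exact ⟨i, by omega, hu.symm⟩
    · obtain ⟨j, hj, hj'⟩ := h.num_sub v hv hv'
      exact ⟨j, by omega, hj'⟩
  · rcases hvis' v hv' with rfl | hv'
    · exact Or.inl ⟨i, by omega, hu.symm⟩
    · rcases h.closed v hv hv' with ⟨j, hj, hj'⟩ | h'
      · exact Or.inl ⟨j, by omega, hj'⟩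
      · exact Or.inr (hvis _ h')
  · rcases Nat.lt_succ_iff_lt_or_eq.1 hj with hj | rfl
    · exact hmem' _ (h.mem_st j hj)
    · rw [hu, hself]; simp
  · have := hT.par_adj u hun
    rw [← hu, ← Function.iterate_succ_apply' par₀, hu] at this
    exact Or.inl (hT.ga_symm _ _ (this (h.lt_n _ hi')))
  -- For the new vertex nothing has to be covered: a neighbour outside the subtree of `x` would be a
  -- proper old ancestor of `x`, and those are visited.
  · rw [hself, ← hst] at hp
    rcases List.mem_cons.1 hp with rfl | hp
    · exfalso
      rcases hT.cross _ _ hq with h1 | h1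
      · exact hxq (hxu.trans h1)
      · rcases hxu.total h1 with h2 | h2
        · exact hxq h2
        · rcases isAncestor_iff.1 h2 with h3 | h3
          · exact hxq (h3 ▸ .refl _)
          · rw [← Function.iterate_succ_apply' par₀, show (ℓ - 1).succ = ℓ by omega] at h3
            exact h.num_above _ h3 (hunv _ hq0)
    · obtain ⟨w, h1, h2, h3, h4, z, h5, h6, a, h7, h8⟩ := h.ga p hp q hq (hunv _ hq0) hxq
      have hwu : w ≠ u := fun h' => hxq (hxu.trans (h' ▸ h4))
      refine ⟨w, h1, by rwa [hnum', Function.update_of_ne hwu], hvis _ h3, h4, z, hmem' z h5, ?_,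
        a, ?_, h8⟩
      · rwa [hnum _ (h.dfs.st_vis _ hp), hnum _ (h.dfs.st_vis _ h5)]
      · have := hstn z h5
        rwa [hne z (by omega)]
  · rcases Nat.lt_succ_iff_lt_or_eq.1 hj with hj | rfl
    · rcases h.hang j hj w hw hwj (hunv _ hw0) with ⟨h1, h2⟩ | ⟨k, hk, ⟨a, h1, h2⟩, h3⟩
      · rw [hch j h1] at h2; simp at h2
      · have := h.lt_n k hk
        exact Or.inr ⟨k, hk, ⟨a, by rwa [hne _ (by omega)], h2⟩, h3⟩
    -- The list of children is complete as long as its owner is unvisited, so at this moment every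
    -- untouched child of the new vertex is in it.
    · refine Or.inl ⟨rfl, ?_⟩
      rw [hu, hne _ (by omega)]
      have := h.child w hw (by rw [hwj, hu, hu0])
      rwa [hwj, hu] at this

/-- Serving changes lists only monotonically: adjacency lists grow, and only lists of children of
visited vertices shrink. Everything except `hang` survives such a change. -/
theorem change_lists {S' : ℕ → List ℕ}
    (h : PathInv n GA XA par₀ a₀ ℓ c₀ i num par fin S cnt) (hst : S' (2 * n + 2) = S (2 * n + 2))
    (hsub : ∀ z ≤ n, ∀ a ∈ S z, a ∈ S' z) (hedge : ∀ z ≤ n, ∀ a ∈ S' z, GA z a ∨ XA z a)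
    (hch : ∀ u, num u = 0 → S' (n + 1 + u) = S (n + 1 + u))
    (hch' : ∀ u, ∀ v ∈ S' (n + 1 + u), v ∈ S (n + 1 + u))
    (hhang : ∀ j < i, ∀ w < n, par₀ w = par₀^[j] a₀ → num w = 0 →
      (j + 1 = i ∧ w ∈ S' (n + 1 + par₀^[j] a₀)) ∨
      ∃ k < ℓ, (∃ a ∈ S' (par₀^[k] a₀), IsAncestor par₀ w a) ∧
        ∀ k' < ℓ, ∀ q, IsAncestor par₀ w q → GA (par₀^[k'] a₀) q → k' ≤ k)
    (hxn : ∀ u v, XA u v → u ≤ n) :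
    PathInv n GA XA par₀ a₀ ℓ c₀ i num par fin S' cnt := by
  refine ⟨⟨hst ▸ h.dfs, fun p q hq hq0 => hsub p (hxn _ _ hq) _ (h.xa p q hq hq0), hedge,
    fun v hv hv0 => (hch _ hv0).symm ▸ h.child v hv hv0,
    fun u hu v hv => h.child' u hu v (hch' u v hv)⟩, h.cnt_eq, h.i_le, h.lt_n, h.num_done,
    h.num_todo, h.num_old, h.num_above, h.num_sub, h.closed, fun j hj => hst ▸ h.mem_st j hj,
    hst ▸ h.top, fun p hp q hq hq0 hxq => ?_, hhang⟩
  exact (h.ga p (hst ▸ hp) q hq hq0 hxq).mono' hst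
    fun z hz => hsub z (h.dfs.le_n z (h.dfs.st_vis z hz))

/-- Delete a visited vertex from the list of the children of the last visited vertex. -/
theorem drop (hT : Setup n GA XA par₀ d₀)
    (h : PathInv n GA XA par₀ a₀ ℓ c₀ (i + 1) num par fin S cnt) {w : ℕ} {l : List ℕ}
    (hS : S (n + 1 + par₀^[i] a₀) = w :: l) (hw : num w ≠ 0) :
    PathInv n GA XA par₀ a₀ ℓ c₀ (i + 1) num par fin
      (Function.update S (n + 1 + par₀^[i] a₀) l) cnt := by
  have hun := h.lt_n i h.i_le
  have hu0 : num (par₀^[i] a₀) ≠ 0 := by rw [h.num_done i (by omega)]; omega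
  generalize hu : par₀^[i] a₀ = u at *
  have hne : ∀ z, z ≠ n + 1 + u → Function.update S (n + 1 + u) l z = S z := fun z hz =>
    Function.update_of_ne hz _ _
  refine h.change_lists (hne _ (by omega)) (fun z hz a ha => by rwa [hne _ (by omega)])
    (fun z hz a ha => ?_) (fun v hv => hne _ fun h' => hu0 ?_) (fun v b hb => ?_)
    (fun j hj v hv hvj hv0 => ?_) hT.xa_le
  · rw [hne _ (by omega)] at ha
    exact h.edge z hz a ha
  · rwa [show u = v by omega]
  · by_cases hvu : v = u
    · subst hvu
      rw [Function.update_self] at hb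
      rw [hS]
      exact List.mem_cons_of_mem _ hb
    · rwa [hne _ (by omega)] at hb
  · rcases h.hang j hj v hv hvj hv0 with ⟨h1, h2⟩ | ⟨k, hk, ⟨a, h1, h2⟩, h3⟩
    · obtain rfl : j = i := by omega
      rw [hu, hS] at h2
      refine Or.inl ⟨rfl, ?_⟩
      rw [hu, Function.update_self]
      exact (List.mem_cons.1 h2).resolve_left fun h' => hw (h' ▸ hv0)
    · have := h.lt_n k hk
      exact Or.inr ⟨k, hk, ⟨a, by rwa [hne _ (by omega)], h2⟩, h3⟩

/-- Serve an untouched subtree that hangs from the last visited vertex. -/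
theorem serve (hT : Setup n GA XA par₀ d₀)
    (h : PathInv n GA XA par₀ a₀ ℓ c₀ (i + 1) num par fin S cnt) {w a z : ℕ} {l : List ℕ}
    (hS : S (n + 1 + par₀^[i] a₀) = w :: l) (haz : GA a z)
    (hdz : d₀ z < d₀ a) (hwa : IsAncestor par₀ w a) (hxz : d₀ (par₀^[ℓ - 1] a₀) ≤ d₀ z)
    (hmin : ∀ u' z', GA u' z' → d₀ z' < d₀ u' → IsAncestor par₀ w u' →
      d₀ (par₀^[ℓ - 1] a₀) ≤ d₀ z' → d₀ z ≤ d₀ z') :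
    PathInv n GA XA par₀ a₀ ℓ c₀ (i + 1) num par fin
      (Function.update (Function.update S (n + 1 + par₀^[i] a₀) l) z (a :: S z)) cnt := by
  have hun := h.lt_n i h.i_le
  have hiℓ := h.i_le
  have hu0 : num (par₀^[i] a₀) ≠ 0 := by rw [h.num_done i (by omega)]; omega
  have hlt := fun (i j : ℕ) (hij : i < j) (hj : j ≤ ℓ) =>
    hT.d_iterate_lt (a := a₀) hij fun k hk => h.lt_n k (by omega)
  have hle : ∀ i j, i ≤ j → j ≤ ℓ → d₀ (par₀^[j] a₀) ≤ d₀ (par₀^[i] a₀) := fun i j hij hj => by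
    rcases Nat.lt_or_eq_of_le hij with h' | rfl
    · exact (hlt i j h' hj).le
    · exact le_rfl
  obtain ⟨hwn, hwu⟩ := h.child' _ hun.le w (by simp [hS])
  have hwd := hT.d_lt w hwn
  have han := hT.ga_lt _ _ haz
  have hzn := hT.ga_lt _ _ (hT.ga_symm _ _ haz)
  -- The tree edge from `w` to its parent on the path competes in the query, so the minimum is not
  -- below the parent.
  have hzu : d₀ z ≤ d₀ (par₀^[i] a₀) := by
    have hadj := hT.par_adj w hwn (hwu ▸ hun)
    rw [hwu] at hadj hwd
    exact hmin _ _ hadj hwd (.refl w) (hle _ _ (by omega) (by omega))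
  -- Both `z` and `w` are ancestors of `a`, hence comparable; the numbers place `z` above `w`.
  have hzw : IsAncestor par₀ z (par₀^[i] a₀) := by
    have hza : IsAncestor par₀ z a := by
      rcases hT.cross _ _ haz with h1 | h1
      · have := hT.d_le_of_anc hzn.le h1
        omega
      · exact h1
    rw [← hwu] at hzu ⊢
    rcases hza.total hwa with h1 | h1
    · rcases isAncestor_iff.1 h1 with h2 | h2
      · have := congrArg d₀ h2
        omega
      · exact h2
    · have := hT.d_le_of_anc hzn.le h1
      omega
  obtain ⟨m, hm⟩ := hzw
  rw [← Function.iterate_add_apply] at hm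
  -- The lower bound `d₀ x ≤ d₀ z` keeps `z` from lying above `x`, so `z` is on the path.
  have hk : m + i < ℓ := by
    by_contra hc
    have h1 : IsAncestor par₀ z (par₀^[ℓ] a₀) :=
      ⟨m + i - ℓ, by rw [← Function.iterate_add_apply, Nat.sub_add_cancel (by omega)]; exact hm⟩
    have h2 := hT.d_le_of_anc (hT.iterate_le (v := a₀) (h.lt_n 0 (by omega)).le ℓ) h1
    have h3 := hlt (ℓ - 1) ℓ (by omega) le_rfl
    omega
  generalize hu : par₀^[i] a₀ = u at *
  set S' := Function.update (Function.update S (n + 1 + u) l) z (a :: S z) with hS'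
  have hne : ∀ y, y ≠ n + 1 + u → y ≠ z → S' y = S y := fun y hy hy' => by
    rw [hS', Function.update_of_ne hy', Function.update_of_ne hy]
  have hz : S' z = a :: S z := Function.update_self ..
  have hsub : ∀ y ≤ n, ∀ b ∈ S y, b ∈ S' y := fun y hy b hb => by
    by_cases hyz : y = z
    · rw [hyz, hz]; rw [hyz] at hb; exact List.mem_cons_of_mem _ hb
    · rwa [hne y (by omega) hyz]
  have hl : S' (n + 1 + u) = l := by
    rw [hS', Function.update_of_ne (by omega), Function.update_self]
  refine h.change_lists (hne _ (by omega) (by omega)) hsub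
    (fun y hy b hb => ?_) (fun v hv => hne _ (fun h' => hu0 ?_) (by omega)) (fun v b hb => ?_)
    (fun j hj v hv hvj hv0 => ?_) hT.xa_le
  · by_cases hyz : y = z
    · rw [hyz, hz] at hb
      rw [hyz]
      rcases List.mem_cons.1 hb with rfl | hb
      · exact Or.inl (hT.ga_symm _ _ haz)
      · exact h.edge z hzn.le b hb
    · rw [hne _ (by omega) hyz] at hb
      exact h.edge y hy b hb
  · rwa [show u = v by omega]
  · by_cases hvu : v = u
    · subst hvu
      rw [hl] at hb
      rw [hS]
      exact List.mem_cons_of_mem _ hb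
    · rwa [hne _ (by omega) (by omega)] at hb
  · rcases h.hang j hj v hv hvj hv0 with ⟨h1, h2⟩ | ⟨k, hk, ⟨b, h1, h2⟩, h3⟩
    · obtain rfl : j = i := by omega
      rw [hu, hS] at h2
      rcases List.mem_cons.1 h2 with rfl | h2
      · refine Or.inr ⟨m + j, hk, ⟨a, by rw [hm, hz]; simp, hwa⟩, fun k' hk' q hq hadj => ?_⟩
        -- A neighbour further along the path would have a smaller number that still satisfies the
        -- bound at `x`, against minimality.
        by_contra hc
        have h4 := hle (m + j) k' (by omega) (by omega)
        have h5 := hlt (m + j) k' (by omega) (by omega)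
        have h6 := hT.ga_lt _ _ (hT.ga_symm _ _ hadj)
        have h7 := hT.d_le_of_anc h6.le hq
        rw [hm] at h4 h5
        rw [hwu] at hwd
        have := hmin q _ (hT.ga_symm _ _ hadj) (by omega) hq (hle _ _ (by omega) (by omega))
        omega
      · exact Or.inl ⟨rfl, by rwa [hu, hl]⟩
    · have := h.lt_n k hk
      exact Or.inr ⟨k, hk, ⟨b, hsub _ this.le _ h1, h2⟩, h3⟩

/-- The whole path has been visited. -/
theorem done (hT : Setup n GA XA par₀ d₀)
    (h : PathInv n GA XA par₀ a₀ ℓ c₀ ℓ num par fin S cnt) (hℓ : 0 < ℓ)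
    (hS : S (n + 1 + par₀^[ℓ - 1] a₀) = []) : MainInv n GA XA par₀ num par fin S cnt := by
  have hroot := h.dfs.num_root
  have hpath : ∀ j ≤ ℓ, num (par₀^[j] a₀) ≠ 0 := fun j hj => by
    rcases Nat.lt_or_eq_of_le hj with hj | rfl
    · rw [h.num_done j hj]; omega
    · exact h.num_above _ (.refl _)
  have hclosed : ∀ v < n, num v ≠ 0 → num (par₀ v) ≠ 0 := fun v hv hv0 => by
    rcases h.closed v hv hv0 with ⟨j, hj, rfl⟩ | h'
    · rw [← Function.iterate_succ_apply' par₀]; exact hpath _ hj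
    · exact h'
  refine ⟨h.toBaseInv, hclosed, fun p hp q hq hq0 => ?_⟩
  by_cases hxq : IsAncestor par₀ (par₀^[ℓ - 1] a₀) q
  swap
  · exact h.ga p hp q hq hq0 hxq
  have hqn := hT.ga_lt _ _ (hT.ga_symm _ _ hq)
  -- The untouched subtree that contains `q` hangs from the path just visited, since no other vertex
  -- below `x` is visited.
  obtain ⟨w, hw, hw0, hwp, hwq⟩ := hT.exists_top (by omega) hqn hq0
  have hxw : IsAncestor par₀ (par₀^[ℓ - 1] a₀) (par₀ w) := by
    have hx0 := hpath (ℓ - 1) (by omega)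
    rcases hxq.total hwq with h1 | h1
    · exact (isAncestor_iff.1 h1).resolve_left fun h2 => hx0 (h2 ▸ hw0)
    · rcases isAncestor_iff.1 h1 with h2 | h2
      · exact absurd hw0 (h2 ▸ hx0)
      · rw [← Function.iterate_succ_apply' par₀, show (ℓ - 1).succ = ℓ by omega] at h2
        exact absurd hw0 (h.num_above _ h2)
  obtain ⟨j, hj, hwj⟩ := h.num_sub _ hwp hxw
  have hhang := h.hang j hj w hw hwj hw0
  rcases hhang with ⟨h1, h2⟩ | ⟨k, hk, ⟨a, h1, h2⟩, h3⟩
  · rw [show j = ℓ - 1 by omega, hS] at h2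
    simp at h2
  · refine ⟨w, hw, hw0, hwp, hwq, _, h.mem_st k hk, ?_, a, h1, h2⟩
    rw [h.num_done k hk]
    -- If `p` is on the path, the served position `k` is at least that of `p` by `hang`; otherwise
    -- `p` was visited before the whole path. Either way the entry sits at a vertex numbered no
    -- earlier than `p`.
    rcases h.num_old p (h.dfs.st_vis p hp) with ⟨k', hk', rfl⟩ | h'
    · have := h3 k' hk' q hwq hq
      rw [h.num_done k' hk']
      omega
    · omega

end PathInv
end

/-! ### Stacks in linked lists -/

/-- The cells from `e` on hold the list `l`; all cells are among the first `ec`. -/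
def IsList (nxt tgt : ℕ → ℕ) (ec : ℕ) : ℕ → List ℕ → Prop
  | e, [] => e = 0
  | e, a :: l => e ≠ 0 ∧ e ≤ ec ∧ tgt e = a ∧ IsList nxt tgt ec (nxt e) l

/-- The new cell lies beyond all cells in use, so no existing list sees the write. Cells are never
reused, and `0` is the null pointer. -/
theorem IsList.push {nxt tgt : ℕ → ℕ} {ec e : ℕ} {l : List ℕ} (h : IsList nxt tgt ec e l)
    (x y : ℕ) :
    IsList (Function.update nxt (ec + 1) x) (Function.update tgt (ec + 1) y) (ec + 1) e l := by
  induction l generalizing e with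
  | nil => exact h
  | cons a l ih =>
    obtain ⟨h1, h2, h3, h4⟩ := h
    refine ⟨h1, by omega, ?_, ?_⟩
    · rwa [Function.update_of_ne (by omega)]
    · rw [Function.update_of_ne (by omega)]; exact ih h4

/-- Arrays `3`, `4` and `5` hold the family `S` of stacks. -/
def Rep (s : State) (S : ℕ → List ℕ) : Prop :=
  ∀ h, IsList (s.arr 4) (s.arr 5) (s.reg 6) (s.arr 3 h) (S h)

theorem Rep.congr {s s' : State} {S : ℕ → List ℕ} (h : Rep s S) (h3 : s'.arr 3 = s.arr 3)
    (h4 : s'.arr 4 = s.arr 4) (h5 : s'.arr 5 = s.arr 5) (h6 : s'.reg 6 = s.reg 6) : Rep s' S := by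
  intro i
  rw [h3, h4, h5, h6]
  exact h i

theorem Rep.eq_zero_iff {s : State} {S : ℕ → List ℕ} (h : Rep s S) (i : ℕ) :
    s.arr 3 i = 0 ↔ S i = [] := by
  have := h i
  cases hS : S i with
  | nil => rw [hS] at this; exact ⟨fun _ => rfl, fun _ => this⟩
  | cons a l => rw [hS] at this; simp [this.1]

theorem Rep.top {s : State} {S : ℕ → List ℕ} (h : Rep s S) {i a : ℕ} {l : List ℕ}
    (hS : S i = a :: l) : s.arr 5 (s.arr 3 i) = a := by
  have := h i
  rw [hS] at this
  exact this.2.2.1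

theorem Rep.pop {s s' : State} {S : ℕ → List ℕ} (h : Rep s S) {i a : ℕ} {l : List ℕ}
    (hS : S i = a :: l) (h3 : s'.arr 3 = Function.update (s.arr 3) i (s.arr 4 (s.arr 3 i)))
    (h4 : s'.arr 4 = s.arr 4) (h5 : s'.arr 5 = s.arr 5) (h6 : s'.reg 6 = s.reg 6) :
    Rep s' (Function.update S i l) := by
  intro j
  rw [h3, h4, h5, h6]
  by_cases hj : j = i
  · subst hj
    have := h j
    rw [hS] at this
    rw [Function.update_self, Function.update_self]
    exact this.2.2.2
  · rw [Function.update_of_ne hj, Function.update_of_ne hj]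
    exact h j

/-- Push register `18` onto the stack whose index is in register `17`. -/
def pushCell : Prog :=
  .setReg 6 (.reg 6 + 1) ;;
  .setArr 5 (.reg 6) (.reg 18) ;;
  .setArr 4 (.reg 6) (.get 3 (.reg 17)) ;;
  .setArr 3 (.reg 17) (.reg 6)

theorem pushCell_runs {w : ℕ} {s : State} {S : ℕ → List ℕ} (h : Rep s S)
    (hW : s.reg 6 + 1 < 2 ^ w) :
    Runs w pushCell s fun s' t => t = 14 ∧ s'.reg 6 = s.reg 6 + 1 ∧
      Rep s' (Function.update S (s.reg 17) (s.reg 18 :: S (s.reg 17))) := by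
  have m1 : 1 % 2 ^ w = 1 := Nat.mod_eq_of_lt (by omega)
  simp [pushCell, m1, Nat.mod_eq_of_lt hW]
  intro j
  by_cases hj : j = s.reg 17
  · simp [hj, State.putReg_reg, IsList]
    exact (h _).push _ _
  · simp [hj, State.putReg_reg]
    exact (h j).push _ _

/-- Push the value of `x` onto the stack `i`. -/
def push (i x : Expr) : Prog := .setReg 17 i ;; .setReg 18 x ;; pushCell

theorem push_runs {w : ℕ} {s : State} {S : ℕ → List ℕ} {i x : Expr} {iv xv : ℕ} (h : Rep s S)
    (hW : s.reg 6 + 1 < 2 ^ w) (hi : i.eval w s = iv) (hx : x.eval w (s.putReg 17 iv) = xv) :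
    Runs w (push i x) s fun s' t => t = i.cost + x.cost + 16 ∧ s'.reg 6 = s.reg 6 + 1 ∧
      Rep s' (Function.update S iv (xv :: S iv)) := by
  simp only [push, runs_seq, runs_setReg, hi, hx]
  refine (pushCell_runs (S := S) (fun j => ?_) ?_).mono ?_
  · simpa [State.putReg_reg] using h j
  · simpa [State.putReg_reg] using hW
  · rintro s' t - ⟨rfl, h6, hR⟩
    simp [State.putReg_reg] at h6 hR
    exact ⟨by omega, h6, hR⟩

/-- The total weight of the entries of the first `K` stacks. -/
def weight (K : ℕ) (wt : ℕ → ℕ) (S : ℕ → List ℕ) : ℕ :=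
  ∑ i ∈ Finset.range K, wt i * (S i).length

theorem weight_update {K : ℕ} (wt : ℕ → ℕ) (S : ℕ → List ℕ) {i : ℕ} (hi : i < K) (l : List ℕ) :
    weight K wt (Function.update S i l) + wt i * (S i).length = weight K wt S + wt i * l.length := by
  have hmem := Finset.mem_range.2 hi
  simp only [weight]
  rw [← Finset.add_sum_erase _ _ hmem, ← Finset.add_sum_erase (Finset.range K) _ hmem,
    Function.update_self]
  have : ∀ j ∈ (Finset.range K).erase i, wt j * (Function.update S i l j).length
      = wt j * (S j).length := fun j hj => by
    rw [Function.update_of_ne (Finset.ne_of_mem_erase hj)]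
  rw [Finset.sum_congr rfl this]
  ring

theorem weight_push {K : ℕ} (wt : ℕ → ℕ) (S : ℕ → List ℕ) {i : ℕ} (hi : i < K) (a : ℕ) :
    weight K wt (Function.update S i (a :: S i)) = weight K wt S + wt i := by
  have := weight_update wt S hi (a :: S i)
  rw [List.length_cons, mul_add, mul_one] at this
  omega

theorem weight_pop {K : ℕ} (wt : ℕ → ℕ) {S : ℕ → List ℕ} {i a : ℕ} {l : List ℕ} (hi : i < K)
    (hS : S i = a :: l) : weight K wt (Function.update S i l) + wt i = weight K wt S := by
  have := weight_update wt S hi l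
  rw [hS, List.length_cons, mul_add, mul_one] at this
  omega


/-! ### The main loop -/

/-- Serve the untouched subtrees that hang from vertex `13`. -/
def childLoop : Prog :=
  .loop (.get 3 (.reg 0 + 1 + .reg 13))
    (.setReg 19 (.reg 0 + 1 + .reg 13) ;;
     .setReg 15 (.get 5 (.get 3 (.reg 19))) ;;
     .setArr 3 (.reg 19) (.get 4 (.get 3 (.reg 19))) ;;
     .cond (.get 6 (.reg 15)) .skip (query ;; push (.reg 32) (.reg 31)))

/-- The first register `12` on the way up from it whose parent is visited. -/
def walkLoop : Prog :=
  .loop (.op .eq (.get 6 (.get 9 (.reg 12))) 0) (.setReg 12 (.get 9 (.reg 12)))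

/-- Visit the vertices on the way up from vertex `13`. -/
def pathLoop : Prog :=
  .loop (.op .eq (.get 6 (.reg 13)) 0)
    (.setReg 7 (.reg 7 + 1) ;;
     .setArr 6 (.reg 13) (.reg 7) ;;
     .setArr 7 (.reg 13) (.reg 14) ;;
     push (.reg 9) (.reg 13) ;;
     .setReg 14 (.reg 13) ;;
     childLoop ;;
     .setReg 13 (.get 9 (.reg 13)))

/-- Enter the untouched subtree of vertex `11` from vertex `10`. -/
def visit : Prog :=
  .setReg 12 (.reg 11) ;;
  walkLoop ;;
  .setReg 16 (.get 0 (.reg 0 + .reg 12)) ;;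
  .setReg 13 (.reg 11) ;;
  .setReg 14 (.reg 10) ;;
  pathLoop

/-- The depth first search. -/
def mainLoop : Prog :=
  .loop (.get 3 (.reg 9))
    (.setReg 10 (.get 5 (.get 3 (.reg 9))) ;;
     .cond (.get 3 (.reg 10))
      (.setReg 11 (.get 5 (.get 3 (.reg 10))) ;;
       .cond (.get 6 (.reg 11))
        (.setArr 3 (.reg 10) (.get 4 (.get 3 (.reg 10))))
        visit)
      (.setArr 8 (.reg 10) (.reg 7) ;;
       .setArr 3 (.reg 9) (.get 4 (.get 3 (.reg 9)))))

/-- What the main loop needs and does not change. The data structure is only needed if the old tree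
has edges. -/
structure CoreCtx (w n b c M : ℕ) (GA XA : ℕ → ℕ → Prop) (par₀ d₀ l₀ : ℕ → ℕ) (s : State) :
    Prop where
  setup : Setup n GA XA par₀ d₀
  reg0 : s.reg 0 = n
  reg3 : s.reg 3 = M
  reg4 : s.reg 4 = n + 2
  reg9 : s.reg 9 = 2 * n + 2
  arr9 : ∀ v < n, s.arr 9 v = par₀ v
  valid : (∃ v < n, par₀ v < n) → DSValid n GA d₀ l₀ (s.arr 0) M ∧
    (∀ v < n, ∀ u < n, IsAncestor par₀ v u ↔ d₀ v ≤ d₀ u ∧ d₀ u ≤ l₀ v) ∧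
    M < 2 ^ b ∧ 3 * n + 2 * M + 3 < 2 ^ w
  word : (n + 2) ^ 5 ≤ 2 ^ w
  levels : n + 2 ≤ 2 ^ c

theorem CoreCtx.congr {w n b c M : ℕ} {GA XA : ℕ → ℕ → Prop} {par₀ d₀ l₀ : ℕ → ℕ} {s s' : State}
    (h : CoreCtx w n b c M GA XA par₀ d₀ l₀ s) (h0 : s'.reg 0 = s.reg 0)
    (h3 : s'.reg 3 = s.reg 3) (h4 : s'.reg 4 = s.reg 4) (h9 : s'.reg 9 = s.reg 9)
    (ha0 : s'.arr 0 = s.arr 0) (ha9 : s'.arr 9 = s.arr 9) :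
    CoreCtx w n b c M GA XA par₀ d₀ l₀ s' where
  setup := h.setup
  reg0 := h0.trans h.reg0
  reg3 := h3.trans h.reg3
  reg4 := h4.trans h.reg4
  reg9 := h9.trans h.reg9
  arr9 := ha9 ▸ h.arr9
  valid := ha0 ▸ h.valid
  word := h.word
  levels := h.levels

theorem CoreCtx.of_frame {w n b c M : ℕ} {GA XA : ℕ → ℕ → Prop} {par₀ d₀ l₀ : ℕ → ℕ}
    {s s' : State} {p : Prog} (h : CoreCtx w n b c M GA XA par₀ d₀ l₀ s) (hF : Frame p s s')
    (hr : ∀ r ∈ [0, 3, 4, 9], r ∉ p.regs) (ha : ∀ a ∈ [0, 9], a ∉ p.arrs) :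
    CoreCtx w n b c M GA XA par₀ d₀ l₀ s' :=
  h.congr (hF.reg _ (hr _ (by simp))) (hF.reg _ (hr _ (by simp))) (hF.reg _ (hr _ (by simp)))
    (hF.reg _ (hr _ (by simp))) (hF.arr _ (ha _ (by simp))) (hF.arr _ (ha _ (by simp)))

/-- The number of steps reserved for an entry of a stack. -/
def wt (n b c i : ℕ) : ℕ :=
  if i ≤ n then 100 else if i < 2 * n + 2 then 300 + 100 * (c + 1) * (b + 4) else 100

section
variable {w n b c M : ℕ} {GA XA : ℕ → ℕ → Prop} {par₀ d₀ l₀ : ℕ → ℕ} {s : State}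
  {S : ℕ → List ℕ}

/-- Removing a child releases `300 + 100 * (c + 1) * (b + 4)`: enough for the query, the push, and
the weight 100 of the new entry. The cell counter plus the weight does not grow either, which keeps
addresses within a word. -/
theorem childLoop_runs {a₀ ℓ c₀ i : ℕ} (hs : CoreCtx w n b c M GA XA par₀ d₀ l₀ s)
    (hR : Rep s S)
    (hP : PathInv n GA XA par₀ a₀ ℓ c₀ (i + 1) (s.arr 6) (s.arr 7) (s.arr 8) S (s.reg 7))
    (h13 : s.reg 13 = par₀^[i] a₀) (h16 : s.reg 16 = s.arr 0 (n + par₀^[ℓ - 1] a₀))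
    (hE : s.reg 6 + weight (2 * n + 3) (wt n b c) S < 2 ^ w) :
    Runs w childLoop s fun s' t => ∃ S', Rep s' S' ∧
      PathInv n GA XA par₀ a₀ ℓ c₀ (i + 1) (s.arr 6) (s.arr 7) (s.arr 8) S' (s.reg 7) ∧
      S' (n + 1 + par₀^[i] a₀) = [] ∧
      t + weight (2 * n + 3) (wt n b c) S' ≤ weight (2 * n + 3) (wt n b c) S + 10 ∧
      s'.reg 6 + weight (2 * n + 3) (wt n b c) S' ≤
        s.reg 6 + weight (2 * n + 3) (wt n b c) S := by
  have hT := hs.setup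
  have hiℓ := hP.i_le
  have hun := hP.lt_n i (by omega)
  have hW := four_mul_le hs.word
  have m1 : 1 % 2 ^ w = 1 := Nat.mod_eq_of_lt (by omega)
  have m2 : (n + 1) % 2 ^ w = n + 1 := Nat.mod_eq_of_lt (by omega)
  have m3 : (n + 1 + par₀^[i] a₀) % 2 ^ w = n + 1 + par₀^[i] a₀ := Nat.mod_eq_of_lt (by omega)
  have hwc : wt n b c (n + 1 + par₀^[i] a₀) = 300 + 100 * (c + 1) * (b + 4) := by
    rw [wt, if_neg (by omega), if_pos (by omega)]
  have hix : n + 1 + par₀^[i] a₀ < 2 * n + 3 := by omega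
  refine (Runs.loop (B₀ := weight (2 * n + 3) (wt n b c) S) (fun s' B => ∃ S', Rep s' S' ∧
    PathInv n GA XA par₀ a₀ ℓ c₀ (i + 1) (s.arr 6) (s.arr 7) (s.arr 8) S' (s.reg 7) ∧
    B = weight (2 * n + 3) (wt n b c) S' ∧
    s'.reg 6 + B ≤ s.reg 6 + weight (2 * n + 3) (wt n b c) S) ⟨S, hR, hP, rfl, le_rfl⟩ ?_).mono ?_
  · rintro s₁ B hF ⟨S₁, hR₁, hP₁, rfl, hE₁⟩ he
    have hs₁ := hs.of_frame hF (by decide) (by decide)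
    have r13 := (hF.reg 13 (by decide)).trans h13
    have r16 := (hF.reg 16 (by decide)).trans h16
    have a6 := hF.arr 6 (by decide)
    have r0 := hs₁.reg0
    simp [r0, r13, m1, m2, m3] at he
    rw [hR₁.eq_zero_iff] at he
    obtain ⟨v, l, hv⟩ := List.exists_cons_of_ne_nil he
    have htop := hR₁.top hv
    obtain ⟨hvn, hvu⟩ := hP₁.child' _ hun.le v (by simp [hv])
    simp only [runs_seq, runs_setReg, runs_setArr, eval_add, eval_reg, eval_lit, eval_get,
      State.putReg_reg, State.putReg_arr, r0, r13, Nat.reduceEqDiff, if_true, if_false, m1, m2, m3,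
      htop, runs_cond]
    set s₂ := ((s₁.putReg 19 (n + 1 + par₀^[i] a₀)).putReg 15 v).putArr 3 (n + 1 + par₀^[i] a₀)
      (s₁.arr 4 (s₁.arr 3 (n + 1 + par₀^[i] a₀))) with hs₂
    have hR₂ : Rep s₂ (Function.update S₁ (n + 1 + par₀^[i] a₀) l) :=
      hR₁.pop hv (by simp [hs₂]) (by simp [hs₂]) (by simp [hs₂]) (by simp [hs₂, State.putReg_reg])
    have hw₂ := weight_pop (wt n b c) hix hv
    rw [hwc] at hw₂
    have e15 : s₂.reg 15 = v := by simp [hs₂, State.putReg_reg]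
    have e6 : s₂.reg 6 = s₁.reg 6 := by simp [hs₂, State.putReg_reg]
    have ea6 : s₂.arr 6 = s.arr 6 := by simp [hs₂, a6]
    have hs₂' : CoreCtx w n b c M GA XA par₀ d₀ l₀ s₂ := hs₁.congr (by simp [hs₂])
      (by simp [hs₂]) (by simp [hs₂]) (by simp [hs₂]) (by simp [hs₂]) (by simp [hs₂])
    simp only [e15, ea6]
    refine ⟨fun hc => ?_, fun hc => ?_⟩
    -- The child is visited, so there is no untouched subtree to serve.
    · rw [runs_skip]
      refine ⟨_, ⟨_, hR₂, hP₁.drop hT hv hc, rfl, by omega⟩, ?_⟩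
      simp
      omega
    · obtain ⟨hD, hanc, hMb, hMw⟩ := hs.valid ⟨v, hvn, by rw [hvu]; exact hun⟩
      have ha0 : s₂.arr 0 = s.arr 0 := by
        have := hF.arr 0 (by decide)
        simp [hs₂, this]
      have hxn := hP.lt_n (ℓ - 1) (by omega)
      have hdx : s.arr 0 (n + par₀^[ℓ - 1] a₀) = d₀ (par₀^[ℓ - 1] a₀) := hD.d_eq _ hxn
      have hq : QueryCtx w n b M (d₀ (par₀^[ℓ - 1] a₀)) (d₀ v) (l₀ v) GA d₀ l₀ s₂ :=
        ⟨ha0 ▸ hD, hs₂'.reg0, hs₂'.reg3, hs₂'.reg4, by simp [hs₂, State.putReg_reg, r16, hdx],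
          hD.d_lt _ hxn, hD.d_lt _ hvn, hD.l_lt _ hvn, hMb, hMw, hs.word⟩
      have hvd := hT.d_lt v hvn
      have hadj := hT.par_adj v hvn (by omega)
      rw [hvu] at hvd hadj
      have hsub : ∀ u < n, d₀ v ≤ d₀ u ∧ d₀ u ≤ l₀ v ↔ IsAncestor par₀ v u := fun u hu =>
        (hanc v hvn u hu).symm
      have hself := (hsub v hvn).2 (.refl v)
      have hxd : d₀ (par₀^[ℓ - 1] a₀) ≤ d₀ (par₀^[i] a₀) := by
        rcases Nat.lt_or_eq_of_le (show i ≤ ℓ - 1 by omega) with h' | h'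
        · exact (hT.d_iterate_lt h' fun k hk => hP.lt_n k (by omega)).le
        · rw [h']
      -- The tree edge from `v` to the current path vertex shows that the query has an answer.
      refine (query_runs hq e15 hvn rfl rfl hs.levels
        ⟨v, _, hadj, hvd, hself.1, hself.2, hxd⟩).mono ?_
      rintro s₃ t₃ hF₃ ⟨ht₃, hmin, haz, hdz, hlo, hhi, hxz⟩
      have han := hT.ga_lt _ _ haz
      have hzn := hT.ga_lt _ _ (hT.ga_symm _ _ haz)
      have hR₃ := hR₂.congr (hF₃.arr 3 (by decide)) (hF₃.arr 4 (by decide))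
        (hF₃.arr 5 (by decide)) (hF₃.reg 6 (by decide))
      have e6' := (hF₃.reg 6 (by decide)).trans e6
      refine (push_runs hR₃ (by omega) rfl
        (xv := s₃.reg 31) (by simp [State.putReg_reg])).mono ?_
      rintro s₄ t₄ - ⟨rfl, h6, hR₄⟩
      have hS₂z : Function.update S₁ (n + 1 + par₀^[i] a₀) l (s₃.reg 32) = S₁ (s₃.reg 32) :=
        Function.update_of_ne (by omega) _ _
      have hw₄ := weight_push (K := 2 * n + 3) (wt n b c)
        (Function.update S₁ (n + 1 + par₀^[i] a₀) l) (i := s₃.reg 32) (by omega) (s₃.reg 31)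
      rw [eval_reg] at hR₄
      rw [show wt n b c (s₃.reg 32) = 100 from if_pos hzn.le] at hw₄
      rw [hS₂z] at hR₄ hw₄
      refine ⟨_, ⟨_, hR₄, hP₁.serve hT hv haz hdz ((hsub _ han).1 ⟨hlo, hhi⟩) hxz
        fun u' z' h1 h2 h3 h4 => ?_, rfl, by omega⟩, ?_⟩
      · have hu' := hT.ga_lt _ _ h1
        have h5 := (hsub _ hu').2 h3
        exact hmin u' z' h1 h2 h5.1 h5.2 h4
      · simp
        omega
  · rintro s' t hF ⟨⟨B, ⟨S', hR', hP', rfl, hE'⟩, ht⟩, he⟩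
    have r13 := (hF.reg 13 (by decide)).trans h13
    have r0 := (hs.of_frame hF (by decide) (by decide)).reg0
    simp [r0, r13, m1, m2, m3] at he ht
    rw [hR'.eq_zero_iff] at he
    exact ⟨S', hR', hP', he, by omega, hE'⟩

end

section
variable {w n b c M : ℕ} {GA XA : ℕ → ℕ → Prop} {par₀ d₀ l₀ : ℕ → ℕ} {s : State}
  {S : ℕ → List ℕ}

theorem walkLoop_runs {a₀ ℓ : ℕ} (hs : CoreCtx w n b c M GA XA par₀ d₀ l₀ s)
    (h12 : s.reg 12 = a₀) (hℓ : 0 < ℓ) (hlt : ∀ j < ℓ, par₀^[j] a₀ < n)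
    (htodo : ∀ j < ℓ, s.arr 6 (par₀^[j] a₀) = 0) (hdone : s.arr 6 (par₀^[ℓ] a₀) ≠ 0) :
    Runs w walkLoop s fun s' t => t ≤ 20 * ℓ + 10 ∧ s'.reg 12 = par₀^[ℓ - 1] a₀ := by
  have hz : 0 % 2 ^ w = 0 := Nat.zero_mod _
  refine (Runs.loop (B₀ := 20 * ℓ) (fun s' B => ∃ j < ℓ, s'.reg 12 = par₀^[j] a₀ ∧
    B = 20 * (ℓ - j)) ⟨0, hℓ, h12, rfl⟩ ?_).mono ?_
  · rintro s₁ B hF ⟨j, hj, hr, rfl⟩ he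
    have a9 := (hs.of_frame hF (by decide) (by decide)).arr9 _ (hlt j hj)
    have a6 := hF.arr 6 (by decide)
    simp [hr, a9, a6] at he
    rw [← Function.iterate_succ_apply' par₀] at he a9
    have hj' : j + 1 < ℓ := by
      rcases Nat.lt_or_eq_of_le hj with h | h
      · exact h
      · rw [← h] at hdone; exact absurd he hdone
    simp only [runs_setReg, eval_get, eval_reg, hr, a9]
    refine ⟨_, ⟨j + 1, hj', by simp [State.putReg_reg], rfl⟩, ?_⟩
    simp
    omega
  · rintro s' t hF ⟨⟨B, ⟨j, hj, hr, rfl⟩, ht⟩, he⟩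
    have a9 := (hs.of_frame hF (by decide) (by decide)).arr9 _ (hlt j hj)
    have a6 := hF.arr 6 (by decide)
    simp [hr, a9, a6] at he
    rw [← Function.iterate_succ_apply' par₀] at he
    have hj' : j = ℓ - 1 := by
      by_contra hc
      exact he (htodo (j + 1) (by omega))
    simp at ht
    exact ⟨by omega, hj' ▸ hr⟩

/-- Each path vertex gets 900 steps, including the weight of its stack entry; the work on its
children is paid by the potential. -/
theorem pathLoop_runs {a₀ ℓ p : ℕ} {st : List ℕ} (hs : CoreCtx w n b c M GA XA par₀ d₀ l₀ s)
    (hR : Rep s S) (hℓ : 0 < ℓ)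
    (hP : PathInv n GA XA par₀ a₀ ℓ (s.reg 7) 0 (s.arr 6) (s.arr 7) (s.arr 8) S (s.reg 7))
    (h13 : s.reg 13 = a₀) (h14 : s.reg 14 = p) (hst : S (2 * n + 2) = p :: st)
    (h16 : s.reg 16 = s.arr 0 (n + par₀^[ℓ - 1] a₀))
    (hdone : s.arr 6 (par₀^[ℓ] a₀) ≠ 0)
    (hE : s.reg 6 + 900 * ℓ + weight (2 * n + 3) (wt n b c) S < 2 ^ w) :
    Runs w pathLoop s fun s' t => ∃ S', Rep s' S' ∧
      MainInv n GA XA par₀ (s'.arr 6) (s'.arr 7) (s'.arr 8) S' (s'.reg 7) ∧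
      s'.reg 7 = s.reg 7 + ℓ ∧
      t + weight (2 * n + 3) (wt n b c) S' ≤ 900 * ℓ + weight (2 * n + 3) (wt n b c) S + 10 ∧
      s'.reg 6 + weight (2 * n + 3) (wt n b c) S' ≤
        s.reg 6 + 900 * ℓ + weight (2 * n + 3) (wt n b c) S := by
  have hT := hs.setup
  have hW := four_mul_le hs.word
  have m1 : 1 % 2 ^ w = 1 := Nat.mod_eq_of_lt (by omega)
  have hws : wt n b c (2 * n + 2) = 100 := by
    rw [wt, if_neg (by omega), if_neg (by omega)]
  refine (Runs.loop (B₀ := 900 * ℓ + weight (2 * n + 3) (wt n b c) S) (fun s' B => ∃ i S',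
    Rep s' S' ∧
    PathInv n GA XA par₀ a₀ ℓ (s.reg 7) i (s'.arr 6) (s'.arr 7) (s'.arr 8) S' (s'.reg 7) ∧
    s'.reg 13 = par₀^[i] a₀ ∧ (∃ st', S' (2 * n + 2) = s'.reg 14 :: st') ∧
    (∀ j, j + 1 = i → S' (n + 1 + par₀^[j] a₀) = []) ∧
    B = 900 * (ℓ - i) + weight (2 * n + 3) (wt n b c) S' ∧
    s'.reg 6 + B ≤ s.reg 6 + 900 * ℓ + weight (2 * n + 3) (wt n b c) S)
    ⟨0, S, hR, hP, h13, ⟨st, h14 ▸ hst⟩, fun j hj => absurd hj (by omega), rfl, by omega⟩ ?_).mono ?_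
  · rintro s₁ B hF ⟨i, S₁, hR₁, hP₁, r13, ⟨st₁, hst₁⟩, hch, rfl, hE₁⟩ he
    have hs₁ := hs.of_frame hF (by decide) (by decide)
    have r16 := (hF.reg 16 (by decide)).trans h16
    have a0 := hF.arr 0 (by decide)
    have r9 := hs₁.reg9
    have hiℓ : i < ℓ := by
      rcases Nat.lt_or_eq_of_le hP₁.i_le with h' | h'
      · exact h'
      · exfalso
        simp [r13] at he
        rw [h'] at he
        exact hP₁.num_above _ (.refl _) he
    have hun := hP₁.lt_n i hiℓ
    have hcnt := hP₁.dfs.cnt_le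
    have m2 : (s₁.reg 7 + 1) % 2 ^ w = s₁.reg 7 + 1 := Nat.mod_eq_of_lt (by omega)
    have hP₂ := hP₁.push hT hiℓ hst₁ hch
    have hw₂ := weight_push (K := 2 * n + 3) (wt n b c) S₁ (i := 2 * n + 2) (by omega)
      (par₀^[i] a₀)
    rw [hws] at hw₂
    simp only [runs_seq, runs_setReg, runs_setArr, eval_add, eval_reg, eval_lit, eval_get,
      State.putReg_reg, State.putReg_arr, State.putArr_reg, r13, Nat.reduceEqDiff, if_true,
      if_false, m1, m2]
    set s₂ := ((s₁.putReg 7 (s₁.reg 7 + 1)).putArr 6 (par₀^[i] a₀) (s₁.reg 7 + 1)).putArr 7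
      (par₀^[i] a₀) (s₁.reg 14) with hs₂
    have hR₂ : Rep s₂ S₁ := hR₁.congr (by simp [hs₂]) (by simp [hs₂]) (by simp [hs₂])
      (by simp [hs₂])
    have e6 : s₂.reg 6 = s₁.reg 6 := by simp [hs₂]
    refine (push_runs hR₂ (by omega) (iv := 2 * n + 2) (xv := par₀^[i] a₀) (by simp [hs₂, r9])
      (by simp [hs₂, r13])).mono ?_
    rintro s₃ t₃ hF₃ ⟨rfl, h6₃, hR₃⟩
    rw [hst₁] at hR₃ hw₂
    have hs₃ : CoreCtx w n b c M GA XA par₀ d₀ l₀ (s₃.putReg 14 (s₃.reg 13)) :=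
      hs₁.congr
        (by simpa [hs₂] using hF₃.reg 0 (by decide))
        (by simpa [hs₂] using hF₃.reg 3 (by decide))
        (by simpa [hs₂] using hF₃.reg 4 (by decide))
        (by simpa [hs₂] using hF₃.reg 9 (by decide))
        (by simpa [hs₂] using hF₃.arr 0 (by decide))
        (by simpa [hs₂] using hF₃.arr 9 (by decide))
    have f13 : s₃.reg 13 = par₀^[i] a₀ := by simpa [hs₂, r13] using hF₃.reg 13 (by decide)
    have f7 : s₃.reg 7 = s₁.reg 7 + 1 := by simpa [hs₂] using hF₃.reg 7 (by decide)
    have f16 : s₃.reg 16 = s.arr 0 (n + par₀^[ℓ - 1] a₀) := by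
      simpa [hs₂, r16] using hF₃.reg 16 (by decide)
    have g0 : s₃.arr 0 = s.arr 0 := by simpa [hs₂, a0] using hF₃.arr 0 (by decide)
    have g6 := hF₃.arr 6 (by decide)
    have g7 := hF₃.arr 7 (by decide)
    have g8 := hF₃.arr 8 (by decide)
    simp [hs₂] at g6 g7 g8
    rw [← g6, ← g7, ← g8, ← f7] at hP₂
    refine (childLoop_runs hs₃ (hR₃.congr rfl rfl rfl (by simp [State.putReg_reg]))
      (by simpa [State.putReg_reg] using hP₂) (by simpa [State.putReg_reg] using f13)
      (by simpa [State.putReg_reg, g0] using f16)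
      (by simp [State.putReg_reg]; omega)).mono ?_
    rintro s₄ t₄ hF₄ ⟨S₄, hR₄, hP₄, hemp, ht₄, hE₄⟩
    have k6 := hF₄.arr 6 (by decide)
    have k7 := hF₄.arr 7 (by decide)
    have k8 := hF₄.arr 8 (by decide)
    have k9 := (hs₃.of_frame hF₄ (by decide) (by decide)).arr9 _ hun
    have l7 := hF₄.reg 7 (by decide)
    have l13 := hF₄.reg 13 (by decide)
    have l14 := hF₄.reg 14 (by decide)
    simp [State.putReg_reg] at k6 k7 k8 l7 l13 l14 hP₄ hE₄
    rw [f13] at l13 l14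
    rw [← k6, ← k7, ← k8, ← l7] at hP₄
    obtain ⟨t', st', hst', -⟩ := hP₄.top
    -- The last visited vertex has the maximal number `cnt`, and numbers on the stack decrease from
    -- the top, so it is the top.
    have htop : t' = par₀^[i] a₀ := by
      have h1 := hP₄.dfs
      rw [hst'] at h1
      have h2 := h1.num_top (hst' ▸ hP₄.mem_st i (by omega))
      rw [hP₄.num_done i (by omega)] at h2
      have h3 := h1.num_le t'
      have h4 := hP₄.cnt_eq
      refine h1.inj t' _ (h1.st_vis _ (by simp)) ?_
      rw [hP₄.num_done i (by omega)]
      omega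
    rw [htop] at hst'
    simp only [l13, k9]
    refine ⟨900 * (ℓ - (i + 1)) + weight (2 * n + 3) (wt n b c) S₄, ⟨i + 1, S₄, ?_,
      by simpa [State.putReg_reg] using hP₄, ?_, ⟨st', by simp [hst', l14]⟩, ?_,
      rfl, ?_⟩, ?_⟩
    · exact hR₄.congr rfl rfl rfl (by simp [State.putReg_reg])
    · rw [Function.iterate_succ_apply']
    · intro j hj
      obtain rfl : j = i := by omega
      exact hemp
    · omega
    · simp
      omega
  · rintro s' t hF ⟨⟨B, ⟨i, S', hR', hP', r13, -, hch, rfl, hE'⟩, ht⟩, he⟩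
    have hi : i = ℓ := by
      by_contra hc
      simp [r13] at he
      exact he (hP'.num_todo i le_rfl (lt_of_le_of_ne hP'.i_le hc))
    subst hi
    simp at ht
    exact ⟨S', hR', hP'.done hT hℓ (hch _ (by omega)), hP'.cnt_eq, by omega, by omega⟩

/-- Here `ℓ` is the least height at which a visited ancestor of `a₀` occurs, so the path ends at the
root `x` of the untouched subtree. Charging 2000 to each newly visited vertex covers both the walk
that finds `x` and the visit of the path. -/
theorem visit_runs {a₀ p : ℕ} {st l : List ℕ} (hs : CoreCtx w n b c M GA XA par₀ d₀ l₀ s)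
    (hR : Rep s S)
    (hP : MainInv n GA XA par₀ (s.arr 6) (s.arr 7) (s.arr 8) S (s.reg 7))
    (h11 : s.reg 11 = a₀) (h10 : s.reg 10 = p) (hst : S (2 * n + 2) = p :: st)
    (hSp : S p = a₀ :: l) (ha : s.arr 6 a₀ = 0)
    (hE : s.reg 6 + 2000 * (n + 1 - s.reg 7) + weight (2 * n + 3) (wt n b c) S < 2 ^ w) :
    Runs w visit s fun s' t => ∃ S', Rep s' S' ∧
      MainInv n GA XA par₀ (s'.arr 6) (s'.arr 7) (s'.arr 8) S' (s'.reg 7) ∧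
      t + 2000 * (n + 1 - s'.reg 7) + weight (2 * n + 3) (wt n b c) S' + 500 ≤
        2000 * (n + 1 - s.reg 7) + weight (2 * n + 3) (wt n b c) S ∧
      s'.reg 6 + 2000 * (n + 1 - s'.reg 7) + weight (2 * n + 3) (wt n b c) S' ≤
        s.reg 6 + 2000 * (n + 1 - s.reg 7) + weight (2 * n + 3) (wt n b c) S := by
  have hT := hs.setup
  have hroot := hP.dfs.num_root
  have hW := four_mul_le hs.word
  have hpn : p ≤ n := hP.dfs.le_n p (hP.dfs.st_vis p (by simp [hst]))
  have han : a₀ < n := by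
    refine lt_of_le_of_ne (hT.le _ _ (hT.symm _ _ (hP.edge p hpn a₀ (by simp [hSp])))) fun h' => ?_
    rw [h'] at ha
    omega
  have hex : ∃ ℓ, s.arr 6 (par₀^[ℓ] a₀) ≠ 0 := by
    obtain ⟨v, h1, h2, h3, i, h4⟩ := hT.exists_top (num := s.arr 6) (by omega) han ha
    exact ⟨i + 1, by rw [Function.iterate_succ_apply', h4]; exact h3⟩
  classical
  obtain ⟨ℓ, hdone, htodo⟩ : ∃ ℓ, s.arr 6 (par₀^[ℓ] a₀) ≠ 0 ∧
      ∀ j < ℓ, s.arr 6 (par₀^[j] a₀) = 0 :=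
    ⟨Nat.find hex, Nat.find_spec hex, fun j hj => not_not.1 (Nat.find_min hex hj)⟩
  have hℓ : 0 < ℓ := Nat.pos_of_ne_zero fun h' => by
    rw [h'] at hdone
    exact hdone ha
  have hP₀ := hP.start hT hst hSp hℓ htodo hdone
  have hxn := hP₀.lt_n (ℓ - 1) (by omega)
  -- The path consists of `ℓ` distinct unvisited vertices, and `s.reg 7` of the `n + 1` vertices are
  -- visited.
  have hℓn : ℓ ≤ n + 1 - s.reg 7 := by
    have hcard := hP.dfs.card
    have hsub : (Finset.range ℓ).image (fun j => par₀^[j] a₀) ⊆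
        (Finset.range (n + 1)).filter (fun v => ¬ s.arr 6 v ≠ 0) := by
      intro v hv
      obtain ⟨j, hj, rfl⟩ := Finset.mem_image.1 hv
      have hj := Finset.mem_range.1 hj
      have := hP₀.lt_n j hj
      simp [htodo j hj]
      omega
    have h1 := Finset.card_le_card hsub
    rw [Finset.card_image_of_injOn, Finset.card_range] at h1
    · have h2 := Finset.card_filter_add_card_filter_not (s := Finset.range (n + 1))
        (fun v => s.arr 6 v ≠ 0)
      rw [Finset.card_range] at h2
      omega
    · have key : ∀ i j, i < j → j < ℓ → par₀^[i] a₀ ≠ par₀^[j] a₀ := fun i j hij hj h' => by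
        have := hT.d_iterate_lt (a := a₀) hij fun k hk => hP₀.lt_n k (by omega)
        rw [h'] at this
        omega
      intro i hi j hj hij
      simp at hi hj
      by_contra hne
      rcases Nat.lt_or_gt_of_ne hne with h' | h'
      · exact key i j h' hj hij
      · exact key j i h' hi hij.symm
  simp only [visit, runs_seq, runs_setReg, eval_reg, h11]
  refine (walkLoop_runs (s := s.putReg 12 a₀) (a₀ := a₀) (hs.congr (by simp) (by simp) (by simp) (by simp) rfl rfl)
    (by simp) hℓ hP₀.lt_n htodo hdone).mono ?_
  rintro s₁ t₁ hF₁ ⟨ht₁, r12⟩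
  have hs₁ : CoreCtx w n b c M GA XA par₀ d₀ l₀ s₁ :=
    (hs.congr (s' := s.putReg 12 a₀) (by simp) (by simp) (by simp) (by simp) rfl rfl).of_frame hF₁
      (by decide) (by decide)
  have r0 := hs₁.reg0
  have r6 := hF₁.reg 6 (by decide)
  have r7 := hF₁.reg 7 (by decide)
  have r10 := hF₁.reg 10 (by decide)
  have r11 := hF₁.reg 11 (by decide)
  have k0 := hF₁.arr 0 (by decide)
  have k3 := hF₁.arr 3 (by decide)
  have k4 := hF₁.arr 4 (by decide)
  have k5 := hF₁.arr 5 (by decide)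
  have k6 := hF₁.arr 6 (by decide)
  have k7 := hF₁.arr 7 (by decide)
  have k8 := hF₁.arr 8 (by decide)
  simp [h10, h11] at r6 r7 r10 r11 k0 k3 k4 k5 k6 k7 k8
  have m1 : (n + par₀^[ℓ - 1] a₀) % 2 ^ w = n + par₀^[ℓ - 1] a₀ := Nat.mod_eq_of_lt (by omega)
  simp only [eval_get, eval_add, eval_reg, r0, r12, m1, State.putReg_reg, Nat.reduceEqDiff,
    if_false, r10, r11, k0]
  set s₂ := ((s₁.putReg 16 (s.arr 0 (n + par₀^[ℓ - 1] a₀))).putReg 13 a₀).putReg 14 p with hs₂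
  have hs₂' : CoreCtx w n b c M GA XA par₀ d₀ l₀ s₂ :=
    hs₁.congr (by simp [hs₂]) (by simp [hs₂]) (by simp [hs₂]) (by simp [hs₂]) rfl rfl
  refine (pathLoop_runs (a₀ := a₀) (p := p) hs₂' (hR.congr k3 k4 k5 (by simp [hs₂, r6])) hℓ ?_ (by simp [hs₂])
    (by simp [hs₂]) hst ?_ ?_ ?_).mono ?_
  · simpa [hs₂, k6, k7, k8, r7] using hP₀
  · simp [hs₂, k0]
  · simpa [hs₂, k6] using hdone
  · simp [hs₂, r6]
    omega
  · rintro s' t - ⟨S', hR', hP', h7, ht, hE'⟩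
    simp [hs₂, r7, r6] at h7 hE'
    refine ⟨S', hR', hP', ?_, by omega⟩
    simp
    omega

/-- The budget is 2000 per unvisited vertex plus the weight of the lists. A pass either discards a
visited entry, visits a path, or finishes the top, and is paid from one of these. -/
theorem mainLoop_runs (hs : CoreCtx w n b c M GA XA par₀ d₀ l₀ s) (hR : Rep s S)
    (hP : MainInv n GA XA par₀ (s.arr 6) (s.arr 7) (s.arr 8) S (s.reg 7))
    (hE : s.reg 6 + 2000 * (n + 1 - s.reg 7) + weight (2 * n + 3) (wt n b c) S < 2 ^ w) :
    Runs w mainLoop s fun s' t => ∃ S', S' (2 * n + 2) = [] ∧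
      MainInv n GA XA par₀ (s'.arr 6) (s'.arr 7) (s'.arr 8) S' (s'.reg 7) ∧
      t ≤ 2000 * (n + 1 - s.reg 7) + weight (2 * n + 3) (wt n b c) S + 10 := by
  have hT := hs.setup
  have hws : wt n b c (2 * n + 2) = 100 := by
    rw [wt, if_neg (by omega), if_neg (by omega)]
  refine (Runs.loop (B₀ := 2000 * (n + 1 - s.reg 7) + weight (2 * n + 3) (wt n b c) S)
    (fun s' B => ∃ S', Rep s' S' ∧
    MainInv n GA XA par₀ (s'.arr 6) (s'.arr 7) (s'.arr 8) S' (s'.reg 7) ∧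
    B = 2000 * (n + 1 - s'.reg 7) + weight (2 * n + 3) (wt n b c) S' ∧
    s'.reg 6 + B < 2 ^ w) ⟨S, hR, hP, rfl, by omega⟩ ?_).mono ?_
  · rintro s₁ B hF ⟨S₁, hR₁, hP₁, rfl, hE₁⟩ he
    have hs₁ := hs.of_frame hF (by decide) (by decide)
    have r9 := hs₁.reg9
    simp [r9] at he
    rw [hR₁.eq_zero_iff] at he
    obtain ⟨p, st, hst⟩ := List.exists_cons_of_ne_nil he
    have htop := hR₁.top hst
    have hpn : p ≤ n := hP₁.dfs.le_n p (hP₁.dfs.st_vis p (by simp [hst]))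
    simp only [runs_seq, runs_setReg, runs_cond, eval_get, eval_reg, r9, htop, State.putReg_reg,
      if_true, State.putReg_arr]
    refine ⟨fun hc => ?_, fun hc => ?_⟩
    · rw [ne_eq, hR₁.eq_zero_iff] at hc
      obtain ⟨a, l, hSp⟩ := List.exists_cons_of_ne_nil hc
      have htop' := hR₁.top hSp
      rw [htop']
      refine ⟨fun ha => ?_, fun ha => ?_⟩
      · have hw := weight_pop (K := 2 * n + 3) (wt n b c) (by omega) hSp
        rw [show wt n b c p = 100 from if_pos hpn] at hw
        rw [runs_setArr]
        refine ⟨_, ⟨Function.update S₁ p l, ?_, ?_, rfl, ?_⟩, ?_⟩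
        · exact hR₁.pop hSp (by simp) (by simp) (by simp) (by simp)
        · simpa using hP₁.drop hT hpn hSp ha
        · simp
          omega
        · simp
          omega
      · refine (visit_runs (s := (s₁.putReg 10 p).putReg 11 a) (hs₁.congr (by simp) (by simp)
          (by simp) (by simp) rfl rfl) (hR₁.congr rfl rfl rfl (by simp)) (by simpa using hP₁)
          (by simp) (by simp) hst hSp ha (by simp; omega)).mono ?_
        rintro s₂ t₂ - ⟨S₂, hR₂, hP₂, ht₂, hE₂⟩
        simp at ht₂ hE₂
        refine ⟨_, ⟨S₂, hR₂, hP₂, rfl, by omega⟩, ?_⟩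
        simp
        omega
    · rw [hR₁.eq_zero_iff] at hc
      have hw := weight_pop (K := 2 * n + 3) (wt n b c) (by omega) hst
      rw [hws] at hw
      simp only [runs_setArr]
      refine ⟨_, ⟨Function.update S₁ (2 * n + 2) st, ?_, ?_, rfl, ?_⟩, ?_⟩
      · exact hR₁.pop hst (by simp [r9]) (by simp) (by simp) (by simp)
      · simpa using hP₁.finish hT hst hc
      · simp
        omega
      · simp
        omega
  · rintro s' t hF ⟨⟨B, ⟨S', hR', hP', rfl, hE'⟩, ht⟩, he⟩
    have r9 := (hs.of_frame hF (by decide) (by decide)).reg9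
    simp [r9] at he ht
    rw [hR'.eq_zero_iff] at he
    exact ⟨S', he, hP', by omega⟩

end

/-! ### The search with its initialization -/

/-- Set up the parents in the old tree and the lists of children, and join the root to all
vertices. -/
def initTree : Prog :=
  .loop (.op .lt (.reg 8) (.reg 0))
    (.cond (.reg 5) (.setArr 9 (.reg 8) (.get 0 (.reg 8))) (.setArr 9 (.reg 8) (.reg 0)) ;;
     push (.reg 0 + 1 + .get 9 (.reg 8)) (.reg 8) ;;
     push (.reg 0) (.reg 8) ;;
     .setReg 8 (.reg 8 + 1))

/-- Enter the inserted edges in the adjacency lists. -/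
def initEdges : Prog :=
  .loop (.op .lt (.reg 8) (.reg 2))
    (push (.get 1 (.reg 8)) (.get 2 (.reg 8)) ;;
     push (.get 2 (.reg 8)) (.get 1 (.reg 8)) ;;
     .setReg 8 (.reg 8 + 1))

/-- The search. Register `5` tells whether an old tree is given in array `0`. -/
def core : Prog :=
  .setReg 4 (.reg 0 + 2) ;;
  .setReg 9 (2 * .reg 0 + 2) ;;
  .setReg 8 0 ;;
  initTree ;;
  .setReg 8 0 ;;
  initEdges ;;
  .setArr 6 (.reg 0) 1 ;;
  .setReg 7 1 ;;
  .setArr 7 (.reg 0) (.reg 0) ;;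
  push (.reg 9) (.reg 0) ;;
  mainLoop

/-- The edges `(x i, y i)`, `i < k`, and the edges from the root. -/
def Added (n k : ℕ) (x y : ℕ → ℕ) (u v : ℕ) : Prop :=
  (u = n ∧ v < n ∨ v = n ∧ u < n) ∨ ∃ i < k, x i = u ∧ y i = v ∨ x i = v ∧ y i = u

/-- The lists while they are set up: the first `a` vertices and the first `e` edges have been
entered. -/
structure InitInv (n k : ℕ) (par₀ x y : ℕ → ℕ) (a e : ℕ) (S : ℕ → List ℕ) : Prop where
  edge : ∀ h ≤ n, ∀ v ∈ S h, Added n k x y h v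
  root : ∀ v < a, v ∈ S n
  child : ∀ v < a, v ∈ S (n + 1 + par₀ v)
  child' : ∀ u ≤ n, ∀ v ∈ S (n + 1 + u), v < n ∧ par₀ v = u
  added : ∀ i < e, y i ∈ S (x i) ∧ x i ∈ S (y i)
  stack : S (2 * n + 2) = []

theorem InitInv.push {n k a e : ℕ} {par₀ x y : ℕ → ℕ} {S : ℕ → List ℕ}
    (h : InitInv n k par₀ x y a e S) {i v : ℕ} (hi : i < 2 * n + 2)
    (hedge : i ≤ n → Added n k x y i v) (hch : ∀ u ≤ n, i = n + 1 + u → v < n ∧ par₀ v = u) :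
    InitInv n k par₀ x y a e (Function.update S i (v :: S i)) := by
  have hmem : ∀ j, ∀ b ∈ S j, b ∈ Function.update S i (v :: S i) j := fun j b hb => by
    by_cases hj : j = i
    · subst hj; rw [Function.update_self]; exact List.mem_cons_of_mem _ hb
    · rwa [Function.update_of_ne hj]
  have hmem' : ∀ j, ∀ b ∈ Function.update S i (v :: S i) j, j = i ∧ b = v ∨ b ∈ S j :=
    fun j b hb => by
      by_cases hj : j = i
      · subst hj
        rw [Function.update_self] at hb
        exact (List.mem_cons.1 hb).imp (fun h => ⟨rfl, h⟩) id
      · rw [Function.update_of_ne hj] at hb; exact Or.inr hb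
  refine ⟨fun j hj b hb => ?_, fun j hj => hmem _ _ (h.root j hj),
    fun j hj => hmem _ _ (h.child j hj), fun u hu b hb => ?_,
    fun j hj => ⟨hmem _ _ (h.added j hj).1, hmem _ _ (h.added j hj).2⟩, ?_⟩
  · rcases hmem' j b hb with ⟨rfl, rfl⟩ | hb
    · exact hedge hj
    · exact h.edge j hj b hb
  · rcases hmem' _ b hb with ⟨h1, rfl⟩ | hb
    · exact hch u hu h1.symm
    · exact h.child' u hu b hb
  · rw [Function.update_of_ne (by omega)]; exact h.stack

section
variable {w n b c k : ℕ} {par₀ x y : ℕ → ℕ} {s : State}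

/-- Every vertex contributes one child entry and one entry in the list of the root. With the star
all child entries are in the list of the dummy root, which the search never serves. -/
theorem initTree_runs (h0 : s.reg 0 = n) (h8 : s.reg 8 = 0) (h6 : s.reg 6 = 0)
    (h3 : ∀ i, s.arr 3 i = 0)
    (hpar : ∀ v < n, par₀ v = if s.reg 5 ≠ 0 then s.arr 0 v else n)
    (hle : ∀ v < n, par₀ v ≤ n) (hW : 3 * n + 10 < 2 ^ w) :
    Runs w initTree s fun s' t => t ≤ 100 * n + 10 ∧ s'.reg 6 = 2 * n ∧
      (∀ v < n, s'.arr 9 v = par₀ v) ∧ ∃ S, Rep s' S ∧ InitInv n k par₀ x y n 0 S ∧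
        weight (2 * n + 3) (wt n b c) S = n * (400 + 100 * (c + 1) * (b + 4)) := by
  have m1 : 1 % 2 ^ w = 1 := Nat.mod_eq_of_lt (by omega)
  have m2 : (n + 1) % 2 ^ w = n + 1 := Nat.mod_eq_of_lt (by omega)
  refine (Runs.loop (B₀ := 100 * n) (fun s' B => ∃ i ≤ n, s'.reg 8 = i ∧ B = 100 * (n - i) ∧
    s'.reg 6 = 2 * i ∧ (∀ v < i, s'.arr 9 v = par₀ v) ∧ ∃ S, Rep s' S ∧
    InitInv n k par₀ x y i 0 S ∧
    weight (2 * n + 3) (wt n b c) S = i * (400 + 100 * (c + 1) * (b + 4))) ?_ ?_).mono ?_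
  · refine ⟨0, by omega, h8, rfl, h6, fun v hv => absurd hv (by omega), fun _ => [],
      fun i => h3 i, ⟨?_, ?_, ?_, ?_, ?_, rfl⟩, by simp [weight]⟩ <;> simp
  · rintro s₁ B hF ⟨i, hi, r8, rfl, r6, h9, S, hR, hI, hw⟩ he
    have r0 := (hF.reg 0 (by decide)).trans h0
    have r5 := hF.reg 5 (by decide)
    have a0 := hF.arr 0 (by decide)
    simp [r8, r0] at he
    have m3 : (n + 1 + par₀ i) % 2 ^ w = n + 1 + par₀ i :=
      Nat.mod_eq_of_lt (by have := hle i he; omega)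
    have m4 : (i + 1) % 2 ^ w = i + 1 := Nat.mod_eq_of_lt (by omega)
    rw [runs_seq]
    refine Runs.mono (Q := fun s' t => s' = s₁.putArr 9 i (par₀ i) ∧ t ≤ 10) ?_ ?_
    · rw [runs_cond]
      refine ⟨fun hc => ?_, fun hc => ?_⟩
      · rw [eval_reg, r5] at hc
        simp [r8, a0, hpar i he, hc]
      · rw [eval_reg, r5] at hc
        simp [r8, r0, hpar i he, hc]
    rintro s₂ t₂ - ⟨rfl, ht₂⟩
    rw [runs_seq]
    have hpi := hle i he
    refine (push_runs (S := S) (iv := n + 1 + par₀ i) (xv := i)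
      (hR.congr (by simp) (by simp) (by simp) (by simp)) (by simp [r6]; omega)
      (by simp [r0, r8, m1, m2, m3]) (by simp [r8])).mono ?_
    rintro s₃ t₃ hF₃ ⟨rfl, h6₃, hR₃⟩
    have f0 := hF₃.reg 0 (by decide)
    have f8 := hF₃.reg 8 (by decide)
    have f9 := hF₃.arr 9 (by decide)
    simp [r0, r6, r8] at f0 f8 f9 h6₃
    have hI₃ := hI.push (i := n + 1 + par₀ i) (v := i) (by omega) (fun h => absurd h (by omega))
      (fun u hu h => ⟨he, by omega⟩)
    have hw₃ := weight_push (K := 2 * n + 3) (wt n b c) S (i := n + 1 + par₀ i) (by omega) i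
    rw [show wt n b c (n + 1 + par₀ i) = 300 + 100 * (c + 1) * (b + 4) by
      rw [wt, if_neg (by omega), if_pos (by omega)]] at hw₃
    rw [runs_seq]
    refine (push_runs hR₃ (by omega) (iv := n) (xv := i) (by simp [f0])
      (by simp [f8, State.putReg_reg])).mono ?_
    rintro s₄ t₄ hF₄ ⟨rfl, h6₄, hR₄⟩
    have g8 := (hF₄.reg 8 (by decide)).trans f8
    have g9 := (hF₄.arr 9 (by decide)).trans f9
    have hI₄ := hI₃.push (i := n) (v := i) (by omega) (fun h => Or.inl (Or.inl ⟨rfl, he⟩))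
      (fun u hu h => absurd h (by omega))
    have hw₄ := weight_push (K := 2 * n + 3) (wt n b c)
      (Function.update S (n + 1 + par₀ i) (i :: S (n + 1 + par₀ i))) (i := n) (by omega) i
    rw [show wt n b c n = 100 from if_pos le_rfl] at hw₄
    rw [runs_setReg]
    simp only [eval_add, eval_reg, eval_lit, g8, m1, m4]
    refine ⟨100 * (n - (i + 1)), ⟨i + 1, he, by simp, rfl, ?_, ?_, _,
      hR₄.congr rfl rfl rfl (by simp), ⟨hI₄.edge, ?_, ?_, hI₄.child', hI₄.added, hI₄.stack⟩, ?_⟩,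
      ?_⟩
    · simp; omega
    · intro v hv
      rw [State.putReg_arr, g9]
      by_cases hvi : v = i
      · simp [hvi]
      · rw [Function.update_of_ne hvi]; exact h9 v (by omega)
    · intro v hv
      rcases Nat.lt_succ_iff_lt_or_eq.1 hv with hv | rfl
      · exact hI₄.root v hv
      · rw [Function.update_self]; simp
    · intro v hv
      rcases Nat.lt_succ_iff_lt_or_eq.1 hv with hv | rfl
      · exact hI₄.child v hv
      · rw [Function.update_of_ne (by omega), Function.update_self]; simp
    · rw [add_mul, one_mul]
      omega
    · simp
      omega
  · rintro s' t hF ⟨⟨B, ⟨i, hi, r8, rfl, r6, h9, S, hR, hI, hw⟩, ht⟩, he⟩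
    have r0 := (hF.reg 0 (by decide)).trans h0
    simp [r8, r0] at he ht
    obtain rfl : i = n := by omega
    exact ⟨by omega, r6, h9, S, hR, hI, hw⟩

theorem initEdges_runs {S₀ : ℕ → List ℕ} (h2 : s.reg 2 = k) (h8 : s.reg 8 = 0)
    (hx : ∀ i < k, s.arr 1 i = x i) (hy : ∀ i < k, s.arr 2 i = y i) (hR : Rep s S₀)
    (hI : InitInv n k par₀ x y n 0 S₀) (hxn : ∀ i < k, x i < n) (hyn : ∀ i < k, y i < n)
    (hW : s.reg 6 + 2 * k + 10 < 2 ^ w) :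
    Runs w initEdges s fun s' t => t ≤ 100 * k + 10 ∧ s'.reg 6 = s.reg 6 + 2 * k ∧
      ∃ S, Rep s' S ∧ InitInv n k par₀ x y n k S ∧
        weight (2 * n + 3) (wt n b c) S = weight (2 * n + 3) (wt n b c) S₀ + 200 * k := by
  have m1 : 1 % 2 ^ w = 1 := Nat.mod_eq_of_lt (by omega)
  refine (Runs.loop (B₀ := 100 * k) (fun s' B => ∃ i ≤ k, s'.reg 8 = i ∧ B = 100 * (k - i) ∧
    s'.reg 6 = s.reg 6 + 2 * i ∧ ∃ S, Rep s' S ∧ InitInv n k par₀ x y n i S ∧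
    weight (2 * n + 3) (wt n b c) S = weight (2 * n + 3) (wt n b c) S₀ + 200 * i)
    ⟨0, by omega, h8, rfl, rfl, S₀, hR, hI, rfl⟩ ?_).mono ?_
  · rintro s₁ B hF ⟨i, hi, r8, rfl, r6, S, hR, hI, hw⟩ he
    have r2 := (hF.reg 2 (by decide)).trans h2
    have a1 := hF.arr 1 (by decide)
    have a2 := hF.arr 2 (by decide)
    simp [r8, r2] at he
    have m4 : (i + 1) % 2 ^ w = i + 1 := Nat.mod_eq_of_lt (by omega)
    have hxi := hxn i he
    have hyi := hyn i he
    rw [runs_seq]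
    refine (push_runs hR (iv := x i) (xv := y i) (by omega) (by simp [r8, a1, hx i he])
      (by simp [r8, a2, hy i he, State.putReg_reg])).mono ?_
    rintro s₃ t₃ hF₃ ⟨rfl, h6₃, hR₃⟩
    have f8 := (hF₃.reg 8 (by decide)).trans r8
    have f1 := (hF₃.arr 1 (by decide)).trans a1
    have f2 := (hF₃.arr 2 (by decide)).trans a2
    have hI₃ := hI.push (i := x i) (v := y i) (by omega)
      (fun h => Or.inr ⟨i, he, Or.inl ⟨rfl, rfl⟩⟩) (fun u hu h => absurd h (by omega))
    have hw₃ := weight_push (K := 2 * n + 3) (wt n b c) S (i := x i) (by omega) (y i)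
    rw [show wt n b c (x i) = 100 from if_pos (by omega)] at hw₃
    rw [runs_seq]
    refine (push_runs hR₃ (iv := y i) (xv := x i) (by omega) (by simp [f8, f2, hy i he])
      (by simp [f8, f1, hx i he, State.putReg_reg])).mono ?_
    rintro s₄ t₄ hF₄ ⟨rfl, h6₄, hR₄⟩
    have g8 := (hF₄.reg 8 (by decide)).trans f8
    have hI₄ := hI₃.push (i := y i) (v := x i) (by omega)
      (fun h => Or.inr ⟨i, he, Or.inr ⟨rfl, rfl⟩⟩) (fun u hu h => absurd h (by omega))
    have hw₄ := weight_push (K := 2 * n + 3) (wt n b c)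
      (Function.update S (x i) (y i :: S (x i))) (i := y i) (by omega) (x i)
    rw [show wt n b c (y i) = 100 from if_pos (by omega)] at hw₄
    rw [runs_setReg]
    simp only [eval_add, eval_reg, eval_lit, g8, m1, m4]
    refine ⟨100 * (k - (i + 1)), ⟨i + 1, he, by simp, rfl, ?_, _,
      hR₄.congr rfl rfl rfl (by simp),
      ⟨hI₄.edge, hI₄.root, hI₄.child, hI₄.child', ?_, hI₄.stack⟩, by omega⟩, ?_⟩
    · simp; omega
    · intro j hj
      rcases Nat.lt_succ_iff_lt_or_eq.1 hj with hj | rfl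
      · exact hI₄.added j hj
      · refine ⟨?_, by rw [Function.update_self]; simp⟩
        by_cases hxy : x j = y j
        · rw [hxy, Function.update_self]; simp
        · rw [Function.update_of_ne hxy, Function.update_self]; simp
    · simp
      omega
  · rintro s' t hF ⟨⟨B, ⟨i, hi, r8, rfl, r6, S, hR, hI, hw⟩, ht⟩, he⟩
    have r2 := (hF.reg 2 (by decide)).trans h2
    simp [r8, r2] at he ht
    obtain rfl : i = k := by omega
    exact ⟨by omega, r6, S, hR, hI, hw⟩

/-- Only the root is visited, and it has no edge of `GA`, so nothing has to be covered yet; all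
added edges are in the lists. -/
theorem InitInv.mainInv {GA : ℕ → ℕ → Prop} {d₀ num par fin : ℕ → ℕ} {S : ℕ → List ℕ}
    (h : InitInv n k par₀ x y n k S) (hT : Setup n GA (Added n k x y) par₀ d₀)
    (hpar : par n = n) (hnum : ∀ v, num v = if v = n then 1 else 0) :
    MainInv n GA (Added n k x y) par₀ num par fin (Function.update S (2 * n + 2) [n]) 1 := by
  have hne : ∀ z, z ≠ 2 * n + 2 → Function.update S (2 * n + 2) [n] z = S z := fun z hz =>
    Function.update_of_ne hz _ _
  have hunv : ∀ v, num v = 0 → v ≠ n := fun v hv h' => by rw [hnum, if_pos h'] at hv; omega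
  refine ⟨⟨?_, fun p q hpq hq => ?_, fun z hz v hv => ?_, fun v hv hv0 => ?_, fun u hu v hv => ?_⟩,
    fun v hv hv0 => ?_, fun p hp q hpq => ?_⟩
  · rw [Function.update_self]
    exact DFSInv.init hT.irrefl hpar hnum
  · have := hT.xa_le _ _ hpq
    rw [hne _ (by omega)]
    have hqn := hunv q hq
    rcases hpq with (⟨rfl, h1⟩ | ⟨h1, -⟩) | ⟨i, hi, ⟨rfl, rfl⟩ | ⟨rfl, rfl⟩⟩
    · exact h.root q h1
    · exact absurd h1 hqn
    · exact (h.added i hi).1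
    · exact (h.added i hi).2
  · rw [hne _ (by omega)] at hv
    exact Or.inr (h.edge z hz v hv)
  · have := hT.par_le v hv
    rw [hne _ (by omega)]
    exact h.child v hv
  · rw [hne _ (by omega)] at hv
    exact h.child' u hu v hv
  · rw [hnum, if_neg (by omega)] at hv0
    exact absurd rfl hv0
  · rw [Function.update_self] at hp
    have := hT.ga_lt _ _ hpq
    simp at hp
    omega

/-- One statement serves all uses. `hvalid` asks for a data structure only if some old tree edge
avoids the dummy root, so it is vacuous for the star. -/
theorem core_runs {M : ℕ} {GA : ℕ → ℕ → Prop} {d₀ l₀ : ℕ → ℕ}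
    (hT : Setup n GA (Added n k x y) par₀ d₀) (h0 : s.reg 0 = n) (h2 : s.reg 2 = k)
    (h3 : s.reg 3 = M) (h6 : s.reg 6 = 0) (ha3 : ∀ i, s.arr 3 i = 0) (ha6 : ∀ i, s.arr 6 i = 0)
    (hx : ∀ i < k, s.arr 1 i = x i) (hy : ∀ i < k, s.arr 2 i = y i)
    (hxn : ∀ i < k, x i < n) (hyn : ∀ i < k, y i < n)
    (hpar : ∀ v < n, par₀ v = if s.reg 5 ≠ 0 then s.arr 0 v else n)
    (hvalid : (∃ v < n, par₀ v < n) → DSValid n GA d₀ l₀ (s.arr 0) M ∧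
      (∀ v < n, ∀ u < n, IsAncestor par₀ v u ↔ d₀ v ≤ d₀ u ∧ d₀ u ≤ l₀ v) ∧
      M < 2 ^ b ∧ 3 * n + 2 * M + 3 < 2 ^ w)
    (hword : (n + 2) ^ 5 ≤ 2 ^ w) (hlevels : n + 2 ≤ 2 ^ c)
    (hE : 3000 * n + 3000 + n * (400 + 100 * (c + 1) * (b + 4)) + 400 * k < 2 ^ w) :
    Runs w core s fun s' t =>
      t ≤ 3000 * n + 3000 + n * (400 + 100 * (c + 1) * (b + 4)) + 400 * k ∧
      DFSInv (fun u v => GA u v ∨ Added n k x y u v) n (s'.arr 6) (s'.arr 7) (s'.arr 8) []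
        (s'.reg 7) ∧ ∀ v ≤ n, s'.arr 6 v ≠ 0 := by
  have m1 : 1 % 2 ^ w = 1 := Nat.mod_eq_of_lt (by omega)
  have m2 : 2 % 2 ^ w = 2 := Nat.mod_eq_of_lt (by omega)
  have m3 : (n + 2) % 2 ^ w = n + 2 := Nat.mod_eq_of_lt (by omega)
  have m4 : (2 * n) % 2 ^ w = 2 * n := Nat.mod_eq_of_lt (by omega)
  have m5 : (2 * n + 2) % 2 ^ w = 2 * n + 2 := Nat.mod_eq_of_lt (by omega)
  have m0 : 0 % 2 ^ w = 0 := Nat.zero_mod _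
  simp only [core, runs_seq, runs_setReg, eval_add, eval_mul, eval_reg, eval_lit, State.putReg_reg,
    Nat.reduceEqDiff, if_false, h0, m0, m1, m2, m3, m4, m5]
  set s₁ := ((s.putReg 4 (n + 2)).putReg 9 (2 * n + 2)).putReg 8 0 with hs₁
  refine (initTree_runs (s := s₁) (n := n) (b := b) (c := c) (k := k) (x := x) (y := y)
    (by simp [hs₁, h0]) (by simp [hs₁]) (by simp [hs₁, h6]) (by simpa [hs₁] using ha3)
    (by simpa [hs₁] using hpar) hT.par_le (by omega)).mono ?_
  rintro s₂ t₂ hF₂ ⟨ht₂, h6₂, h9₂, S₂, hR₂, hI₂, hw₂⟩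
  refine (initEdges_runs (s := s₂.putReg 8 0) (n := n) (b := b) (c := c) (k := k) (x := x) (y := y)
    (by simpa [hs₁, h2] using hF₂.reg 2 (by decide)) (by simp)
    (fun i hi => by simpa [hs₁, hx i hi] using congrFun (hF₂.arr 1 (by decide)) i)
    (fun i hi => by simpa [hs₁, hy i hi] using congrFun (hF₂.arr 2 (by decide)) i)
    (hR₂.congr rfl rfl rfl (by simp)) hI₂ hxn hyn (by simp [h6₂]; omega)).mono ?_
  rintro s₃ t₃ hF₃ ⟨ht₃, h6₃, S₃, hR₃, hI₃, hw₃⟩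
  have hreg : ∀ r, r ∉ initTree.regs → r ∉ initEdges.regs → r ≠ 8 → s₃.reg r = s₁.reg r :=
    fun r h h' h'' => by rw [hF₃.reg r h', State.putReg_reg, if_neg h'', hF₂.reg r h]
  have harr : ∀ r, r ∉ initTree.arrs → r ∉ initEdges.arrs → s₃.arr r = s₁.arr r :=
    fun r h h' => by rw [hF₃.arr r h', State.putReg_arr, hF₂.arr r h]
  have f0 : s₃.reg 0 = n := by
    rw [hreg 0 (by decide) (by decide) (by decide)]; simp [hs₁, h0]
  have f3 : s₃.reg 3 = M := by
    rw [hreg 3 (by decide) (by decide) (by decide)]; simp [hs₁, h3]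
  have f4 : s₃.reg 4 = n + 2 := by
    rw [hreg 4 (by decide) (by decide) (by decide)]; simp [hs₁]
  have f9 : s₃.reg 9 = 2 * n + 2 := by
    rw [hreg 9 (by decide) (by decide) (by decide)]; simp [hs₁]
  have g0 : s₃.arr 0 = s.arr 0 := by
    rw [harr 0 (by decide) (by decide)]; rfl
  have g6 : s₃.arr 6 = s.arr 6 := by
    rw [harr 6 (by decide) (by decide)]; rfl
  have g9 : ∀ v < n, s₃.arr 9 v = par₀ v := by
    rw [hF₃.arr 9 (by decide)]; exact h9₂
  simp at h6₃
  simp only [runs_setArr, eval_reg, eval_lit, f0, m1, State.putArr_reg, State.putReg_reg,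
    Nat.reduceEqDiff, if_false]
  set s₄ := ((s₃.putArr 6 n 1).putReg 7 1).putArr 7 n n with hs₄
  refine (push_runs (s := s₄) (S := S₃) (iv := 2 * n + 2) (xv := n)
    (hR₃.congr (by simp [hs₄]) (by simp [hs₄]) (by simp [hs₄]) (by simp [hs₄]))
    (by simp [hs₄]; omega) (by simp [hs₄, f9]) (by simp [hs₄, f0])).mono ?_
  rintro s₅ t₅ hF₅ ⟨rfl, h6₅, hR₅⟩
  rw [hI₃.stack] at hR₅
  have hw₅ := weight_push (K := 2 * n + 3) (wt n b c) S₃ (i := 2 * n + 2) (by omega) n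
  rw [show wt n b c (2 * n + 2) = 100 by rw [wt, if_neg (by omega), if_neg (by omega)],
    hI₃.stack] at hw₅
  have k6 : s₅.arr 6 = Function.update (s.arr 6) n 1 := by
    rw [hF₅.arr 6 (by decide)]; simp [hs₄, g6]
  have k7 : s₅.arr 7 n = n := by
    rw [hF₅.arr 7 (by decide)]; simp [hs₄]
  have r7 : s₅.reg 7 = 1 := by
    rw [hF₅.reg 7 (by decide)]; simp [hs₄]
  have hM₅ := hI₃.mainInv (fin := s₅.arr 8) (num := s₅.arr 6) hT k7 (fun v => by
    rw [k6, Function.update_apply, ha6])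
  rw [← r7] at hM₅
  have hctx : CoreCtx w n b c M GA (Added n k x y) par₀ d₀ l₀ s₅ := by
    refine ⟨hT, ?_, ?_, ?_, ?_, ?_, ?_, hword, hlevels⟩
    · rw [hF₅.reg 0 (by decide)]; simp [hs₄, f0]
    · rw [hF₅.reg 3 (by decide)]; simp [hs₄, f3]
    · rw [hF₅.reg 4 (by decide)]; simp [hs₄, f4]
    · rw [hF₅.reg 9 (by decide)]; simp [hs₄, f9]
    · rw [hF₅.arr 9 (by decide)]; simpa [hs₄] using g9
    · rw [hF₅.arr 0 (by decide)]; simpa [hs₄, g0] using hvalid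
  have e6 : s₄.reg 6 = s₃.reg 6 := by simp [hs₄]
  refine (mainLoop_runs hctx hR₅ hM₅ (by omega)).mono ?_
  rintro s₆ t₆ - ⟨S₆, hS₆, hM₆, ht₆⟩
  refine ⟨?_, hS₆ ▸ hM₆.dfs, hM₆.all_visited hT hS₆⟩
  simp
  omega

end

/-! ### Graphs on natural numbers -/

/-- `x i` and `y i`, `i < k`, are the endpoints of the edges. -/
def EdgeRel (k : ℕ) (x y : ℕ → ℕ) (u v : ℕ) : Prop :=
  ∃ i < k, x i = u ∧ y i = v ∨ x i = v ∧ y i = u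

theorem EdgeRel.congr {k : ℕ} {x y x' y' : ℕ → ℕ} (hx : ∀ i < k, x' i = x i)
    (hy : ∀ i < k, y' i = y i) (u v : ℕ) : EdgeRel k x' y' u v ↔ EdgeRel k x y u v := by
  refine exists_congr fun i => and_congr_right fun hi => ?_
  rw [hx i hi, hy i hi]

theorem EdgeRel.append {k m : ℕ} {x y x' y' x'' y'' : ℕ → ℕ} (hx : ∀ i < k, x'' i = x i)
    (hy : ∀ i < k, y'' i = y i) (hx' : ∀ i < m, x'' (k + i) = x' i)
    (hy' : ∀ i < m, y'' (k + i) = y' i) (u v : ℕ) :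
    EdgeRel (k + m) x'' y'' u v ↔ EdgeRel k x y u v ∨ EdgeRel m x' y' u v := by
  rw [← EdgeRel.congr hx hy, ← EdgeRel.congr (x' := fun i => x'' (k + i))
    (y' := fun i => y'' (k + i)) hx' hy']
  constructor
  · rintro ⟨i, hi, h⟩
    by_cases hik : i < k
    · exact Or.inl ⟨i, hik, h⟩
    · refine Or.inr ⟨i - k, by omega, ?_⟩
      simpa only [Nat.add_sub_of_le (not_lt.1 hik)] using h
  · rintro (⟨i, hi, h⟩ | ⟨i, hi, h⟩)
    · exact ⟨i, by omega, h⟩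
    · exact ⟨k + i, by omega, h⟩

/-- Adjacency in `G`, as a relation on the natural numbers. -/
def NatAdj {n : ℕ} (G : SimpleGraph (Fin n)) (u v : ℕ) : Prop :=
  ∃ a b : Fin n, G.Adj a b ∧ a.val = u ∧ b.val = v

section
variable {n : ℕ} {G : SimpleGraph (Fin n)} {u v : ℕ}

theorem NatAdj.symm (h : NatAdj G u v) : NatAdj G v u := by
  obtain ⟨a, b, h, ha, hb⟩ := h
  exact ⟨b, a, h.symm, hb, ha⟩

theorem NatAdj.ne (h : NatAdj G u v) : u ≠ v := by
  obtain ⟨a, b, h, rfl, rfl⟩ := h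
  exact fun h' => h.ne (Fin.ext h')

theorem NatAdj.lt (h : NatAdj G u v) : u < n := by
  obtain ⟨a, b, h, rfl, rfl⟩ := h
  exact a.2

theorem fsts_getD {L : List (Fin n × Fin n)} {i : ℕ} (hi : i < L.length) :
    (fsts L).getD i 0 = L[i].1 := by
  simp [fsts, hi]

theorem snds_getD {L : List (Fin n × Fin n)} {i : ℕ} (hi : i < L.length) :
    (snds L).getD i 0 = L[i].2 := by
  simp [snds, hi]

theorem edgeRel_list {L : List (Fin n × Fin n)} {S : Set (Sym2 (Fin n))} (hL : Lists L S) :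
    EdgeRel L.length ((fsts L).getD · 0) ((snds L).getD · 0) u v ↔
      ∃ a b : Fin n, s(a, b) ∈ S ∧ a.val = u ∧ b.val = v := by
  constructor
  · rintro ⟨i, hi, h⟩
    simp only [fsts_getD hi, snds_getD hi] at h
    have hm : s(L[i].1, L[i].2) ∈ S := by
      rw [hL.2]
      exact List.mem_map.2 ⟨L[i], List.getElem_mem hi, rfl⟩
    rcases h with ⟨rfl, rfl⟩ | ⟨rfl, rfl⟩
    · exact ⟨_, _, hm, rfl, rfl⟩
    · exact ⟨_, _, Sym2.eq_swap ▸ hm, rfl, rfl⟩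
  · rintro ⟨a, b, hab, rfl, rfl⟩
    rw [hL.2, List.mem_map] at hab
    obtain ⟨p, hp, he⟩ := hab
    obtain ⟨i, hi, rfl⟩ := List.getElem_of_mem hp
    refine ⟨i, hi, ?_⟩
    simp only [fsts_getD hi, snds_getD hi]
    rcases Sym2.eq_iff.1 he with ⟨h1, h2⟩ | ⟨h1, h2⟩
    · exact Or.inl ⟨congrArg _ h1, congrArg _ h2⟩
    · exact Or.inr ⟨congrArg _ h1, congrArg _ h2⟩

theorem Lists.edgeRel {L : List (Fin n × Fin n)} (hL : Lists L G.edgeSet) :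
    EdgeRel L.length ((fsts L).getD · 0) ((snds L).getD · 0) u v ↔ NatAdj G u v := by
  rw [edgeRel_list hL]
  rfl

theorem Lists.length_eq {L : List (Fin n × Fin n)} {S : Set (Sym2 (Fin n))} (hL : Lists L S) :
    L.length = S.ncard := by
  classical
  have : S = ((L.map fun p => s(p.1, p.2)).toFinset : Set (Sym2 (Fin n))) := by
    ext e
    rw [List.coe_toFinset]
    exact hL.2 e
  rw [this, Set.ncard_coe_finset, List.toFinset_card_of_nodup hL.1, List.length_map]

/-- A crude bound, only used to see that indices and counters fit into a word. -/
theorem Lists.length_le {L : List (Fin n × Fin n)} {S : Set (Sym2 (Fin n))} (hL : Lists L S) :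
    L.length ≤ n * n := by
  classical
  have hinj : L.Nodup := List.Nodup.of_map _ hL.1
  rw [← List.toFinset_card_of_nodup hinj]
  refine (Finset.card_le_univ _).trans ?_
  simp

theorem natAdj_insertEdges {U : Finset (Sym2 (Fin n))} (hU : ∀ e ∈ U, ¬ e.IsDiag)
    {L : List (Fin n × Fin n)} (hL : Lists L (U : Set (Sym2 (Fin n)))) :
    NatAdj (insertEdges G U) u v ↔
      NatAdj G u v ∨ EdgeRel L.length ((fsts L).getD · 0) ((snds L).getD · 0) u v := by
  rw [edgeRel_list hL]
  constructor
  · rintro ⟨a, b, h, ha, hb⟩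
    rw [insertEdges, SimpleGraph.sup_adj, SimpleGraph.fromEdgeSet_adj] at h
    exact h.imp (fun h => ⟨a, b, h, ha, hb⟩) fun h => ⟨a, b, h.1, ha, hb⟩
  · rintro (⟨a, b, h, ha, hb⟩ | ⟨a, b, h, ha, hb⟩)
    · exact ⟨a, b, Or.inl h, ha, hb⟩
    · refine ⟨a, b, Or.inr ?_, ha, hb⟩
      rw [SimpleGraph.fromEdgeSet_adj]
      exact ⟨h, fun hab => hU _ h (by simpa using hab)⟩

/-- The adjacency of the augmented graph. -/
def AugAdj (G : SimpleGraph (Fin n)) (u v : ℕ) : Prop :=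
  (u = n ∧ v < n ∨ v = n ∧ u < n) ∨ NatAdj G u v

theorem augment_adj (p q : Fin (n + 1)) : (augment G).Adj p q ↔ AugAdj G p q := by
  rw [augment, SimpleGraph.sup_adj, SimpleGraph.map_adj', SimpleGraph.fromRel_adj, AugAdj, or_comm]
  have hp := p.2
  have hq := q.2
  refine or_congr ?_ ?_
  · simp only [Fin.ext_iff, Fin.val_last, ne_eq]
    omega
  · constructor
    · rintro ⟨-, a, b, h, rfl, rfl⟩
      exact ⟨a, b, h, rfl, rfl⟩
    · rintro ⟨a, b, h, ha, hb⟩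
      have := h.ne
      simp only [ne_eq, Fin.ext_iff] at this
      exact ⟨fun h' => this (by rw [ha, hb, h']), a, b, h, Fin.ext ha, Fin.ext hb⟩

/-- The result of a finished depth first search of the augmented graph. -/
structure Searched (G : SimpleGraph (Fin n)) (num par fin : ℕ → ℕ) : Prop where
  dfs : ∃ cnt, DFSInv (AugAdj G) n num par fin [] cnt
  visited : ∀ v ≤ n, num v ≠ 0

variable {num par fin : ℕ → ℕ}

theorem Searched.par_le (h : Searched G num par fin) {v : ℕ} (hv : v ≤ n) : par v ≤ n := by
  obtain ⟨cnt, hd⟩ := h.dfs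
  exact hd.le_n _ (hd.par_vis v (h.visited v hv))

theorem Searched.reports (h : Searched G num par fin) {s : State}
    (hs : ∀ v < n, s.arr 0 v = par v) : ReportsDFSTree G s := by
  obtain ⟨cnt, hd⟩ := h.dfs
  let f : Fin (n + 1) → Fin (n + 1) := fun v =>
    ⟨par v, Nat.lt_succ_of_le (h.par_le (Nat.le_of_lt_succ v.2))⟩
  have hit : ∀ i, ∀ v : Fin (n + 1), (f^[i] v).val = par^[i] v := by
    intro i
    induction i with
    | zero => exact fun _ => rfl
    | succ i ih => exact fun v => by rw [Function.iterate_succ_apply, ih]; rfl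
  have hanc : ∀ a v : Fin (n + 1), IsAncestor par a v → IsAncestor f a v := by
    rintro a v ⟨i, hi⟩
    exact ⟨i, Fin.ext ((hit i v).trans hi)⟩
  have hvis : ∀ v : Fin (n + 1), num v ≠ 0 := fun v => h.visited v (Nat.le_of_lt_succ v.2)
  refine ⟨f, ⟨Fin.ext hd.par_root, fun v hv => ?_, fun v => ?_, fun u v huv => ?_⟩,
    fun v => hs v v.2⟩
  · rw [augment_adj]
    exact hd.adj_par v (hvis v) fun h' => hv (Fin.ext h')
  · exact hanc (Fin.last n) v (hd.root_anc v (hvis v))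
  · rw [augment_adj] at huv
    exact (hd.no_cross u v (hvis u) (hvis v) huv).imp (hanc _ _) (hanc _ _)

theorem Searched.isAncestor_iff (h : Searched G num par fin) {w u : ℕ} (hw : w ≤ n) (hu : u ≤ n) :
    IsAncestor par w u ↔ num w ≤ num u ∧ num u ≤ fin w := by
  obtain ⟨cnt, hd⟩ := h.dfs
  exact hd.fin_anc w (h.visited w hw) (by simp) u (h.visited u hu)

theorem Searched.num_lt (h : Searched G num par fin) (v : ℕ) : num v < n + 2 := by
  obtain ⟨cnt, hd⟩ := h.dfs
  have := hd.num_le v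
  have := hd.cnt_le
  omega

theorem Searched.fin_lt (h : Searched G num par fin) {v : ℕ} (hv : v ≤ n) : fin v < n + 2 := by
  obtain ⟨cnt, hd⟩ := h.dfs
  have := hd.fin_le v (h.visited v hv) (by simp)
  have := hd.cnt_le
  omega

theorem Searched.num_ne (h : Searched G num par fin) {u v : ℕ} (hv : v ≤ n)
    (huv : v ≠ u) : num v ≠ num u := by
  obtain ⟨cnt, hd⟩ := h.dfs
  exact fun h' => huv (hd.inj _ _ (h.visited v hv) h')

theorem AugAdj.ne (h : AugAdj G u v) : u ≠ v := by
  rcases h with h | h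
  · omega
  · exact h.ne

/-- A depth first search tree of `G` serves for the insertion of edges into `G`. -/
theorem Searched.setup (h : Searched G num par fin) {k : ℕ} {x y : ℕ → ℕ}
    (hx : ∀ i < k, x i < n) (hy : ∀ i < k, y i < n) (hxy : ∀ i < k, x i ≠ y i) :
    Setup n (NatAdj G) (Added n k x y) par num := by
  obtain ⟨cnt, hd⟩ := h.dfs
  refine ⟨fun u v => NatAdj.symm, fun v h' => h'.ne rfl, fun u v h' => h'.lt, ?_, ?_, ?_, ?_,
    hd.par_root, fun v hv => h.par_le hv.le, fun v hv hpv => ?_, fun v hv => ?_,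
    fun u v huv => ?_⟩
  · rintro u v (h' | ⟨i, hi, h'⟩)
    · exact Or.inl h'.symm
    · exact Or.inr ⟨i, hi, h'.symm⟩
  · rintro v (h' | ⟨i, hi, h'⟩)
    · omega
    · rcases h' with ⟨h1, h2⟩ | ⟨h1, h2⟩ <;> exact hxy i hi (h1.trans h2.symm)
  · rintro u v (h' | ⟨i, hi, h'⟩)
    · omega
    · have := hx i hi
      have := hy i hi
      omega
  · exact fun v hv => Or.inl (Or.inl ⟨rfl, hv⟩)
  · rcases hd.adj_par v (h.visited v hv.le) hv.ne with h' | h'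
    · omega
    · exact h'
  -- An ancestor has a number at most as large, and distinct visited vertices have distinct numbers.
  · have h1 := (h.isAncestor_iff (h.par_le hv.le) hv.le).1 (isAncestor_par v)
    have h2 : par v ≠ v := (AugAdj.ne (hd.adj_par v (h.visited v hv.le) hv.ne)).symm
    have h3 := h.num_ne (h.par_le hv.le) h2
    omega
  · have hu := huv.lt
    have hv := huv.symm.lt
    exact hd.no_cross u v (h.visited u hu.le) (h.visited v hv.le) (Or.inr huv)

/-- Without an old graph, the star serves as the tree. -/
theorem setup_star {k : ℕ} {x y : ℕ → ℕ}
    (hx : ∀ i < k, x i < n) (hy : ∀ i < k, y i < n) (hxy : ∀ i < k, x i ≠ y i) :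
    Setup n (fun _ _ => False) (Added n k x y) (fun _ => n) (fun v => if v = n then 0 else 1) := by
  refine ⟨fun u v => id, fun v => id, fun u v => False.elim, ?_, ?_, ?_, ?_,
    rfl, fun v hv => le_rfl, fun v hv hpv => ?_, fun v hv => ?_, fun u v => False.elim⟩
  · rintro u v (h' | ⟨i, hi, h'⟩)
    · exact Or.inl h'.symm
    · exact Or.inr ⟨i, hi, h'.symm⟩
  · rintro v (h' | ⟨i, hi, h'⟩)
    · omega
    · rcases h' with ⟨h1, h2⟩ | ⟨h1, h2⟩ <;> exact hxy i hi (h1.trans h2.symm)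
  · rintro u v (h' | ⟨i, hi, h'⟩)
    · omega
    · have := hx i hi
      have := hy i hi
      omega
  · exact fun v hv => Or.inl (Or.inl ⟨rfl, hv⟩)
  · exact absurd hpv (lt_irrefl n)
  · simp [hv.ne]

end

/-! ### Loops that are not timed -/

/-- No time bound is claimed for the preprocessing, so for its own loops a decreasing measure
suffices. -/
theorem Runs.loop_of_measure {w e p s₀} (I : State → ℕ → Prop) (h₀ : ∃ B, I s₀ B)
    (hstep : ∀ s B, Frame p s₀ s → I s B → e.eval w s ≠ 0 →
      Runs w p s fun s' _ => ∃ B', I s' B' ∧ B' < B) :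
    Runs w (.loop e p) s₀ fun s _ => (∃ B, I s B) ∧ e.eval w s = 0 := by
  obtain ⟨B₀, h₀⟩ := h₀
  suffices H : ∀ B s, Frame p s₀ s → I s B → Runs w (.loop e p) s fun s _ =>
      (∃ B', I s B') ∧ e.eval w s = 0 from H B₀ s₀ (.rfl' _ _) h₀
  intro B
  induction B using Nat.strong_induction_on with
  | _ B ih =>
    intro s hF hI
    by_cases he : e.eval w s = 0
    · exact ⟨s, _, .loopFalse he, ⟨B, hI⟩, he⟩
    · obtain ⟨s₁, t₁, hx₁, B₁, hI₁, hB₁⟩ := hstep s B hF hI he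
      obtain ⟨s₂, t₂, hx₂, h₂⟩ := ih B₁ hB₁ s₁ (hF.trans hx₁.frame) hI₁
      exact ⟨s₂, _, .loopTrue he hx₁ hx₂, h₂⟩

/-! ### Sorting -/

/-- Sort the part of array `0` from `3 * n` on. -/
def sort : Prog :=
  .setReg 8 0 ;;
  .loop (.op .lt (.reg 8) (.reg 3))
    (.setReg 30 (3 * .reg 0 + .reg 8) ;;
     .cond (.reg 8)
      (.cond (.op .lt (.get 0 (.reg 30)) (.get 0 (.reg 30 - 1)))
        (.setReg 29 (.get 0 (.reg 30)) ;;
         .setArr 0 (.reg 30) (.get 0 (.reg 30 - 1)) ;;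
         .setArr 0 (.reg 30 - 1) (.reg 29) ;;
         .setReg 8 (.reg 8 - 1))
        (.setReg 8 (.reg 8 + 1)))
      (.setReg 8 (.reg 8 + 1)))

theorem sum_lt_of_swap {f g : ℕ → ℕ} {M j : ℕ} (hj : j + 1 < M)
    (h : ∀ i, i ≠ j → i ≠ j + 1 → f i = g i) (h' : f j + f (j + 1) < g j + g (j + 1)) :
    ∑ i ∈ Finset.range M, f i < ∑ i ∈ Finset.range M, g i := by
  have h1 : j ∈ Finset.range M := by simp; omega
  have h2 : j + 1 ∈ (Finset.range M).erase j := by simp; omega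
  rw [← Finset.add_sum_erase _ f h1, ← Finset.add_sum_erase _ g h1, ← Finset.add_sum_erase _ f h2,
    ← Finset.add_sum_erase _ g h2]
  have : ∑ i ∈ ((Finset.range M).erase j).erase (j + 1), f i
      = ∑ i ∈ ((Finset.range M).erase j).erase (j + 1), g i :=
    Finset.sum_congr rfl fun i hi => by
      simp only [Finset.mem_erase] at hi
      exact h i hi.2.1 hi.1
  omega

/-- The function `A` with the values at `j` and `j + 1` exchanged. -/
def swapAt (A : ℕ → ℕ) (j : ℕ) : ℕ → ℕ :=
  Function.update (Function.update A (j + 1) (A j)) j (A (j + 1))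

theorem swapAt_apply (A : ℕ → ℕ) (j i : ℕ) :
    swapAt A j i = if i = j then A (j + 1) else if i = j + 1 then A j else A i := by
  simp only [swapAt, Function.update_apply]

theorem swapAt_values {A : ℕ → ℕ} {j M : ℕ} (hj : j + 1 < M) (y : ℕ) :
    (∃ i < M, swapAt A j i = y) ↔ ∃ i < M, A i = y := by
  simp only [swapAt_apply]
  constructor
  · rintro ⟨i, hi, h⟩
    split_ifs at h
    · exact ⟨j + 1, hj, h⟩
    · exact ⟨j, by omega, h⟩
    · exact ⟨i, hi, h⟩
  · rintro ⟨i, hi, h⟩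
    by_cases h1 : i = j
    · exact ⟨j + 1, hj, by simpa [← h1]⟩
    · by_cases h2 : i = j + 1
      · exact ⟨j, by omega, by simpa [← h2]⟩
      · exact ⟨i, hi, by simpa [h1, h2]⟩

/-- Earlier positions weigh more, so moving the smaller value forward lowers the weighted sum. -/
theorem swapAt_potential {A : ℕ → ℕ} {j M : ℕ} (hj : j + 1 < M) (h : A (j + 1) < A j) :
    ∑ i ∈ Finset.range M, swapAt A j i * (M - i) < ∑ i ∈ Finset.range M, A i * (M - i) := by
  refine sum_lt_of_swap hj (fun i h1 h2 => by simp [swapAt_apply, h1, h2]) ?_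
  obtain ⟨r, hr⟩ : ∃ r, M - (j + 1) = r := ⟨_, rfl⟩
  obtain ⟨a, ha⟩ := Nat.exists_eq_add_of_lt h
  rw [show M - j = r + 1 by omega, hr]
  simp only [swapAt_apply, if_true, if_neg (show ¬ j + 1 = j by omega), ha]
  ring_nf
  omega

/-- A cursor moves right over sorted positions and steps left after each exchange of neighbours.
Simplicity matters here, not speed. -/
theorem sort_runs {w M N : ℕ} {s : State} (h3 : s.reg 3 = M) (hN : 3 * s.reg 0 = N)
    (hW : N + M + 3 < 2 ^ w) :
    Runs w sort s fun s' _ => (∀ i < N, s'.arr 0 i = s.arr 0 i) ∧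
      (∀ i j, i ≤ j → j < M → s'.arr 0 (N + i) ≤ s'.arr 0 (N + j)) ∧
      ∀ y, (∃ i < M, s'.arr 0 (N + i) = y) ↔ ∃ i < M, s.arr 0 (N + i) = y := by
  have m0 : 0 % 2 ^ w = 0 := Nat.zero_mod _
  have m1 : 1 % 2 ^ w = 1 := Nat.mod_eq_of_lt (by omega)
  have m3 : 3 % 2 ^ w = 3 := Nat.mod_eq_of_lt (by omega)
  have mN : N % 2 ^ w = N := Nat.mod_eq_of_lt (by omega)
  rw [sort, runs_seq, runs_setReg]
  refine (Runs.loop_of_measure (fun s' B => ∃ A : ℕ → ℕ, (∀ i, s'.arr 0 (N + i) = A i) ∧ s'.reg 8 ≤ M ∧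
    (∀ i j, i ≤ j → j < s'.reg 8 → A i ≤ A j) ∧ (∀ i < N, s'.arr 0 i = s.arr 0 i) ∧
    (∀ y, (∃ i < M, A i = y) ↔ ∃ i < M, s.arr 0 (N + i) = y) ∧
    -- The factor 2 makes an exchange outweigh the step of the cursor to the left.
    2 * ∑ i ∈ Finset.range M, A i * (M - i) + (M - s'.reg 8) ≤ B)
    ?_ ?_).mono ?_
  · exact ⟨_, fun i => s.arr 0 (N + i), fun _ => rfl, by simp, by simp, fun _ _ => rfl,
      fun _ => Iff.rfl, le_rfl⟩
  · rintro s₁ B hF ⟨A, hA, hj, hmono, hlow, hval, hB⟩ he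
    have r0 : 3 * s₁.reg 0 = N := by simpa using (congrArg (3 * ·) (hF.reg 0 (by decide))).trans hN
    have r3 : s₁.reg 3 = M := (hF.reg 3 (by decide)).trans (by simpa using h3)
    simp [r3] at he
    have m8 : (N + s₁.reg 8) % 2 ^ w = N + s₁.reg 8 := Nat.mod_eq_of_lt (by omega)
    have m9 : (s₁.reg 8 + 1) % 2 ^ w = s₁.reg 8 + 1 := Nat.mod_eq_of_lt (by omega)
    obtain ⟨P, hP⟩ : ∃ P, ∑ i ∈ Finset.range M, A i * (M - i) = P := ⟨_, rfl⟩
    rw [hP] at hB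
    rcases Nat.eq_zero_or_pos (s₁.reg 8) with h8 | h8
    · simp [h8, m1, m3, r0, mN]
      refine ⟨_, ⟨A, hA, by omega, fun i j hij hj => ?_, hlow, hval, le_rfl⟩, ?_⟩
      · rw [show i = j by omega]
      · omega
    · obtain ⟨j, hj'⟩ : ∃ j, s₁.reg 8 = j + 1 := ⟨s₁.reg 8 - 1, by omega⟩
      simp only [hj'] at m8 m9 hmono he ⊢
      have e1 : N + (j + 1) - 1 = N + j := by omega
      simp [hj', m1, m3, r0, mN, m8, e1, hA]
      refine ⟨fun hc => ?_, fun hc => ?_⟩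
      · have hpot := swapAt_potential (A := A) he hc
        refine ⟨_, ⟨swapAt A j, fun i => ?_, by omega, fun a b hab hb => ?_, fun i hi => ?_,
          fun y => (swapAt_values he y).trans (hval y), le_rfl⟩, ?_⟩
        · simp only [Function.update_apply, swapAt_apply, hA, Nat.add_left_cancel_iff]
        · rw [swapAt_apply, swapAt_apply, if_neg (by omega), if_neg (by omega), if_neg (by omega),
            if_neg (by omega)]
          exact hmono a b hab (by omega)
        · rw [Function.update_of_ne (by omega), Function.update_of_ne (by omega), hlow i hi]
        · omega
      · rw [m9]
        refine ⟨_, ⟨A, fun _ => rfl, by omega, fun a b hab hb => ?_, hlow, hval, le_rfl⟩, ?_⟩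
        · rcases Nat.lt_or_eq_of_le (Nat.le_of_lt_succ hb) with hb | rfl
          · exact hmono a b hab hb
          · rcases Nat.lt_or_eq_of_le hab with hab | rfl
            · exact (hmono a j (by omega) (by omega)).trans hc
            · exact le_rfl
        · omega
  · rintro s' t hF ⟨⟨B, A, hA, hj, hmono, hlow, hval, -⟩, he⟩
    have r3 : s'.reg 3 = M := (hF.reg 3 (by decide)).trans (by simpa using h3)
    simp [r3] at he
    obtain rfl : s'.reg 8 = M := by omega
    simp only [hA]
    exact ⟨hlow, hmono, hval⟩


/-! ### The preprocessing -/

/-- Copy the tree with its numbering to array `0`. -/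
def copyTree : Prog :=
  .setReg 8 0 ;;
  .loop (.op .lt (.reg 8) (.reg 0))
    (.setArr 0 (.reg 8) (.get 7 (.reg 8)) ;;
     .setArr 0 (.reg 0 + .reg 8) (.get 6 (.reg 8)) ;;
     .setArr 0 (2 * .reg 0 + .reg 8) (.get 8 (.reg 8)) ;;
     .setReg 8 (.reg 8 + 1))

/-- Orient edge `8` upwards. -/
def orient : Prog :=
  .cond (.op .lt (.get 6 (.get 1 (.reg 8))) (.get 6 (.get 2 (.reg 8))))
    (.setReg 31 (.get 2 (.reg 8)) ;; .setReg 32 (.get 1 (.reg 8)))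
    (.setReg 31 (.get 1 (.reg 8)) ;; .setReg 32 (.get 2 (.reg 8)))

/-- Generate the entries for all powers of two and all edges. -/
def generate : Prog :=
  .setReg 4 (.reg 0 + 2) ;;
  .setReg 20 1 ;;
  .setReg 8 0 ;;
  .setReg 3 0 ;;
  .loop (.op .lt (.reg 20) (.reg 4))
    (.cond (.op .lt (.reg 8) (.reg 1))
      (orient ;;
       .setArr 0 (3 * .reg 0 + .reg 3)
        ((((.reg 20 * .reg 4 + .get 6 (.reg 31) / .reg 20) * .reg 4 + .get 6 (.reg 32)) * .reg 4
          + .reg 31) * .reg 4 + .reg 32) ;;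
       .setReg 3 (.reg 3 + 1) ;;
       .setReg 8 (.reg 8 + 1))
      (.setReg 20 (.reg 20 + .reg 20) ;;
       .setReg 8 0))

/-- Append array `2` to array `0`. -/
def appendEdges : Prog :=
  .setReg 8 0 ;;
  .loop (.op .lt (.reg 8) (.reg 1))
    (.setArr 0 (.reg 1 + .reg 8) (.get 2 (.reg 8)) ;;
     .setReg 8 (.reg 8 + 1))

/-- Move the edges to arrays `1` and `2`. -/
def moveEdges : Prog :=
  .setReg 8 0 ;;
  .loop (.op .lt (.reg 8) (.reg 1))
    (.setArr 2 (.reg 8) (.get 1 (.reg 8)) ;;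
     .setArr 1 (.reg 8) (.get 0 (.reg 8)) ;;
     .setReg 8 (.reg 8 + 1))

/-- The preprocessing algorithm. -/
def preprocess : Prog :=
  moveEdges ;;
  .setReg 2 (.reg 1) ;;
  core ;;
  .cond (.op .lt (.reg 1) (.reg 0))
    (appendEdges ;;
     .setReg 0 (2 * .reg 1))
    (copyTree ;;
     generate ;;
     sort ;;
     .setReg 0 (3 * .reg 0 + .reg 3))

section
variable {w n m : ℕ} {s : State}

theorem moveEdges_runs (h1 : s.reg 1 = m) (hW : m + 2 < 2 ^ w) :
    Runs w moveEdges s fun s' _ => (∀ i < m, s'.arr 2 i = s.arr 1 i) ∧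
      ∀ i < m, s'.arr 1 i = s.arr 0 i := by
  have m1 : 1 % 2 ^ w = 1 := Nat.mod_eq_of_lt (by omega)
  rw [moveEdges, runs_seq, runs_setReg]
  refine (Runs.loop_of_measure (fun s' B => s'.reg 8 ≤ m ∧ m - s'.reg 8 ≤ B ∧
    (∀ i < s'.reg 8, s'.arr 2 i = s.arr 1 i) ∧ (∀ i < s'.reg 8, s'.arr 1 i = s.arr 0 i) ∧
    ∀ i, s'.reg 8 ≤ i → s'.arr 1 i = s.arr 1 i) ?_ ?_).mono ?_
  · exact ⟨_, by simp, le_rfl, by simp, by simp, by simp⟩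
  · rintro s₁ B hF ⟨h8, hB, h2, h1', hge⟩ he
    have r1 : s₁.reg 1 = m := (hF.reg 1 (by decide)).trans (by simpa using h1)
    have a0 : s₁.arr 0 = s.arr 0 := (hF.arr 0 (by decide)).trans (by simp)
    simp [r1] at he
    have m8 : (s₁.reg 8 + 1) % 2 ^ w = s₁.reg 8 + 1 := Nat.mod_eq_of_lt (by omega)
    simp [m1, m8, a0]
    refine ⟨m - (s₁.reg 8 + 1), ⟨by omega, by omega, fun i hi => ?_, fun i hi => ?_, fun i hi => ?_⟩, by omega⟩
    · rcases Nat.lt_or_eq_of_le hi with hi | rfl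
      · rw [Function.update_of_ne (by omega), h2 i hi]
      · rw [Function.update_self, hge _ le_rfl]
    · rcases Nat.lt_or_eq_of_le hi with hi | rfl
      · rw [Function.update_of_ne (by omega), h1' i hi]
      · rw [Function.update_self]
    · rw [Function.update_of_ne (by omega), hge i (by omega)]
  · rintro s' t hF ⟨⟨B, h8, -, h2, h1', -⟩, he⟩
    have r1 : s'.reg 1 = m := (hF.reg 1 (by decide)).trans (by simpa using h1)
    simp [r1] at he
    obtain rfl : s'.reg 8 = m := by omega
    exact ⟨h2, h1'⟩

theorem appendEdges_runs (h1 : s.reg 1 = m) (hW : 2 * m + 2 < 2 ^ w) :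
    Runs w appendEdges s fun s' _ => (∀ i < m, s'.arr 0 i = s.arr 0 i) ∧
      ∀ i < m, s'.arr 0 (m + i) = s.arr 2 i := by
  have m1 : 1 % 2 ^ w = 1 := Nat.mod_eq_of_lt (by omega)
  rw [appendEdges, runs_seq, runs_setReg]
  refine (Runs.loop_of_measure (fun s' B => s'.reg 8 ≤ m ∧ m - s'.reg 8 ≤ B ∧
    (∀ i < m, s'.arr 0 i = s.arr 0 i) ∧ ∀ i < s'.reg 8, s'.arr 0 (m + i) = s.arr 2 i)
    ?_ ?_).mono ?_
  · exact ⟨_, by simp, le_rfl, by simp, by simp⟩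
  · rintro s₁ B hF ⟨h8, hB, h2, h1'⟩ he
    have r1 : s₁.reg 1 = m := (hF.reg 1 (by decide)).trans (by simpa using h1)
    have a2 : s₁.arr 2 = s.arr 2 := (hF.arr 2 (by decide)).trans (by simp)
    simp [r1] at he
    have m8 : (s₁.reg 8 + 1) % 2 ^ w = s₁.reg 8 + 1 := Nat.mod_eq_of_lt (by omega)
    have m9 : (m + s₁.reg 8) % 2 ^ w = m + s₁.reg 8 := Nat.mod_eq_of_lt (by omega)
    simp [m1, m8, a2, r1, m9]
    refine ⟨m - (s₁.reg 8 + 1), ⟨by omega, by omega, fun i hi => ?_, fun i hi => ?_⟩, by omega⟩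
    · rw [Function.update_of_ne (by omega), h2 i hi]
    · rcases Nat.lt_or_eq_of_le hi with hi | rfl
      · rw [Function.update_of_ne (by omega), h1' i hi]
      · rw [Function.update_self]
  · rintro s' t hF ⟨⟨B, h8, -, h2, h1'⟩, he⟩
    have r1 : s'.reg 1 = m := (hF.reg 1 (by decide)).trans (by simpa using h1)
    simp [r1] at he
    obtain rfl : s'.reg 8 = m := by omega
    exact ⟨h2, h1'⟩

theorem copyTree_runs (h0 : s.reg 0 = n) (hW : 3 * n + 2 < 2 ^ w) :
    Runs w copyTree s fun s' _ => ∀ v < n, s'.arr 0 v = s.arr 7 v ∧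
      s'.arr 0 (n + v) = s.arr 6 v ∧ s'.arr 0 (2 * n + v) = s.arr 8 v := by
  have m1 : 1 % 2 ^ w = 1 := Nat.mod_eq_of_lt (by omega)
  rw [copyTree, runs_seq, runs_setReg]
  refine (Runs.loop_of_measure (fun s' B => s'.reg 8 ≤ n ∧ n - s'.reg 8 ≤ B ∧
    ∀ v < s'.reg 8, s'.arr 0 v = s.arr 7 v ∧
      s'.arr 0 (n + v) = s.arr 6 v ∧ s'.arr 0 (2 * n + v) = s.arr 8 v) ?_ ?_).mono ?_
  · exact ⟨_, by simp, le_rfl, by simp⟩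
  · rintro s₁ B hF ⟨h8, hB, h⟩ he
    have r0 : s₁.reg 0 = n := (hF.reg 0 (by decide)).trans (by simpa using h0)
    have a6 : s₁.arr 6 = s.arr 6 := (hF.arr 6 (by decide)).trans (by simp)
    have a7 : s₁.arr 7 = s.arr 7 := (hF.arr 7 (by decide)).trans (by simp)
    have a8 : s₁.arr 8 = s.arr 8 := (hF.arr 8 (by decide)).trans (by simp)
    simp [r0] at he
    have m2 : 2 % 2 ^ w = 2 := Nat.mod_eq_of_lt (by omega)
    have m3 : (2 * n) % 2 ^ w = 2 * n := Nat.mod_eq_of_lt (by omega)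
    have m8 : (s₁.reg 8 + 1) % 2 ^ w = s₁.reg 8 + 1 := Nat.mod_eq_of_lt (by omega)
    have m9 : (n + s₁.reg 8) % 2 ^ w = n + s₁.reg 8 := Nat.mod_eq_of_lt (by omega)
    have m10 : (2 * n + s₁.reg 8) % 2 ^ w = 2 * n + s₁.reg 8 := Nat.mod_eq_of_lt (by omega)
    simp only [runs_seq, runs_setArr, runs_setReg, eval_add, eval_mul, eval_reg, eval_lit, eval_get,
      State.putArr_reg, State.putArr_arr, Nat.reduceEqDiff, if_true, if_false, r0, a6, a7, a8,
      m1, m2, m3, m8, m9, m10, State.putReg_arr, State.putReg_reg]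
    refine ⟨_, ⟨by omega, le_rfl, fun v hv => ?_⟩, by omega⟩
    rcases Nat.lt_succ_iff_lt_or_eq.1 hv with hv | rfl
    · obtain ⟨g1, g2, g3⟩ := h v hv
      simp only [Function.update_apply]
      refine ⟨?_, ?_, ?_⟩
      · rw [if_neg (by omega), if_neg (by omega), if_neg (by omega), g1]
      · rw [if_neg (by omega), if_neg (by omega), if_neg (by omega), g2]
      · rw [if_neg (by omega), if_neg (by omega), if_neg (by omega), g3]
    · simp only [Function.update_apply]
      refine ⟨?_, ?_, if_pos trivial⟩
      · rw [if_neg (by omega), if_neg (by omega), if_pos trivial]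
      · rw [if_neg (by omega), if_pos trivial]
  · rintro s' t hF ⟨⟨B, h8, -, h⟩, he⟩
    have r0 : s'.reg 0 = n := (hF.reg 0 (by decide)).trans (by simpa using h0)
    simp [r0] at he
    obtain rfl : s'.reg 8 = n := by omega
    exact h

/-- The lower endpoint of an edge. -/
def lower (num : ℕ → ℕ) (u v : ℕ) : ℕ := if num u < num v then v else u

/-- The upper endpoint of an edge. -/
def upper (num : ℕ → ℕ) (u v : ℕ) : ℕ := if num u < num v then u else v

/-- The entry for the edge `uv` and the number `p`. -/
def entry (n : ℕ) (num : ℕ → ℕ) (p u v : ℕ) : ℕ :=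
  comp (n + 2) p (num (lower num u v) / p) (num (upper num u v)) (lower num u v) (upper num u v)

/-- Reductions modulo the word size commute with sums and products, so only the final value of a key
must fit. -/
theorem comp_mod {B p j d u z W : ℕ} :
    ((((p * B % W + j) % W * B % W + d) % W * B % W + u) % W * B % W + z) % W
      = comp B p j d u z % W := by
  simp only [comp, Nat.mod_add_mod, Nat.mod_mul_mod]

theorem orient_runs {u v : ℕ} (hu : s.arr 1 (s.reg 8) = u) (hv : s.arr 2 (s.reg 8) = v) :
    Runs w orient s fun s' _ => s'.reg 31 = lower (s.arr 6) u v ∧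
      s'.reg 32 = upper (s.arr 6) u v := by
  rw [orient, runs_cond]
  simp [hu, hv, lower, upper]
  constructor
  · intro h
    simp [h]
  · intro h
    simp [h.not_gt]

/-- The entry at offset `t` belongs to level `t / m` and edge `t % m`. The clause `n + 2 ≤ 2 ^ K → i
= 0` of the invariant says that the loop ends only between levels, so no level is incomplete. -/
theorem generate_runs {x y num : ℕ → ℕ} (h0 : s.reg 0 = n) (h1 : s.reg 1 = m) (hm : 0 < m)
    (hx : ∀ i < m, s.arr 1 i = x i) (hy : ∀ i < m, s.arr 2 i = y i)
    (hxn : ∀ i < m, x i < n) (hyn : ∀ i < m, y i < n)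
    (hnum : s.arr 6 = num) (hnumB : ∀ v, num v < n + 2) (hword : (n + 2) ^ 5 ≤ 2 ^ w)
    (hW : 3 * n + 2 * ((n + 3) * m) + 3 < 2 ^ w) :
    Runs w generate s fun s' _ => ∃ K, (∀ k < K, 2 ^ k < n + 2) ∧ n + 2 ≤ 2 ^ K ∧
      s'.reg 3 = K * m ∧ (∀ t < K * m, s'.arr 0 (3 * n + t) =
        entry n num (2 ^ (t / m)) (x (t % m)) (y (t % m))) ∧
      ∀ i < 3 * n, s'.arr 0 i = s.arr 0 i := by
  have hW4 := four_mul_le hword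
  have m1 : 1 % 2 ^ w = 1 := Nat.mod_eq_of_lt (by omega)
  have m2 : 2 % 2 ^ w = 2 := Nat.mod_eq_of_lt (by omega)
  have m3 : 3 % 2 ^ w = 3 := Nat.mod_eq_of_lt (by omega)
  have m4 : (n + 2) % 2 ^ w = n + 2 := Nat.mod_eq_of_lt (by omega)
  have m5 : (3 * n) % 2 ^ w = 3 * n := Nat.mod_eq_of_lt (by omega)
  simp only [generate, runs_seq, runs_setReg, eval_add, eval_reg, eval_lit,
    h0, m1, m2, m4, Nat.zero_mod]
  refine (Runs.loop_of_measure (fun s' B => ∃ K i, s'.reg 20 = 2 ^ K ∧ s'.reg 8 = i ∧ i ≤ m ∧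
    s'.reg 3 = K * m + i ∧ (∀ k < K, 2 ^ k < n + 2) ∧ (n + 2 ≤ 2 ^ K → i = 0) ∧
    (∀ t < K * m + i, s'.arr 0 (3 * n + t) =
        entry n num (2 ^ (t / m)) (x (t % m)) (y (t % m))) ∧
    (∀ i < 3 * n, s'.arr 0 i = s.arr 0 i) ∧ (n + 2 - K) * (m + 1) + (m - i) ≤ B) ?_ ?_).mono ?_
  · exact ⟨_, 0, 0, by simp, by simp, by simp, by simp, by simp, by simp, by simp, by simp, le_rfl⟩
  · rintro s₁ B hF ⟨K, i, r20, r8, hi, r3, hK, hK0, hent, hlow, hB⟩ he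
    have r0 : s₁.reg 0 = n := (hF.reg 0 (by decide)).trans (by simpa using h0)
    have r1 : s₁.reg 1 = m := (hF.reg 1 (by decide)).trans (by simpa using h1)
    have r4 : s₁.reg 4 = n + 2 := (hF.reg 4 (by decide)).trans (by simp)
    have a1 : s₁.arr 1 = s.arr 1 := (hF.arr 1 (by decide)).trans (by simp)
    have a2 : s₁.arr 2 = s.arr 2 := (hF.arr 2 (by decide)).trans (by simp)
    have a6 : s₁.arr 6 = num := (hF.arr 6 (by decide)).trans (by simpa using hnum)
    simp [r20, r4] at he
    have hKn : K < n + 2 := K.lt_two_pow_self.trans he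
    have hKm : K * m + m ≤ (n + 3) * m := by
      have := Nat.mul_le_mul_right m (show K + 1 ≤ n + 3 by omega)
      linarith
    rw [runs_cond]
    refine ⟨fun hc => ?_, fun hc => ?_⟩
    · simp [r8, r1] at hc
      rw [runs_seq]
      refine (orient_runs (u := x i) (v := y i) (by rw [r8, a1, hx i hc])
        (by rw [r8, a2, hy i hc])).mono ?_
      rintro s₂ t₂ hF₂ ⟨r31, r32⟩
      have f0 := (hF₂.reg 0 (by decide)).trans r0
      have f3 := (hF₂.reg 3 (by decide)).trans r3
      have f4 := (hF₂.reg 4 (by decide)).trans r4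
      have f8 := (hF₂.reg 8 (by decide)).trans r8
      have f20 := (hF₂.reg 20 (by decide)).trans r20
      have g0 := hF₂.arr 0 (by decide)
      have g6 := (hF₂.arr 6 (by decide)).trans a6
      rw [a6] at r31 r32
      have hl : lower num (x i) (y i) < n + 2 := by
        have := hxn i hc
        have := hyn i hc
        rw [lower]; split_ifs <;> omega
      have hu : upper num (x i) (y i) < n + 2 := by
        have := hxn i hc
        have := hyn i hc
        rw [upper]; split_ifs <;> omega
      have hent' : entry n num (2 ^ K) (x i) (y i) % 2 ^ w = entry n num (2 ^ K) (x i) (y i) :=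
        Nat.mod_eq_of_lt ((comp_lt he ((Nat.div_le_self _ _).trans_lt (hnumB _)) (hnumB _)
          hl hu).trans_le hword)
      have m6 : (3 * n + (K * m + i)) % 2 ^ w = 3 * n + (K * m + i) :=
        Nat.mod_eq_of_lt (by omega)
      have m7 : (K * m + i + 1) % 2 ^ w = K * m + i + 1 := Nat.mod_eq_of_lt (by omega)
      have m8 : (i + 1) % 2 ^ w = i + 1 := Nat.mod_eq_of_lt (by omega)
      simp only [runs_seq, runs_setReg, runs_setArr, eval_add, eval_mul, eval_div, eval_reg,
        eval_lit, eval_get, State.putReg_reg, State.putReg_arr, State.putArr_reg, State.putArr_arr,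
        f0, f3, f4, f8, f20, g6, r31, r32, m1, m3, m5, m6, m7, m8, Nat.reduceEqDiff, if_true,
        if_false, comp_mod]
      rw [show comp (n + 2) (2 ^ K) (num (lower num (x i) (y i)) / 2 ^ K)
        (num (upper num (x i) (y i))) (lower num (x i) (y i)) (upper num (x i) (y i))
        = entry n num (2 ^ K) (x i) (y i) from rfl, hent', g0]
      refine ⟨_, ⟨K, i + 1, rfl, rfl, hc, rfl, hK, by omega, fun t ht => ?_, fun j hj => ?_,
        le_rfl⟩, by omega⟩
      · rcases Nat.lt_succ_iff_lt_or_eq.1 (show t < K * m + i + 1 from ht) with ht | rfl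
        · rw [Function.update_of_ne (by omega), hent t ht]
        · rw [Function.update_self, Nat.mul_comm K m, Nat.mul_add_div hm, Nat.div_eq_of_lt hc,
            Nat.mul_add_mod, Nat.mod_eq_of_lt hc, Nat.add_zero]
      · rw [Function.update_of_ne (by omega), hlow j hj]
    · simp [r8, r1] at hc
      obtain rfl : i = m := by omega
      have e20 : (2 ^ K + 2 ^ K) % 2 ^ w = 2 ^ (K + 1) := by
        rw [Nat.mod_eq_of_lt (by omega), pow_succ]; omega
      simp only [runs_seq, runs_setReg, eval_add, eval_reg, eval_lit, State.putReg_reg,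
        State.putReg_arr, r20, e20, Nat.reduceEqDiff, if_true, if_false, Nat.zero_mod, r3]
      refine ⟨_, ⟨K + 1, 0, rfl, rfl, by omega, by rw [add_mul, one_mul]; rfl, fun k hk => ?_,
        fun _ => rfl, fun t ht => hent t (by rwa [add_mul, one_mul] at ht), hlow, le_rfl⟩, ?_⟩
      · rcases Nat.lt_succ_iff_lt_or_eq.1 hk with hk | rfl
        · exact hK k hk
        · exact he
      · have : (n + 2 - K) * (i + 1) = (n + 2 - (K + 1)) * (i + 1) + (i + 1) := by
          rw [show n + 2 - K = n + 2 - (K + 1) + 1 by omega, add_mul, one_mul]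
        omega
  · rintro s' t hF ⟨⟨B, K, i, r20, r8, hi, r3, hK, hK0, hent, hlow, -⟩, he⟩
    have r4 : s'.reg 4 = n + 2 := (hF.reg 4 (by decide)).trans (by simp)
    simp [r20, r4] at he
    obtain rfl := hK0 he
    exact ⟨K, hK, he, r3, hent, hlow⟩

end

/-! ### Correctness of the data structure -/

section
variable {w n : ℕ}

/-- The data structure for a graph with fewer edges than vertices: a list of the edges. -/
structure SparseData (G : SimpleGraph (Fin n)) (D : ℕ → ℕ) (m : ℕ) : Prop where
  lt_n : ∀ i < m, D i < n ∧ D (m + i) < n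
  edges : ∀ u v, EdgeRel m D (fun i => D (m + i)) u v ↔ NatAdj G u v

/-- The data structure for a graph with at least as many edges as vertices: a depth first search
tree with its numbering, and the sorted list of the entries. -/
structure DenseData (G : SimpleGraph (Fin n)) (D : ℕ → ℕ) (M : ℕ) (num par fin : ℕ → ℕ) :
    Prop where
  searched : Searched G num par fin
  par_eq : ∀ v < n, D v = par v
  valid : DSValid n (NatAdj G) num fin D M

/-- Only the words within the reported length matter; this permits passing from the memory after
preprocessing to the input of the report. -/
theorem SparseData.congr {G : SimpleGraph (Fin n)} {D D' : ℕ → ℕ} {m : ℕ}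
    (h : SparseData G D m) (hD : ∀ i < 2 * m, D' i = D i) : SparseData G D' m := by
  refine ⟨fun i hi => ?_, fun u v => ?_⟩
  · rw [hD i (by omega), hD _ (by omega)]
    exact h.lt_n i hi
  · rw [← h.edges]
    exact EdgeRel.congr (fun i hi => hD i (by omega)) (fun i hi => hD _ (by omega)) u v

theorem DenseData.congr {G : SimpleGraph (Fin n)} {D D' : ℕ → ℕ} {M : ℕ} {num par fin : ℕ → ℕ}
    (h : DenseData G D M num par fin) (hD : ∀ i < 3 * n + M, D' i = D i) :
    DenseData G D' M num par fin := by
  have hv := h.valid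
  refine ⟨h.searched, fun v hv => ?_, fun v hn => ?_, fun v hn => ?_, fun i j hij hj => ?_,
    fun y => ?_, hv.bound, hv.d_pos, hv.d_lt, hv.l_lt⟩
  · rw [hD v (by omega)]; exact h.par_eq v hv
  · rw [hD _ (by omega)]; exact hv.d_eq v hn
  · rw [hD _ (by omega)]; exact hv.l_eq v hn
  · rw [hD _ (by omega), hD _ (by omega)]; exact hv.mono i j hij hj
  · rw [← hv.mem]
    refine exists_congr fun i => and_congr_right fun hi => ?_
    rw [hD _ (by omega)]

theorem added_iff {G : SimpleGraph (Fin n)} {k : ℕ} {x y : ℕ → ℕ}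
    (h : ∀ u v, EdgeRel k x y u v ↔ NatAdj G u v) :
    (fun u v => False ∨ Added n k x y u v) = AugAdj G := by
  ext u v
  rw [false_or]
  exact or_congr Iff.rfl (h u v)

theorem EdgeRel.natAdj_lower {G : SimpleGraph (Fin n)} {m : ℕ} {x y num par fin : ℕ → ℕ}
    (hS : Searched G num par fin) (hE : ∀ u v, EdgeRel m x y u v ↔ NatAdj G u v) {i : ℕ}
    (hi : i < m) : NatAdj G (lower num (x i) (y i)) (upper num (x i) (y i)) ∧
      num (upper num (x i) (y i)) < num (lower num (x i) (y i)) := by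
  have h : NatAdj G (x i) (y i) := (hE _ _).1 ⟨i, hi, Or.inl ⟨rfl, rfl⟩⟩
  rw [lower, upper]
  split_ifs with hlt
  · exact ⟨h.symm, hlt⟩
  · have := hS.num_ne h.lt.le h.ne
    exact ⟨h, by omega⟩

/-- Level and edge index are recovered as quotient and remainder by `m`. The levels below `K` are
exactly those with `2 ^ k < n + 2`, and each edge is oriented by its numbers. -/
theorem mem_entries {G : SimpleGraph (Fin n)} {m K : ℕ} {x y num par fin : ℕ → ℕ}
    (hS : Searched G num par fin) (hE : ∀ u v, EdgeRel m x y u v ↔ NatAdj G u v) (hm : 0 < m)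
    (hK : ∀ k < K, 2 ^ k < n + 2) (hK' : n + 2 ≤ 2 ^ K) (c : ℕ) :
    (∃ t < K * m, entry n num (2 ^ (t / m)) (x (t % m)) (y (t % m)) = c) ↔
      ∃ k u z, 2 ^ k < n + 2 ∧ NatAdj G u z ∧ num z < num u ∧
        c = comp (n + 2) (2 ^ k) (num u / 2 ^ k) (num z) u z := by
  constructor
  · rintro ⟨t, ht, rfl⟩
    have hi := Nat.mod_lt t hm
    have h := EdgeRel.natAdj_lower hS hE hi
    exact ⟨t / m, _, _, hK _ ((Nat.div_lt_iff_lt_mul hm).2 ht), h.1, h.2, rfl⟩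
  · rintro ⟨k, u, z, hk, huz, hlt, rfl⟩
    have hkK : k < K := (Nat.pow_lt_pow_iff_right (by norm_num : 1 < 2)).1 (hk.trans_le hK')
    obtain ⟨i, hi, h⟩ := (hE u z).2 huz
    have h1 : (m * k + i) / m = k := by
      rw [Nat.mul_add_div hm, Nat.div_eq_of_lt hi, Nat.add_zero]
    have h2 : (m * k + i) % m = i := by rw [Nat.mul_add_mod, Nat.mod_eq_of_lt hi]
    refine ⟨m * k + i, ?_, ?_⟩
    · have := Nat.mul_le_mul_left m (show k + 1 ≤ K from hkK)
      rw [Nat.mul_comm K m]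
      linarith
    · rw [h1, h2, entry, lower, upper]
      rcases h with ⟨rfl, rfl⟩ | ⟨rfl, rfl⟩
      · rw [if_neg (by omega), if_neg (by omega)]
      · rw [if_pos hlt, if_pos hlt]

/-- The search is run on the star, with the edges of `G` in the role of added edges. The case
distinction `m < n` keeps the `3 * n` words of the tree within `3 * m`. -/
theorem preprocess_runs {G : SimpleGraph (Fin n)} {m c : ℕ} {x y : ℕ → ℕ} {s : State}
    (hn : 2 ≤ n) (hE : ∀ u v, EdgeRel m x y u v ↔ NatAdj G u v)
    (hx : ∀ i < m, s.arr 0 i = x i) (hy : ∀ i < m, s.arr 1 i = y i) (h0 : s.reg 0 = n)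
    (h1 : s.reg 1 = m) (h5 : s.reg 5 = 0) (h3 : s.reg 3 = 0) (h6 : s.reg 6 = 0)
    (ha3 : ∀ i, s.arr 3 i = 0) (ha6 : ∀ i, s.arr 6 i = 0)
    (hword : (n + 2) ^ 5 ≤ 2 ^ w) (hlevels : n + 2 ≤ 2 ^ c)
    (hT : 3000 * n + 3000 + n * (400 + 100 * (c + 1) * (0 + 4)) + 400 * m < 2 ^ w)
    (hW : 3 * n + 2 * ((n + 3) * m) + 3 < 2 ^ w) :
    Runs w preprocess s fun s' _ =>
      (m < n ∧ s'.reg 0 = 2 * m ∧ SparseData G (s'.arr 0) m) ∨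
      (n ≤ m ∧ ∃ K num par fin, (∀ k < K, 2 ^ k < n + 2) ∧ s'.reg 0 = 3 * n + K * m ∧
        DenseData G (s'.arr 0) (K * m) num par fin) := by
  have hadj : ∀ i < m, NatAdj G (x i) (y i) := fun i hi => (hE _ _).1 ⟨i, hi, Or.inl ⟨rfl, rfl⟩⟩
  have hxn : ∀ i < m, x i < n := fun i hi => (hadj i hi).lt
  have hyn : ∀ i < m, y i < n := fun i hi => (hadj i hi).symm.lt
  have m2 : 2 % 2 ^ w = 2 := Nat.mod_eq_of_lt (by omega)
  have m3 : 3 % 2 ^ w = 3 := Nat.mod_eq_of_lt (by omega)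
  have m4 : (2 * m) % 2 ^ w = 2 * m := Nat.mod_eq_of_lt (by omega)
  have m5 : (3 * n) % 2 ^ w = 3 * n := Nat.mod_eq_of_lt (by omega)
  rw [preprocess, runs_seq]
  refine (moveEdges_runs h1 (by omega)).mono ?_
  rintro s₁ t₁ hF₁ ⟨h2₁, h1₁⟩
  rw [runs_seq, runs_setReg, eval_reg, (hF₁.reg 1 (by decide)).trans h1]
  have a0₁ := hF₁.arr 0 (by decide)
  rw [runs_seq]
  refine (core_runs (s := s₁.putReg 2 m) (n := n) (k := m) (b := 0) (c := c) (M := 0) (l₀ := fun _ => 0)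
    (setup_star hxn hyn fun i hi => (hadj i hi).ne) ?_ ?_ ?_ ?_ ?_ ?_ (fun i hi => ?_)
    (fun i hi => ?_) hxn hyn (fun v hv => ?_) ?_ hword hlevels hT).mono ?_
  · simpa [h0] using hF₁.reg 0 (by decide)
  · simp
  · simpa [h3] using hF₁.reg 3 (by decide)
  · simpa [h6] using hF₁.reg 6 (by decide)
  · simpa [ha3] using congrFun (hF₁.arr 3 (by decide))
  · simpa [ha6] using congrFun (hF₁.arr 6 (by decide))
  · simpa [hx i hi] using h1₁ i hi
  · simpa [hy i hi] using h2₁ i hi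
  · rw [if_neg]
    simpa [h5] using hF₁.reg 5 (by decide)
  · rintro ⟨v, -, hv⟩
    exact absurd hv (lt_irrefl n)
  rintro s₂ t₂ hF₂ ⟨-, hdfs, hvis⟩
  rw [added_iff hE] at hdfs
  have hS : Searched G (s₂.arr 6) (s₂.arr 7) (s₂.arr 8) := ⟨⟨_, hdfs⟩, hvis⟩
  have r0 : s₂.reg 0 = n := by
    rw [hF₂.reg 0 (by decide)]; simpa [h0] using hF₁.reg 0 (by decide)
  have r1 : s₂.reg 1 = m := by
    rw [hF₂.reg 1 (by decide)]; simpa [h1] using hF₁.reg 1 (by decide)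
  have a0 : ∀ i < m, s₂.arr 0 i = x i := fun i hi => by
    rw [hF₂.arr 0 (by decide), State.putReg_arr, a0₁, hx i hi]
  have a1 : ∀ i < m, s₂.arr 1 i = x i := fun i hi => by
    rw [hF₂.arr 1 (by decide), State.putReg_arr, h1₁ i hi, hx i hi]
  have a2 : ∀ i < m, s₂.arr 2 i = y i := fun i hi => by
    rw [hF₂.arr 2 (by decide), State.putReg_arr, h2₁ i hi, hy i hi]
  rw [runs_cond]
  refine ⟨fun hc => ?_, fun hc => ?_⟩
  · simp [r0, r1] at hc
    rw [runs_seq]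
    refine (appendEdges_runs r1 (by omega)).mono ?_
    rintro s₃ t₃ hF₃ ⟨hlo, hhi⟩
    have r1₃ := (hF₃.reg 1 (by decide)).trans r1
    simp only [runs_setReg, eval_mul, eval_reg, eval_lit, r1₃, m2, m4]
    refine Or.inl ⟨hc, by simp, ?_⟩
    have hD0 : ∀ i < m, s₃.arr 0 i = x i := fun i hi => (hlo i hi).trans (a0 i hi)
    have hD1 : ∀ i < m, s₃.arr 0 (m + i) = y i := fun i hi => (hhi i hi).trans (a2 i hi)
    refine ⟨fun i hi => ?_, fun u v => ?_⟩
    · rw [State.putReg_arr, hD0 i hi, hD1 i hi]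
      exact ⟨hxn i hi, hyn i hi⟩
    · rw [← hE]
      exact EdgeRel.congr hD0 hD1 u v
  · simp [r0, r1] at hc
    rw [runs_seq]
    refine (copyTree_runs r0 (by omega)).mono ?_
    rintro s₃ t₃ hF₃ hcopy
    have r0₃ := (hF₃.reg 0 (by decide)).trans r0
    have a6₃ := hF₃.arr 6 (by decide)
    rw [runs_seq]
    refine (generate_runs (m := m) (x := x) (y := y) (num := s₂.arr 6) r0₃
      ((hF₃.reg 1 (by decide)).trans r1) (by omega)
      (by rw [hF₃.arr 1 (by decide)]; exact a1) (by rw [hF₃.arr 2 (by decide)]; exact a2)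
      hxn hyn a6₃ hS.num_lt hword hW).mono ?_
    rintro s₄ t₄ hF₄ ⟨K, hK, hK', r3, hent, hlow⟩
    have r0₄ := (hF₄.reg 0 (by decide)).trans r0₃
    have hKn : K ≤ n + 2 := by
      rcases K with _ | K
      · omega
      · have := K.lt_two_pow_self
        have := hK K (by omega)
        omega
    have hM : K * m ≤ (n + 3) * m := Nat.mul_le_mul_right m (by omega)
    have m6 : (3 * n + K * m) % 2 ^ w = 3 * n + K * m := Nat.mod_eq_of_lt (by omega)
    rw [runs_seq]
    refine (sort_runs (M := K * m) (N := 3 * n) r3 (by rw [r0₄]) (by omega)).mono ?_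
    rintro s₅ t₅ hF₅ ⟨hlow', hmono, hval⟩
    have r0₅ := (hF₅.reg 0 (by decide)).trans r0₄
    have r3₅ := (hF₅.reg 3 (by decide)).trans r3
    simp only [runs_setReg, eval_mul, eval_add, eval_reg, eval_lit, r0₅, r3₅, m3, m5, m6]
    refine Or.inr ⟨hc, K, s₂.arr 6, s₂.arr 7, s₂.arr 8, hK, by simp, hS, fun v hv => ?_, fun v hv => ?_,
      fun v hv => ?_, hmono, fun c => ?_, fun u z h => ⟨h.lt, h.symm.lt⟩, fun v hv => ?_,
      fun v hv => hS.num_lt v, fun v hv => hS.fin_lt hv.le⟩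
    · rw [State.putReg_arr, hlow' v (by omega), hlow v (by omega), (hcopy v hv).1]
    · rw [State.putReg_arr, hlow' _ (by omega), hlow _ (by omega), (hcopy v hv).2.1]
    · rw [State.putReg_arr, hlow' _ (by omega), hlow _ (by omega), (hcopy v hv).2.2]
    · rw [State.putReg_arr, hval, ← mem_entries hS hE (by omega) hK hK']
      refine exists_congr fun t => and_congr_right fun ht => ?_
      rw [hent t ht]
    · exact Nat.pos_of_ne_zero (hvis v hv.le)

end

/-! ### Reporting a tree -/

/-- Add the edges listed in array `0` to those in arrays `1` and `2`. -/
def addEdges : Prog :=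
  .setReg 4 (.reg 1 / 2) ;;
  .setReg 8 0 ;;
  .loop (.op .lt (.reg 8) (.reg 4))
    (.setArr 1 (.reg 2) (.get 0 (.reg 8)) ;;
     .setArr 2 (.reg 2) (.get 0 (.reg 4 + .reg 8)) ;;
     .setReg 2 (.reg 2 + 1) ;;
     .setReg 8 (.reg 8 + 1))

/-- Copy the tree to array `0`. -/
def copyParents : Prog :=
  .setReg 8 0 ;;
  .loop (.op .lt (.reg 8) (.reg 0))
    (.setArr 0 (.reg 8) (.get 7 (.reg 8)) ;;
     .setReg 8 (.reg 8 + 1))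

/-- The reporting algorithm. -/
def report : Prog :=
  .cond (.op .lt (.reg 1) (2 * .reg 0))
    addEdges
    (.setReg 5 1 ;; .setReg 3 (.reg 1 - 3 * .reg 0)) ;;
  core ;;
  copyParents

section
variable {w n m k : ℕ} {s : State}

theorem addEdges_runs (h1 : s.reg 1 = 2 * m) (h2 : s.reg 2 = k) (hW : 2 * m + k + 3 < 2 ^ w) :
    Runs w addEdges s fun s' t => t ≤ 50 * m + 50 ∧ s'.reg 2 = k + m ∧
      (∀ i < k, s'.arr 1 i = s.arr 1 i) ∧ (∀ i < k, s'.arr 2 i = s.arr 2 i) ∧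
      (∀ i < m, s'.arr 1 (k + i) = s.arr 0 i) ∧ ∀ i < m, s'.arr 2 (k + i) = s.arr 0 (m + i) := by
  have m1 : 1 % 2 ^ w = 1 := Nat.mod_eq_of_lt (by omega)
  have m2 : 2 % 2 ^ w = 2 := Nat.mod_eq_of_lt (by omega)
  have e4 : 2 * m / 2 = m := by omega
  simp only [addEdges, runs_seq, runs_setReg, eval_div, eval_reg, eval_lit, h1, m2, e4,
    Nat.zero_mod]
  refine (Runs.loop (B₀ := 50 * m) (fun s' B => ∃ i ≤ m, s'.reg 8 = i ∧ s'.reg 2 = k + i ∧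
    B = 50 * (m - i) ∧ (∀ j < k, s'.arr 1 j = s.arr 1 j) ∧ (∀ j < k, s'.arr 2 j = s.arr 2 j) ∧
    (∀ j < i, s'.arr 1 (k + j) = s.arr 0 j) ∧ ∀ j < i, s'.arr 2 (k + j) = s.arr 0 (m + j))
    ?_ ?_).mono ?_
  · exact ⟨0, by omega, by simp, by simp [h2], rfl, by simp, by simp, by simp, by simp⟩
  · rintro s₁ B hF ⟨i, hi, r8, r2, rfl, g1, g2, g3, g4⟩ he
    have r4 : s₁.reg 4 = m := (hF.reg 4 (by decide)).trans (by simp)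
    have a0 : s₁.arr 0 = s.arr 0 := (hF.arr 0 (by decide)).trans (by simp)
    simp [r4, r8] at he
    have m3 : (m + i) % 2 ^ w = m + i := Nat.mod_eq_of_lt (by omega)
    have m4 : (k + i + 1) % 2 ^ w = k + i + 1 := Nat.mod_eq_of_lt (by omega)
    have m5 : (i + 1) % 2 ^ w = i + 1 := Nat.mod_eq_of_lt (by omega)
    simp only [runs_seq, runs_setArr, runs_setReg, eval_add, eval_reg, eval_lit, eval_get,
      State.putArr_reg, State.putArr_arr, Nat.reduceEqDiff, if_true, if_false, r4, r8, r2, a0,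
      m1, m3, m4, m5, State.putReg_arr, State.putReg_reg]
    refine ⟨_, ⟨i + 1, he, rfl, rfl, rfl, fun j hj => ?_, fun j hj => ?_, fun j hj => ?_,
      fun j hj => ?_⟩, ?_⟩
    · rw [Function.update_of_ne (by omega), g1 j hj]
    · rw [Function.update_of_ne (by omega), g2 j hj]
    · rcases Nat.lt_succ_iff_lt_or_eq.1 hj with hj | rfl
      · rw [Function.update_of_ne (by omega), g3 j hj]
      · rw [Function.update_self]
    · rcases Nat.lt_succ_iff_lt_or_eq.1 hj with hj | rfl
      · rw [Function.update_of_ne (by omega), g4 j hj]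
      · rw [Function.update_self]
    · simp
      omega
  · rintro s' t hF ⟨⟨B, ⟨i, hi, r8, r2, rfl, g1, g2, g3, g4⟩, ht⟩, he⟩
    have r4 : s'.reg 4 = m := (hF.reg 4 (by decide)).trans (by simp)
    simp [r4, r8] at he ht
    obtain rfl : i = m := by omega
    exact ⟨by simp; omega, r2, g1, g2, g3, g4⟩

theorem copyParents_runs (h0 : s.reg 0 = n) (hW : n + 2 < 2 ^ w) :
    Runs w copyParents s fun s' t => t ≤ 50 * n + 50 ∧ ∀ v < n, s'.arr 0 v = s.arr 7 v := by
  have m1 : 1 % 2 ^ w = 1 := Nat.mod_eq_of_lt (by omega)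
  rw [copyParents, runs_seq, runs_setReg]
  refine (Runs.loop (B₀ := 50 * n) (fun s' B => ∃ i ≤ n, s'.reg 8 = i ∧ B = 50 * (n - i) ∧
    ∀ v < i, s'.arr 0 v = s.arr 7 v) ?_ ?_).mono ?_
  · exact ⟨0, by omega, by simp, rfl, by simp⟩
  · rintro s₁ B hF ⟨i, hi, r8, rfl, h⟩ he
    have r0 : s₁.reg 0 = n := (hF.reg 0 (by decide)).trans (by simpa using h0)
    have a7 : s₁.arr 7 = s.arr 7 := (hF.arr 7 (by decide)).trans (by simp)
    simp [r0, r8] at he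
    have m8 : (i + 1) % 2 ^ w = i + 1 := Nat.mod_eq_of_lt (by omega)
    simp only [runs_seq, runs_setArr, runs_setReg, eval_add, eval_reg, eval_lit, eval_get,
      State.putArr_reg, State.putArr_arr, if_true, a7, r8, m1, m8,
      State.putReg_arr, State.putReg_reg]
    refine ⟨_, ⟨i + 1, he, rfl, rfl, fun v hv => ?_⟩, ?_⟩
    · rcases Nat.lt_succ_iff_lt_or_eq.1 hv with hv | rfl
      · rw [Function.update_of_ne (by omega), h v hv]
      · rw [Function.update_self]
    · simp
      omega
  · rintro s' t hF ⟨⟨B, ⟨i, hi, r8, rfl, h⟩, ht⟩, he⟩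
    have r0 : s'.reg 0 = n := (hF.reg 0 (by decide)).trans (by simpa using h0)
    simp [r0, r8] at he ht
    obtain rfl : i = n := by omega
    exact ⟨by simp; omega, h⟩

/-- The number of steps of the search. -/
def coreTime (n b c k : ℕ) : ℕ :=
  3000 * n + 3000 + n * (400 + 100 * (c + 1) * (b + 4)) + 400 * k

/-- The two formats are told apart by length: below `2 * n` for an edge list, at least `3 * n`
otherwise. The time is stated for `k + n` added edges, since in the sparse case the fewer than `n`
old edges are added too. -/
theorem report_runs {G H : SimpleGraph (Fin n)} {b c len : ℕ} {x y : ℕ → ℕ}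
    (hH : ∀ u v, NatAdj H u v ↔ NatAdj G u v ∨ EdgeRel k x y u v)
    (h0 : s.reg 0 = n) (h1 : s.reg 1 = len) (h2 : s.reg 2 = k) (h3 : s.reg 3 = 0)
    (h5 : s.reg 5 = 0) (h6 : s.reg 6 = 0) (ha3 : ∀ i, s.arr 3 i = 0) (ha6 : ∀ i, s.arr 6 i = 0)
    (hx : ∀ i < k, s.arr 1 i = x i) (hy : ∀ i < k, s.arr 2 i = y i)
    (hD : (∃ m < n, len = 2 * m ∧ SparseData G (s.arr 0) m) ∨
      ∃ M num par fin, len = 3 * n + M ∧ DenseData G (s.arr 0) M num par fin ∧ M < 2 ^ b ∧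
        3 * n + 2 * M + 3 < 2 ^ w)
    (hword : (n + 2) ^ 5 ≤ 2 ^ w) (hlevels : n + 2 ≤ 2 ^ c) (hT : coreTime n b c (k + n) < 2 ^ w) :
    Runs w report s fun s' t => t ≤ coreTime n b c (k + n) + 100 * n + 200 ∧
      ReportsDFSTree H s' := by
  have hadj : ∀ i < k, NatAdj H (x i) (y i) := fun i hi =>
    (hH _ _).2 (Or.inr ⟨i, hi, Or.inl ⟨rfl, rfl⟩⟩)
  have hW := four_mul_le hword
  have hT' := hT
  simp only [coreTime] at hT' ⊢
  have m1 : 1 % 2 ^ w = 1 := Nat.mod_eq_of_lt (by omega)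
  have m2 : 2 % 2 ^ w = 2 := Nat.mod_eq_of_lt (by omega)
  have m3 : 3 % 2 ^ w = 3 := Nat.mod_eq_of_lt (by omega)
  have m4 : (2 * n) % 2 ^ w = 2 * n := Nat.mod_eq_of_lt (by omega)
  have m5 : (3 * n) % 2 ^ w = 3 * n := Nat.mod_eq_of_lt (by omega)
  have hend : ∀ s' : State, s'.reg 0 = n → Searched H (s'.arr 6) (s'.arr 7) (s'.arr 8) →
      Runs w copyParents s' fun s'' t => t ≤ 50 * n + 50 ∧ ReportsDFSTree H s'' := by
    intro s' r0 hS
    refine (copyParents_runs r0 (by omega)).mono ?_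
    rintro s'' t - ⟨ht, hp⟩
    exact ⟨ht, hS.reports hp⟩
  rw [report, runs_seq, runs_cond]
  rcases hD with ⟨m, hm, rfl, hD⟩ | ⟨M, num, par, fin, rfl, hD, hMb, hMw⟩
  · refine ⟨fun _ => ?_, fun hc => ?_⟩
    swap
    · simp [h0, h1, m2, m4] at hc
      omega
    refine (addEdges_runs h1 h2 (by omega)).mono ?_
    rintro s₁ t₁ hF₁ ⟨ht₁, r2, g1, g2, g3, g4⟩
    have hrel : ∀ u v, EdgeRel (k + m) (s₁.arr 1) (s₁.arr 2) u v ↔ NatAdj H u v := fun u v => by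
      rw [hH, or_comm, ← hD.edges]
      exact EdgeRel.append (fun i hi => (g1 i hi).trans (hx i hi))
        (fun i hi => (g2 i hi).trans (hy i hi)) g3 g4 u v
    have hadj' : ∀ i < k + m, NatAdj H (s₁.arr 1 i) (s₁.arr 2 i) := fun i hi =>
      (hrel _ _).1 ⟨i, hi, Or.inl ⟨rfl, rfl⟩⟩
    have hxn : ∀ i < k + m, s₁.arr 1 i < n := fun i hi => (hadj' i hi).lt
    have hyn : ∀ i < k + m, s₁.arr 2 i < n := fun i hi => (hadj' i hi).symm.lt
    have f0 := (hF₁.reg 0 (by decide)).trans h0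
    rw [runs_seq]
    refine (core_runs (n := n) (k := k + m) (b := b) (c := c) (M := 0) (l₀ := fun _ => 0)
      (setup_star hxn hyn fun i hi => (hadj' i hi).ne) f0 r2
      ((hF₁.reg 3 (by decide)).trans h3) ((hF₁.reg 6 (by decide)).trans h6)
      (by rw [hF₁.arr 3 (by decide)]; exact ha3) (by rw [hF₁.arr 6 (by decide)]; exact ha6)
      (fun i hi => rfl) (fun i hi => rfl) hxn hyn (fun v hv => ?_) ?_ hword hlevels
      (by omega)).mono ?_
    · rw [if_neg]
      simpa [h5] using hF₁.reg 5 (by decide)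
    · rintro ⟨v, -, hv⟩
      exact absurd hv (lt_irrefl n)
    rintro s₂ t₂ hF₂ ⟨ht₂, hdfs, hvis⟩
    rw [added_iff hrel] at hdfs
    refine (hend s₂ ((hF₂.reg 0 (by decide)).trans f0) ⟨⟨_, hdfs⟩, hvis⟩).mono ?_
    rintro s₃ t₃ - ⟨ht₃, hR⟩
    refine ⟨?_, hR⟩
    simp
    omega
  · refine ⟨fun hc => ?_, fun _ => ?_⟩
    · simp [h0, h1, m2, m4] at hc
      omega
    simp only [runs_seq, runs_setReg, eval_sub, eval_mul, eval_reg, eval_lit, State.putReg_reg,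
      Nat.reduceEqDiff, if_false, h0, h1, m1, m3, m5, Nat.add_sub_cancel_left]
    have hxn : ∀ i < k, x i < n := fun i hi => (hadj i hi).lt
    have hyn : ∀ i < k, y i < n := fun i hi => (hadj i hi).symm.lt
    have hS := hD.searched
    refine (core_runs (s := (s.putReg 5 1).putReg 3 M) (n := n) (k := k) (x := x) (y := y) (b := b) (c := c) (M := M) (l₀ := fin)
      (hS.setup hxn hyn fun i hi => (hadj i hi).ne) ?_ ?_ ?_ ?_ ha3 ha6 hx hy hxn hyn
      (fun v hv => ?_) ?_ hword hlevels (by omega)).mono ?_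
    · simp [h0]
    · simp [h2]
    · simp
    · simp [h6]
    · rw [if_pos (by simp)]
      exact (hD.par_eq v hv).symm
    · exact fun _ => ⟨hD.valid, fun v hv u hu => hS.isAncestor_iff hv.le hu.le, hMb, hMw⟩
    rintro s₂ t₂ hF₂ ⟨ht₂, hdfs, hvis⟩
    have hA : (fun u v => NatAdj G u v ∨ Added n k x y u v) = AugAdj H := by
      ext u v
      rw [AugAdj, hH, Added, or_left_comm]
      rfl
    rw [hA] at hdfs
    have f0 := hF₂.reg 0 (by decide)
    refine (hend s₂ (f0.trans (by simp [h0])) ⟨⟨_, hdfs⟩, hvis⟩).mono ?_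
    rintro s₃ t₃ - ⟨ht₃, hR⟩
    refine ⟨?_, hR⟩
    simp
    omega

end

/-! ### Numerical estimates -/

section
variable {n g w : ℕ}

theorem add_two_le_pow (hg : 1 ≤ g) (hn : n < 2 ^ (g + 1)) : n + 2 ≤ 2 ^ (g + 2) := by
  have : 2 ≤ 2 ^ (g + 1) := Nat.le_self_pow (by omega) 2
  rw [pow_succ]
  omega

theorem add_two_le_pow_three (hg : 1 ≤ g) (hn : n < 2 ^ (g + 1)) : n + 2 ≤ 2 ^ (3 * g) :=
  (add_two_le_pow hg hn).trans (Nat.pow_le_pow_right (by norm_num) (by omega))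

/-- Here and below `g` is the integer logarithm of `n`; since `n + 2 ≤ 2 ^ (3 * g)`, five digits
need at most `15 * g` bits. -/
theorem word_bound (hg : 1 ≤ g) (hn : n < 2 ^ (g + 1)) (hw : 40 * g ≤ w) :
    (n + 2) ^ 5 ≤ 2 ^ w := by
  refine (Nat.pow_le_pow_left (add_two_le_pow_three hg hn) 5).trans ?_
  rw [← pow_mul]
  exact Nat.pow_le_pow_right (by norm_num) (by omega)

/-- Up to `3 * g` levels and `6 * g` bits of binary search give a bound of order `n * g ^ 2`, one
logarithm better than required. -/
theorem coreTime_le (hg : 1 ≤ g) (hn : 2 ≤ n) {k : ℕ} (hk : k ≤ n) :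
    coreTime n (6 * g) (3 * g) (k + n) + 100 * n + 200 ≤ 11500 * (n * g ^ 2) := by
  have h1 : 1 ≤ g ^ 2 := Nat.one_le_pow _ _ hg
  have h2 : (3 * g + 1) * (6 * g + 4) ≤ 40 * g ^ 2 := by nlinarith
  have h3 : n * (400 + 100 * (3 * g + 1) * (6 * g + 4)) ≤ n * (4400 * g ^ 2) :=
    Nat.mul_le_mul_left n (by nlinarith)
  have h4 : n ≤ n * g ^ 2 := Nat.le_mul_of_pos_right n h1
  simp only [coreTime]
  have h5 : n * (4400 * g ^ 2) = 4400 * (n * g ^ 2) := by ring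
  rw [h5] at h3
  omega

theorem reportTime_lt (hg : 1 ≤ g) (hn : n < 2 ^ (g + 1)) (hw : 40 * g ≤ w) :
    11500 * (n * g ^ 2) < 2 ^ w := by
  have hg' : g ^ 2 ≤ (2 ^ g) ^ 2 := Nat.pow_le_pow_left g.lt_two_pow_self.le 2
  calc 11500 * (n * g ^ 2) < 2 ^ 14 * (2 ^ (g + 1) * (2 ^ g) ^ 2) :=
        Nat.mul_lt_mul_of_lt_of_le (by norm_num) (Nat.mul_le_mul hn.le hg') (by positivity)
    _ = 2 ^ (3 * g + 15) := by ring
    _ ≤ 2 ^ w := Nat.pow_le_pow_right (by norm_num) (by omega)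

theorem preprocessTime_lt (hg : 1 ≤ g) (hn : n < 2 ^ (g + 1)) (hn2 : 2 ≤ n) (hw : 40 * g ≤ w)
    {m : ℕ} (hm : m ≤ n * n) :
    3000 * n + 3000 + n * (400 + 100 * (3 * g + 1) * (0 + 4)) + 400 * m < 2 ^ w := by
  have h1 : n ≤ n * n := Nat.le_mul_self n
  have h2 : n * n ≤ n * n * g := Nat.le_mul_of_pos_right _ hg
  have h3 : n * g ≤ n * n * g := Nat.mul_le_mul_right g h1
  have h4 : n * (400 + 100 * (3 * g + 1) * (0 + 4)) = 800 * n + 1200 * (n * g) := by ring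
  calc _ ≤ 8400 * (n * n * g) := by rw [h4]; omega
    _ < 2 ^ 14 * (2 ^ (g + 1) * 2 ^ (g + 1) * 2 ^ g) :=
        Nat.mul_lt_mul_of_lt_of_le (by norm_num)
          (Nat.mul_le_mul (Nat.mul_le_mul hn.le hn.le) g.lt_two_pow_self.le) (by positivity)
    _ = 2 ^ (3 * g + 16) := by ring
    _ ≤ 2 ^ w := Nat.pow_le_pow_right (by norm_num) (by omega)

theorem index_lt (hg : 1 ≤ g) (hn : n < 2 ^ (g + 1)) (hw : 40 * g ≤ w)
    {m : ℕ} (hm : m ≤ n * n) : 3 * n + 2 * ((n + 3) * m) + 3 < 2 ^ w := by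
  calc _ ≤ 3 * n + 2 * ((n + 3) * (n * n)) + 3 := by gcongr
    _ < 8 * (n + 2) ^ 3 := by nlinarith [Nat.zero_le (n ^ 3), Nat.zero_le (n ^ 2)]
    _ ≤ 2 ^ 3 * (2 ^ (3 * g)) ^ 3 := Nat.mul_le_mul (by norm_num)
        (Nat.pow_le_pow_left (add_two_le_pow_three hg hn) 3)
    _ = 2 ^ (9 * g + 3) := by ring
    _ ≤ 2 ^ w := Nat.pow_le_pow_right (by norm_num) (by omega)

theorem levels_le (hg : 1 ≤ g) (hn : n < 2 ^ (g + 1)) {K : ℕ} (hK : ∀ k < K, 2 ^ k < n + 2) :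
    K ≤ g + 2 := by
  rcases K with _ | K
  · omega
  · exact (Nat.pow_lt_pow_iff_right (by norm_num : 1 < 2)).1
      ((hK K (by omega)).trans_le (add_two_le_pow hg hn))

theorem entries_lt (hg : 1 ≤ g) (hn : n < 2 ^ (g + 1)) {K m : ℕ} (hK : K ≤ g + 2)
    (hm : m ≤ n * n) : K * m < 2 ^ (6 * g) := by
  have h1 : g + 2 ≤ 2 ^ (g + 1) := (g + 1).lt_two_pow_self
  have h2 : m < 2 ^ (g + 1) * 2 ^ (g + 1) := hm.trans_lt (Nat.mul_lt_mul'' hn hn)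
  calc K * m < 2 ^ (g + 1) * (2 ^ (g + 1) * 2 ^ (g + 1)) :=
        Nat.mul_lt_mul_of_le_of_lt (hK.trans h1) h2 (by positivity)
    _ = 2 ^ (3 * g + 3) := by ring
    _ ≤ 2 ^ (6 * g) := Nat.pow_le_pow_right (by norm_num) (by omega)

end

/-! ### Reading back the data structure, and the main theorem -/

theorem builtData_getD {s : State} {i : ℕ} (hi : i < s.reg 0) :
    (builtData s).getD i 0 = s.arr 0 i := by
  simp [builtData, hi]

theorem builtData_length (s : State) : (builtData s).length = s.reg 0 := by
  simp [builtData]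

end DynDFS

theorem mainTheorem11 :
    ∃ (preprocess report : DynDFS.Prog) (c C : ℕ),
      ∀ (n : ℕ), 2 ≤ n → ∀ (w : ℕ), c * Nat.log 2 n ≤ w →
      ∀ (G : SimpleGraph (Fin n)) (E : List (Fin n × Fin n)), DynDFS.Lists E G.edgeSet →
      ∃ D : List ℕ,
        (∃ (s : DynDFS.State) (t : ℕ),
          DynDFS.Exec w preprocess
            (DynDFS.inputState [n, E.length] [DynDFS.fsts E, DynDFS.snds E]) s t ∧
          D = DynDFS.builtData s) ∧
        D.length ≤ C * (G.edgeSet.ncard * Nat.log 2 n) ∧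
        ∀ U : Finset (Sym2 (Fin n)), (∀ e ∈ U, ¬ e.IsDiag) → U.card ≤ n →
        ∀ L : List (Fin n × Fin n), DynDFS.Lists L (U : Set (Sym2 (Fin n))) →
          ∃ (s : DynDFS.State) (t : ℕ),
            DynDFS.Exec w report
              (DynDFS.inputState [n, D.length, L.length] [D, DynDFS.fsts L, DynDFS.snds L]) s t ∧
            t ≤ C * (n * Nat.log 2 n ^ 3) ∧
            DynDFS.ReportsDFSTree (DynDFS.insertEdges G U) s := by
  open DynDFS in
  refine ⟨preprocess, report, 40, 11500, fun n hn w hw G E hE => ?_⟩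
  have hg : 1 ≤ Nat.log 2 n := Nat.log_pos (by norm_num) hn
  have hng : n < 2 ^ (Nat.log 2 n + 1) := Nat.lt_pow_succ_log_self (by norm_num) n
  generalize Nat.log 2 n = g at *
  have hm : E.length ≤ n * n := hE.length_le
  have hword := word_bound hg hng hw
  have hindex := index_lt hg hng hw hm
  obtain ⟨s, t, hx, hs⟩ := preprocess_runs (w := w) (c := 3 * g)
    (s := inputState [n, E.length] [fsts E, snds E]) hn (fun u v => hE.edgeRel)
    (fun _ _ => rfl) (fun _ _ => rfl) rfl rfl rfl rfl rfl (fun _ => rfl) (fun _ => rfl)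
    hword (add_two_le_pow_three hg hng) (preprocessTime_lt hg hng hn hw hm) hindex
  refine ⟨builtData s, ⟨s, t, hx, rfl⟩, ?_, fun U hU hUn L hL => ?_⟩
  · rw [builtData_length, ← hE.length_eq]
    have h1 : E.length ≤ E.length * g := Nat.le_mul_of_pos_right _ hg
    rcases hs with ⟨-, h0, -⟩ | ⟨hnm, K, -, -, -, hK, h0, -⟩
    · omega
    -- There are at most `g + 2` levels, and `n ≤ m` absorbs the tree, so the size is at most `3 * m
    -- + (g + 2) * m`.
    · have hKm := Nat.mul_le_mul_right E.length (levels_le hg hng hK)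
      rw [add_mul, Nat.mul_comm g] at hKm
      omega
  · have hLn : L.length ≤ n := by
      rw [hL.length_eq, Set.ncard_coe_finset]
      exact hUn
    have hT := coreTime_le hg hn hLn
    have hlt := reportTime_lt hg hng hw
    have hdata : (∃ m < n, (builtData s).length = 2 * m ∧
          SparseData G (fun i => (builtData s).getD i 0) m) ∨
        ∃ M num par fin, (builtData s).length = 3 * n + M ∧
          DenseData G (fun i => (builtData s).getD i 0) M num par fin ∧ M < 2 ^ (6 * g) ∧
          3 * n + 2 * M + 3 < 2 ^ w := by
      rw [builtData_length]
      rcases hs with ⟨hmn, h0, hD⟩ | ⟨-, K, num, par, fin, hK, h0, hD⟩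
      · exact Or.inl ⟨_, hmn, h0, hD.congr fun i hi => builtData_getD (by omega)⟩
      · have hKg := levels_le hg hng hK
        have hKn : K ≤ n + 3 := by
          rcases K with _ | K
          · omega
          · have := hK K (by omega)
            have := K.lt_two_pow_self
            omega
        have := Nat.mul_le_mul_right E.length hKn
        exact Or.inr ⟨_, num, par, fin, h0, hD.congr fun i hi => builtData_getD (by omega),
          entries_lt hg hng hKg hm, by omega⟩
    obtain ⟨s', t', hx', ht', hR⟩ := report_runs (w := w) (b := 6 * g) (c := 3 * g)
      (s := inputState [n, (builtData s).length, L.length] [builtData s, fsts L, snds L])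
      (fun u v => natAdj_insertEdges hU hL) rfl rfl rfl rfl rfl rfl (fun _ => rfl) (fun _ => rfl)
      (fun _ _ => rfl) (fun _ _ => rfl) hdata hword (add_two_le_pow_three hg hng) (by omega)
    refine ⟨s', t', hx', ht'.trans (hT.trans (Nat.mul_le_mul_left _ (Nat.mul_le_mul_left _ ?_))),
      hR⟩
    -- The running time was bounded with `g ^ 2`; the claim allows `g ^ 3`.
    exact Nat.pow_le_pow_right hg (by norm_num)
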